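/- **Setting.** Formulae are built from the units $\mathsf f$ (false), $\mathsf t$ (true) and atoms by disjunction $[\alpha\vee\beta]$ and conjunction $(\alpha\wedge\beta)$; the set of atoms carries a fixed-point-free involution $a\mapsto\bar a$ (negation). System $\mathsf{SKS}$ has the rules (premiss $\to$ conclusion) - $\mathsf{ai}{\downarrow}:\ \mathsf t\to[a\vee\bar a]$, $\quad\mathsf{aw}{\downarrow}:\ \mathsf f\to a$, $\quad\mathsf{ac}{\downarrow}:\ [a\vee a]\to a$, - $\mathsf{ai}{\uparrow}$ (atomic cut)$:\ (a\wedge\bar a)\to\mathsf f$, $\quad\mathsf{aw}{\uparrow}:\ a\to\mathsf t$, $\quad\mathsf{ac}{\uparrow}:\ a\to(a\wedge a)$, - $\mathsf s:\ (\alpha\wedge[\beta\vee\gamma])\to[(\alpha\wedge\beta)\vee\gamma]$, $\quad\mathsf m:\ [(\alpha\wedge\beta)\vee(\gamma\wedge\delta)]\to([\alpha\vee\gamma]\wedge[\beta\vee\delta])$, - and the rule $=$, which replaces one side of an equation by the other, in either direction, for the equations expressing commutativity and associativity of $\vee$ and $\wedge$, and $[\alpha\vee\mathsf f]=\alpha$,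 $(\alpha\wedge\mathsf t)=\alpha$, $[\mathsf t\vee\mathsf t]=\mathsf t$, $(\mathsf f\wedge\mathsf f)=\mathsf f$. Every rule may be applied inside any context. A derivation in a set of rules is a finite chain of such inference steps (each given with its rule instance and its context); a proof of $\alpha$ is a derivation with premiss $\mathsf t$ and conclusion $\alpha$. The size of a derivation is the number of unit and atom occurrences in all its formulae. A running time $T$ is quasipolynomial if $T(n)\le 2^{c(\log n)^c+c}$ for some constant $c$ and all $n\ge1$. Algorithms treat atoms as symbols, which can be copied, compared and negated in unit time. **Theorem.** There is an algorithm that, given any proof $\Pi$ of any formula $\alpha$ in $\mathsf{SKS}$, constructs a proof of $\alpha$ in $\mathsf{SKS}\setminus\{\mathsf{ai}{\uparrow}\}$ in time quasipolynomial in the size of $\Pi$. -/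

import Mathlib

universe u

namespace DeepInference

/-- A set of atoms: a type with a fixed-point-free involution, called negation. -/
class AtomSet (A : Type u) where
  /-- The dual of an atom. -/
  dual : A → A
  dual_dual : ∀ a, dual (dual a) = a
  dual_ne : ∀ a, dual a ≠ a

/-- Formulae: units, atoms, disjunction, conjunction. Negation exists on atoms only. -/
inductive Formula (A : Type u) : Type u where
  | ff : Formula A
  | tt : Formula A
  | atom (a : A) : Formula A
  | disj (α β : Formula A) : Formula A
  | conj (α β : Formula A) : Formula A

/-- The number of unit and atom occurrences in a formula. -/
def Formula.size {A : Type u} : Formula A → ℕ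
  | .ff => 1
  | .tt => 1
  | .atom _ => 1
  | .disj α β => α.size + β.size
  | .conj α β => α.size + β.size

/-- Contexts: formulae with exactly one hole. -/
inductive Ctx (A : Type u) : Type u where
  | hole : Ctx A
  | disjL (ξ : Ctx A) (β : Formula A) : Ctx A
  | disjR (α : Formula A) (ξ : Ctx A) : Ctx A
  | conjL (ξ : Ctx A) (β : Formula A) : Ctx A
  | conjR (α : Formula A) (ξ : Ctx A) : Ctx A

/-- Filling the hole of a context by a formula. -/
def Ctx.fill {A : Type u} : Ctx A → Formula A → Formula A
  | .hole, γ => γ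
  | .disjL ξ β, γ => .disj (ξ.fill γ) β
  | .disjR α ξ, γ => .disj α (ξ.fill γ)
  | .conjL ξ β, γ => .conj (ξ.fill γ) β
  | .conjR α ξ, γ => .conj α (ξ.fill γ)

/-- The names of the inference rules of `SKS`: the structural rules (identity, weakening,
contraction, cut, coweakening, cocontraction), the logical rules (switch, medial), and the
rule `=`. -/
inductive Rule : Type where
  | aiDown
  | awDown
  | acDown
  | aiUp
  | awUp
  | acUp
  | switch
  | medial
  | eq

/-- Instances of the eight equations between formulae. -/
inductive EqInst (A : Type u) : Type u where
  | disjComm (α β : Formula A) : EqInst A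
  | conjComm (α β : Formula A) : EqInst A
  | disjAssoc (α β γ : Formula A) : EqInst A
  | conjAssoc (α β γ : Formula A) : EqInst A
  | disjFf (α : Formula A) : EqInst A
  | conjTt (α : Formula A) : EqInst A
  | disjTtTt : EqInst A
  | conjFfFf : EqInst A

/-- Left-hand side of an equation. -/
def EqInst.lhs {A : Type u} : EqInst A → Formula A
  | .disjComm α β => .disj α β
  | .conjComm α β => .conj α β
  | .disjAssoc α β γ => .disj (.disj α β) γ
  | .conjAssoc α β γ => .conj (.conj α β) γ
  | .disjFf α => .disj α .ff
  | .conjTt α => .conj α .tt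
  | .disjTtTt => .disj .tt .tt
  | .conjFfFf => .conj .ff .ff

/-- Right-hand side of an equation. -/
def EqInst.rhs {A : Type u} : EqInst A → Formula A
  | .disjComm α β => .disj β α
  | .conjComm α β => .conj β α
  | .disjAssoc α β γ => .disj α (.disj β γ)
  | .conjAssoc α β γ => .conj α (.conj β γ)
  | .disjFf α => α
  | .conjTt α => α
  | .disjTtTt => .tt
  | .conjFfFf => .ff

/-- Instances of the inference rules: a rule together with values for its schematic letters.
An instance of the rule `=` is an equation read in one of its two directions. -/
inductive Inst (A : Type u) : Type u where
  | aiDown (a : A) : Inst A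
  | awDown (a : A) : Inst A
  | acDown (a : A) : Inst A
  | aiUp (a : A) : Inst A
  | awUp (a : A) : Inst A
  | acUp (a : A) : Inst A
  | switch (α β γ : Formula A) : Inst A
  | medial (α β γ δ : Formula A) : Inst A
  | eqLR (e : EqInst A) : Inst A
  | eqRL (e : EqInst A) : Inst A

/-- The rule of which something is an instance. -/
def Inst.rule {A : Type u} : Inst A → Rule
  | .aiDown _ => .aiDown
  | .awDown _ => .awDown
  | .acDown _ => .acDown
  | .aiUp _ => .aiUp
  | .awUp _ => .awUp
  | .acUp _ => .acUp
  | .switch _ _ _ => .switch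
  | .medial _ _ _ _ => .medial
  | .eqLR _ => .eq
  | .eqRL _ => .eq

/-- The premiss of a rule instance. -/
def Inst.premiss {A : Type u} [AtomSet A] : Inst A → Formula A
  | .aiDown _ => .tt
  | .awDown _ => .ff
  | .acDown a => .disj (.atom a) (.atom a)
  | .aiUp a => .conj (.atom a) (.atom (AtomSet.dual a))
  | .awUp a => .atom a
  | .acUp a => .atom a
  | .switch α β γ => .conj α (.disj β γ)
  | .medial α β γ δ => .disj (.conj α β) (.conj γ δ)
  | .eqLR e => e.lhs
  | .eqRL e => e.rhs

/-- The conclusion of a rule instance. -/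
def Inst.conclusion {A : Type u} [AtomSet A] : Inst A → Formula A
  | .aiDown a => .disj (.atom a) (.atom (AtomSet.dual a))
  | .awDown a => .atom a
  | .acDown a => .atom a
  | .aiUp _ => .ff
  | .awUp _ => .tt
  | .acUp a => .conj (.atom a) (.atom a)
  | .switch α β γ => .disj (.conj α β) γ
  | .medial α β γ δ => .conj (.disj α γ) (.disj β δ)
  | .eqLR e => e.rhs
  | .eqRL e => e.lhs

/-- An inference step: a rule instance inside a context. -/
structure Step (A : Type u) : Type u where
  ctx : Ctx A
  inst : Inst A

/-- The formula above an inference step. -/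
def Step.premiss {A : Type u} [AtomSet A] (s : Step A) : Formula A :=
  s.ctx.fill s.inst.premiss

/-- The formula below an inference step. -/
def Step.conclusion {A : Type u} [AtomSet A] (s : Step A) : Formula A :=
  s.ctx.fill s.inst.conclusion

/-- `IsChain α l β`: the steps of `l`, in order, lead from `α` at the top to `β` at the
bottom. -/
def IsChain {A : Type u} [AtomSet A] : Formula A → List (Step A) → Formula A → Prop
  | α, [], β => α = β
  | α, s :: l, β => s.premiss = α ∧ IsChain s.conclusion l β

/-- The data of a derivation in the calculus of structures: the topmost formula and the
inference steps from top to bottom. -/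
structure Derivation (A : Type u) : Type u where
  premiss : Formula A
  steps : List (Step A)

/-- The number of unit and atom occurrences in all the formulae of a derivation. -/
def Derivation.size {A : Type u} [AtomSet A] (D : Derivation A) : ℕ :=
  D.premiss.size + (D.steps.map fun s => s.conclusion.size).sum

/-- `D` is a derivation from `α` to `β` in the proof system `S` (a set of rules). -/
def Derivation.IsDerivation {A : Type u} [AtomSet A] (S : Set Rule) (D : Derivation A)
    (α β : Formula A) : Prop :=
  D.premiss = α ∧ IsChain α D.steps β ∧ ∀ s ∈ D.steps, s.inst.rule ∈ S

/-- A proof of `α` in `S` is a derivation in `S` from the unit true to `α`. -/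
def Derivation.IsProof {A : Type u} [AtomSet A] (S : Set Rule) (D : Derivation A)
    (α : Formula A) : Prop :=
  D.IsDerivation S .tt α

/-- System `SKS`, which consists of all the rules listed above. -/
def SKS : Set Rule :=
  {.aiDown, .awDown, .acDown, .aiUp, .awUp, .acUp, .switch, .medial, .eq}

/-! A model of computation: programs of a first-order functional language with general
recursion, working on symbolic expressions whose leaves are `nil` or atoms. Atoms are
symbols: a program can copy an atom, compare two atoms for identity, and form the dual of an
atom, but has no other access to them. -/

/-- Symbolic expressions. -/
inductive SExp (A : Type u) : Type u where
  | nil : SExp A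
  | atom (a : A) : SExp A
  | cons (x y : SExp A) : SExp A

/-- The number of nodes of a symbolic expression. -/
def SExp.size {A : Type u} : SExp A → ℕ
  | .nil => 1
  | .atom _ => 1
  | .cons x y => x.size + y.size + 1

/-- Program expressions. Variables are de Bruijn indices into the environment. In
`letIn e e'` the variable 0 of `e'` is the value of `e`. In `case e e₀ e₁ e₂`, the branch `e₀`
is for `nil`, `e₁` for an atom (bound to variable 0), `e₂` for a pair (its components bound
to variables 0 and 1). The expression `ifEq e e' e₁ e₂` compares two atoms, and `call f e`
applies the function with number `f` to the value of `e`. -/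
inductive Expr : Type where
  | var (i : ℕ) : Expr
  | nil : Expr
  | cons (e e' : Expr) : Expr
  | letIn (e e' : Expr) : Expr
  | case (e e₀ e₁ e₂ : Expr) : Expr
  | dual (e : Expr) : Expr
  | ifEq (e e' e₁ e₂ : Expr) : Expr
  | call (f : ℕ) (e : Expr) : Expr

/-- A program is a finite list of the bodies of unary, mutually recursive functions, in
which variable 0 is the argument. The function with number 0 is the main one. -/
abbrev Program : Type := List Expr

/-- `Eval P env e v c`: in the environment `env`, the expression `e` of the program `P`
evaluates to `v` in time `c`. Evaluation is by value, each syntactic construct costs one unit of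
time, and reading a variable costs in addition the size of the value that is copied (so that
the size of every computed value is at most the time spent). -/
inductive Eval {A : Type u} [AtomSet A] (P : Program) :
    List (SExp A) → Expr → SExp A → ℕ → Prop where
  | var {env : List (SExp A)} {i : ℕ} {v : SExp A} (h : env[i]? = some v) :
      Eval P env (.var i) v (v.size + 1)
  | nil {env : List (SExp A)} : Eval P env .nil .nil 1
  | cons {env : List (SExp A)} {e e' : Expr} {v v' : SExp A} {c c' : ℕ}
      (h : Eval P env e v c) (h' : Eval P env e' v' c') :
      Eval P env (.cons e e') (.cons v v') (c + c' + 1)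
  | letIn {env : List (SExp A)} {e e' : Expr} {v w : SExp A} {c c' : ℕ}
      (h : Eval P env e v c) (h' : Eval P (v :: env) e' w c') :
      Eval P env (.letIn e e') w (c + c' + 1)
  | caseNil {env : List (SExp A)} {e e₀ e₁ e₂ : Expr} {w : SExp A} {c c' : ℕ}
      (h : Eval P env e .nil c) (h' : Eval P env e₀ w c') :
      Eval P env (.case e e₀ e₁ e₂) w (c + c' + 1)
  | caseAtom {env : List (SExp A)} {e e₀ e₁ e₂ : Expr} {a : A} {w : SExp A} {c c' : ℕ}
      (h : Eval P env e (.atom a) c) (h' : Eval P (.atom a :: env) e₁ w c') :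
      Eval P env (.case e e₀ e₁ e₂) w (c + c' + 1)
  | caseCons {env : List (SExp A)} {e e₀ e₁ e₂ : Expr} {x y w : SExp A} {c c' : ℕ}
      (h : Eval P env e (.cons x y) c) (h' : Eval P (x :: y :: env) e₂ w c') :
      Eval P env (.case e e₀ e₁ e₂) w (c + c' + 1)
  | dual {env : List (SExp A)} {e : Expr} {a : A} {c : ℕ}
      (h : Eval P env e (.atom a) c) :
      Eval P env (.dual e) (.atom (AtomSet.dual a)) (c + 1)
  | ifEqTrue {env : List (SExp A)} {e e' e₁ e₂ : Expr} {a : A} {w : SExp A} {c c' d : ℕ}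
      (h : Eval P env e (.atom a) c) (h' : Eval P env e' (.atom a) c')
      (k : Eval P env e₁ w d) :
      Eval P env (.ifEq e e' e₁ e₂) w (c + c' + d + 1)
  | ifEqFalse {env : List (SExp A)} {e e' e₁ e₂ : Expr} {a b : A} {w : SExp A} {c c' d : ℕ}
      (h : Eval P env e (.atom a) c) (h' : Eval P env e' (.atom b) c') (hab : a ≠ b)
      (k : Eval P env e₂ w d) :
      Eval P env (.ifEq e e' e₁ e₂) w (c + c' + d + 1)
  | call {env : List (SExp A)} {f : ℕ} {e body : Expr} {v w : SExp A} {c c' : ℕ}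
      (hf : P[f]? = some body) (h : Eval P env e v c) (h' : Eval P [v] body w c') :
      Eval P env (.call f e) w (c + c' + 1)

/-- On input `x`, the program `P` halts with output `y` within time `t`. -/
def Program.OutputsInTime {A : Type u} [AtomSet A] (P : Program) (x y : SExp A) (t : ℕ) :
    Prop :=
  ∃ c, Eval P [x] (.call 0 (.var 0)) y c ∧ c ≤ t

/-! Representation of derivations as symbolic expressions. -/

/-- A list of symbolic expressions as one symbolic expression. -/
def SExp.ofList {A : Type u} : List (SExp A) → SExp A
  | [] => .nil
  | x :: l => .cons x (SExp.ofList l)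

/-- The tag number `k`, in unary, followed by a list of arguments. -/
def SExp.node {A : Type u} (k : ℕ) (l : List (SExp A)) : SExp A :=
  .cons (SExp.ofList (List.replicate k .nil)) (SExp.ofList l)

/-- Encoding of formulae. -/
def Formula.encode {A : Type u} : Formula A → SExp A
  | .ff => .node 0 []
  | .tt => .node 1 []
  | .atom a => .atom a
  | .disj α β => .node 2 [α.encode, β.encode]
  | .conj α β => .node 3 [α.encode, β.encode]

/-- Encoding of contexts. -/
def Ctx.encode {A : Type u} : Ctx A → SExp A
  | .hole => .node 0 []
  | .disjL ξ β => .node 1 [ξ.encode, β.encode]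
  | .disjR α ξ => .node 2 [α.encode, ξ.encode]
  | .conjL ξ β => .node 3 [ξ.encode, β.encode]
  | .conjR α ξ => .node 4 [α.encode, ξ.encode]

/-- Encoding of instances of equations. -/
def EqInst.encode {A : Type u} : EqInst A → SExp A
  | .disjComm α β => .node 0 [α.encode, β.encode]
  | .conjComm α β => .node 1 [α.encode, β.encode]
  | .disjAssoc α β γ => .node 2 [α.encode, β.encode, γ.encode]
  | .conjAssoc α β γ => .node 3 [α.encode, β.encode, γ.encode]
  | .disjFf α => .node 4 [α.encode]
  | .conjTt α => .node 5 [α.encode]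
  | .disjTtTt => .node 6 []
  | .conjFfFf => .node 7 []

/-- Encoding of rule instances. -/
def Inst.encode {A : Type u} : Inst A → SExp A
  | .aiDown a => .node 0 [.atom a]
  | .awDown a => .node 1 [.atom a]
  | .acDown a => .node 2 [.atom a]
  | .aiUp a => .node 3 [.atom a]
  | .awUp a => .node 4 [.atom a]
  | .acUp a => .node 5 [.atom a]
  | .switch α β γ => .node 6 [α.encode, β.encode, γ.encode]
  | .medial α β γ δ => .node 7 [α.encode, β.encode, γ.encode, δ.encode]
  | .eqLR e => .node 8 [e.encode]
  | .eqRL e => .node 9 [e.encode]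

/-- Encoding of derivations: the premiss, followed by the list of the steps. -/
def Derivation.encode {A : Type u} (D : Derivation A) : SExp A :=
  .cons D.premiss.encode
    (SExp.ofList (D.steps.map fun s => .cons s.ctx.encode s.inst.encode))

/-- `T` is bounded by a quasipolynomial, that is, `T n` is `2 ^ ((log n) ^ O(1))`. -/
def IsQuasipolynomial (T : ℕ → ℕ) : Prop :=
  ∃ c : ℕ, ∀ n, T n ≤ 2 ^ (c * Nat.log 2 n ^ c + c)

end DeepInference

/-! Let Π be a proof of α, and let Tₖ be a formula without negation saying that at least k of the
cut atoms of Π, listed with repetitions, are true. Two cut-free derivations make these formulae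
useful. For every atom a there is Tₖ → Tₖ[a := f] ∨ a, because formulae are monotone in their atoms
(`Scr.act_ext`). For every listed atom a there is a ∧ Tₖ[a := f] → Tₖ₊₁, because an occurrence of a
that was counted as false now counts as true (`Threshold.adds_add`).

Of a pair a, ā of which at least one is listed, the atom that is listed first is taken to be
positive and the other one negative. In Π every negative ā is replaced by ā ∧ Tₖ[a := f]. An
identity on such a pair then follows from Tₖ. A cut need not be refuted: its premiss yields a ∧ Tₖ[a
:= f], hence Tₖ₊₁. All other rules survive, since switch, medial and the equations are schematic,
while weakening, contraction and their duals are derivable for arbitrary formulae (`Scr.act_inst`).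
Switch and associativity carry Tₖ into the context of a step and Tₖ₊₁ out of it (`Scr.act_within`).
Cocontraction supplies a Tₖ for every step and contraction gathers the Tₖ₊₁. So Π becomes a cut-free
slice α ∨ Tₖ → α ∨ Tₖ₊₁ (`Scr.act_slice`).

T₀ is provable. A threshold beyond the number of leaves is false even when all atoms, dual ones
included, are true, and such a formula derives f by coweakening (`Scr.act_refute`). Composing the
slices proves α (`Scr.act_cutFree`).

For the complexity, Tₖ is built along a balanced binary tree by convolution: Tₖ of a node is the
disjunction of Tᵢ ∧ Tₖ₋ᵢ of its two subtrees. One level multiplies the sizes by O(n), and the depth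
is logarithmic, so the formulae and the derivations between them have size n^O(log n)
(`Threshold.esize_vec_le`, `Threshold.esize_add_le`).

Two devices keep the formalisation manageable. Derivations are described by scripts, which name
rules and places but no formulae. A script is interpreted totally, an instruction that does not fit
being replaced by a harmless one, so every script gives a valid cut-free derivation from any formula
(`Scr.isChain`, `Scr.rule_ne`), and only its conclusion `Scr.act` has to be computed. Running times
are handled by the class `QPT`, which is closed under composition, case distinction and bounded
recursion (`QPT.rec_comp`), so that instance search assembles the program from the definitions. What
remains to be supplied for each recursion is an a priori bound on the values that occur in it. -/

set_option linter.unusedVariables false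
set_option linter.unusedSimpArgs false

universe v w v' w'

namespace DeepInference

/-! Quasipolynomial bounds. -/

/-- A family of quasipolynomial bounds, closed under sums, products and composition. -/
def qb (k n : ℕ) : ℕ := 2 ^ ((Nat.log 2 n + 2) ^ k)

theorem qb_mono {k l m n : ℕ} (hk : k ≤ l) (hn : m ≤ n) : qb k m ≤ qb l n := by
  unfold qb
  apply Nat.pow_le_pow_right (by norm_num)
  calc (Nat.log 2 m + 2) ^ k ≤ (Nat.log 2 m + 2) ^ l := Nat.pow_le_pow_right (by omega) hk
    _ ≤ (Nat.log 2 n + 2) ^ l :=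
      Nat.pow_le_pow_left (Nat.add_le_add_right (Nat.log_mono_right hn) 2) l

/-- A function is bounded by a quasipolynomial of the family `qb`. -/
def IsQP (g : ℕ → ℕ) : Prop := ∃ k, ∀ n, g n ≤ qb k n

theorem IsQP.mono {f g : ℕ → ℕ} (hg : IsQP g) (h : ∀ n, f n ≤ g n) : IsQP f := by
  obtain ⟨k, hk⟩ := hg
  exact ⟨k, fun n => (h n).trans (hk n)⟩

theorem isQP_qb (k : ℕ) : IsQP (qb k) := ⟨k, fun _ => le_rfl⟩

/-- In a product of two bounds `qb` the outer exponents add up; this absorbs their sum into a single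
power. -/
theorem pow_add_pow_le (x a b : ℕ) (hx : 2 ≤ x) : x ^ a + x ^ b ≤ x ^ (a + b + 1) := by
  have h1 : x ^ a ≤ x ^ (a + b) := Nat.pow_le_pow_right (by omega) (by omega)
  have h2 : x ^ b ≤ x ^ (a + b) := Nat.pow_le_pow_right (by omega) (by omega)
  rw [pow_succ]
  have := Nat.mul_le_mul_left (x ^ (a + b)) hx
  omega

theorem IsQP.mul {f g : ℕ → ℕ} (hf : IsQP f) (hg : IsQP g) : IsQP (fun n => f n * g n) := by
  obtain ⟨k, hk⟩ := hf
  obtain ⟨l, hl⟩ := hg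
  refine ⟨k + l + 1, fun n => (Nat.mul_le_mul (hk n) (hl n)).trans ?_⟩
  unfold qb
  rw [← pow_add]
  exact Nat.pow_le_pow_right (by norm_num) (pow_add_pow_le _ _ _ (by omega))

theorem IsQP.add {f g : ℕ → ℕ} (hf : IsQP f) (hg : IsQP g) : IsQP (fun n => f n + g n) := by
  obtain ⟨k, hk⟩ := hf
  obtain ⟨l, hl⟩ := hg
  obtain ⟨j, hj⟩ := (isQP_qb k).mul (isQP_qb l)
  refine ⟨j, fun n => le_trans ?_ (hj n)⟩
  have h1 : 2 ≤ qb k n := by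
    unfold qb; exact Nat.le_self_pow (by positivity) 2
  have h2 : 2 ≤ qb l n := by
    unfold qb; exact Nat.le_self_pow (by positivity) 2
  have := hk n
  have := hl n
  simp only
  nlinarith

theorem isQP_const (c : ℕ) : IsQP (fun _ => c) := by
  refine ⟨c, fun n => ?_⟩
  unfold qb
  calc c ≤ 2 ^ c := Nat.lt_two_pow_self.le
    _ ≤ (Nat.log 2 n + 2) ^ c := Nat.pow_le_pow_left (by omega) c
    _ ≤ _ := Nat.lt_two_pow_self.le

theorem isQP_id : IsQP (fun n => n) := by
  refine ⟨1, fun n => ?_⟩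
  unfold qb
  rw [pow_one]
  refine (Nat.lt_pow_succ_log_self (b := 2) (by norm_num) n).le.trans ?_
  exact Nat.pow_le_pow_right (by norm_num) (by omega)

/-- The logarithm of the inner bound is (log n + 2) ^ l, so composition multiplies the exponents.
The additional 2 in (l + 2) * k absorbs the summand 2 inside `qb`. -/
theorem IsQP.qb_comp {f : ℕ → ℕ} (hf : IsQP f) (k : ℕ) : IsQP (fun n => qb k (f n)) := by
  obtain ⟨l, hl⟩ := hf
  refine ⟨(l + 2) * k, fun n => (qb_mono le_rfl (hl n)).trans ?_⟩
  unfold qb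
  rw [Nat.log_pow (by norm_num), pow_mul]
  refine Nat.pow_le_pow_right (by norm_num) (Nat.pow_le_pow_left ?_ k)
  set x := Nat.log 2 n + 2 with hx
  have h2 : 2 ≤ x := by omega
  have h1 : 1 ≤ x ^ l := Nat.one_le_pow _ _ (by omega)
  calc x ^ l + 2 ≤ x ^ l * 4 := by omega
    _ ≤ x ^ l * x ^ 2 := Nat.mul_le_mul le_rfl (by nlinarith)
    _ = _ := (pow_add _ _ _).symm

theorem IsQP.comp {f g : ℕ → ℕ} (hg : IsQP g) (hf : IsQP f) : IsQP (fun n => g (f n)) := by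
  obtain ⟨k, hk⟩ := hg
  exact (hf.qb_comp k).mono fun n => hk _

theorem IsQP.pow {f : ℕ → ℕ} (hf : IsQP f) (c : ℕ) : IsQP (fun n => f n ^ c) := by
  induction c with
  | zero => simpa using isQP_const 1
  | succ c ih => simpa only [pow_succ] using ih.mul hf

/-- This is the growth along a tree of logarithmic depth, with one factor per level. It raises the
exponent of the bound by one. -/
theorem IsQP.pow_log {f : ℕ → ℕ} (hf : IsQP f) : IsQP (fun n => f n ^ (Nat.log 2 n + 2)) := by
  obtain ⟨k, hk⟩ := hf
  refine ⟨k + 1, fun n => (Nat.pow_le_pow_left (hk n) _).trans ?_⟩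
  unfold qb
  rw [← pow_mul, ← pow_succ]

theorem isQuasipolynomial_of_isQP {T : ℕ → ℕ} (h : IsQP T) : IsQuasipolynomial T := by
  obtain ⟨k, hk⟩ := h
  -- If log n ≥ 1, then log n + 2 ≤ 3 log n, which costs the factor 3 ^ k. If log n = 0, the
  -- additive constant takes over.
  refine ⟨3 ^ k, fun n => (hk n).trans ?_⟩
  unfold qb
  apply Nat.pow_le_pow_right (by norm_num)
  have hk3 : k ≤ 3 ^ k := Nat.lt_pow_self (by norm_num) |>.le
  rcases Nat.eq_zero_or_pos (Nat.log 2 n) with h0 | h0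
  · rw [h0, zero_add]
    exact (Nat.pow_le_pow_left (by norm_num) k).trans (Nat.le_add_left _ _)
  · calc (Nat.log 2 n + 2) ^ k ≤ (3 * Nat.log 2 n) ^ k := Nat.pow_le_pow_left (by omega) k
      _ = 3 ^ k * Nat.log 2 n ^ k := mul_pow _ _ _
      _ ≤ 3 ^ k * Nat.log 2 n ^ 3 ^ k :=
        Nat.mul_le_mul le_rfl (Nat.pow_le_pow_right h0 hk3)
      _ ≤ _ := Nat.le_add_right _ _

/-! Evaluation within a time bound. -/

theorem SExp.one_le_size {A : Type u} (x : SExp A) : 1 ≤ x.size := by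
  cases x <;> simp [SExp.size]

section Evaluation

variable {A : Type u} [AtomSet A]

/-- Since reading a variable is charged by the size of its value, time bounds size. Each time bound
thereby also bounds the output. -/
theorem Eval.size_le {P : Program} {env : List (SExp A)} {e : Expr} {v : SExp A} {c : ℕ}
    (h : Eval P env e v c) : v.size ≤ c := by
  induction h <;> (try simp only [SExp.size] at *) <;> omega

/-- Evaluation within time `c`. -/
def Ev (P : Program) (env : List (SExp A)) (e : Expr) (v : SExp A) (c : ℕ) : Prop :=
  ∃ c' ≤ c, Eval P env e v c'

/-- The function with number `i` maps `x` to `y` within time `c`. -/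
def Fn (P : Program) (i : ℕ) (x y : SExp A) (c : ℕ) : Prop :=
  ∃ body, P[i]? = some body ∧ Ev P [x] body y c

variable {P : Program} {env : List (SExp A)} {e e' e₀ e₁ e₂ : Expr} {i : ℕ}
  {x y v v' w : SExp A} {c c' c'' : ℕ}

theorem Ev.mono (h : Ev P env e v c) (hc : c ≤ c') : Ev P env e v c' :=
  let ⟨d, hd, h⟩ := h; ⟨d, hd.trans hc, h⟩

theorem Ev.size_le (h : Ev P env e v c) : v.size ≤ c :=
  let ⟨_, hd, h⟩ := h; h.size_le.trans hd

theorem Fn.mono (h : Fn P i x y c) (hc : c ≤ c') : Fn P i x y c' :=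
  let ⟨b, hb, h⟩ := h; ⟨b, hb, h.mono hc⟩

theorem Fn.size_le (h : Fn P i x y c) : y.size ≤ c := let ⟨_, _, h⟩ := h; h.size_le

theorem Ev.var (h : env[i]? = some v) : Ev P env (.var i) v (v.size + 1) :=
  ⟨_, le_rfl, .var h⟩

theorem Ev.nil : Ev P env .nil .nil 1 := ⟨_, le_rfl, .nil⟩

theorem Ev.cons (h : Ev P env e v c) (h' : Ev P env e' v' c') :
    Ev P env (.cons e e') (.cons v v') (c + c' + 1) :=
  let ⟨_, hd, h⟩ := h; let ⟨_, hd', h'⟩ := h'; ⟨_, by omega, .cons h h'⟩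

theorem Ev.letIn (h : Ev P env e v c) (h' : Ev P (v :: env) e' w c') :
    Ev P env (.letIn e e') w (c + c' + 1) :=
  let ⟨_, hd, h⟩ := h; let ⟨_, hd', h'⟩ := h'; ⟨_, by omega, .letIn h h'⟩

theorem Ev.caseNil (h : Ev P env e .nil c) (h' : Ev P env e₀ w c') :
    Ev P env (.case e e₀ e₁ e₂) w (c + c' + 1) :=
  let ⟨_, hd, h⟩ := h; let ⟨_, hd', h'⟩ := h'; ⟨_, by omega, .caseNil h h'⟩

theorem Ev.caseAtom {a : A} (h : Ev P env e (.atom a) c) (h' : Ev P (.atom a :: env) e₁ w c') :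
    Ev P env (.case e e₀ e₁ e₂) w (c + c' + 1) :=
  let ⟨_, hd, h⟩ := h; let ⟨_, hd', h'⟩ := h'; ⟨_, by omega, .caseAtom h h'⟩

theorem Ev.caseCons (h : Ev P env e (.cons x y) c) (h' : Ev P (x :: y :: env) e₂ w c') :
    Ev P env (.case e e₀ e₁ e₂) w (c + c' + 1) :=
  let ⟨_, hd, h⟩ := h; let ⟨_, hd', h'⟩ := h'; ⟨_, by omega, .caseCons h h'⟩

theorem Ev.dual {a : A} (h : Ev P env e (.atom a) c) :
    Ev P env (.dual e) (.atom (AtomSet.dual a)) (c + 1) :=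
  let ⟨_, hd, h⟩ := h; ⟨_, by omega, .dual h⟩

theorem Ev.ifEqTrue {a : A} (h : Ev P env e (.atom a) c) (h' : Ev P env e' (.atom a) c')
    (k : Ev P env e₁ w c'') : Ev P env (.ifEq e e' e₁ e₂) w (c + c' + c'' + 1) :=
  let ⟨_, hd, h⟩ := h; let ⟨_, hd', h'⟩ := h'; let ⟨_, hd'', k⟩ := k
  ⟨_, by omega, .ifEqTrue h h' k⟩

theorem Ev.ifEqFalse {a b : A} (h : Ev P env e (.atom a) c) (h' : Ev P env e' (.atom b) c')
    (hab : a ≠ b) (k : Ev P env e₂ w c'') :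
    Ev P env (.ifEq e e' e₁ e₂) w (c + c' + c'' + 1) :=
  let ⟨_, hd, h⟩ := h; let ⟨_, hd', h'⟩ := h'; let ⟨_, hd'', k⟩ := k
  ⟨_, by omega, .ifEqFalse h h' hab k⟩

theorem Ev.call (hf : Fn P i v w c') (h : Ev P env e v c) :
    Ev P env (.call i e) w (c + c' + 1) :=
  let ⟨_, hb, _, hd', h'⟩ := hf; let ⟨_, hd, h⟩ := h; ⟨_, by omega, .call hb h h'⟩

end Evaluation

/-! Relations (partial functions) on symbolic expressions that are computable in quasipolynomial
time, uniformly in the set of atoms. -/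

/-- For every set of atoms, relations between symbolic expressions that depend on a bound. -/
abbrev SRel : Type (u + 1) := ∀ (A : Type u) [AtomSet A], ℕ → SExp A → SExp A → Prop

/-- Some function of a program that can be placed at any address computes, whenever `S A b x y`,
from `x` the value `y` in time quasipolynomial in `b`. -/
def Comp (S : SRel.{u}) : Prop :=
  ∃ k, ∀ n, ∃ (Q : Program) (i : ℕ), ∀ P R : Program, P.length = n →
    ∀ (A : Type u) [AtomSet A] (b : ℕ) (x y : SExp A), S A b x y →
      Fn (P ++ Q ++ R) i x y (qb k b)

theorem Comp.mono {S T : SRel.{u}} (hT : Comp T) {g : ℕ → ℕ} (hg : IsQP g)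
    (h : ∀ (A : Type u) [AtomSet A] (b : ℕ) (x y : SExp A), S A b x y → T A (g b) x y) :
    Comp S := by
  obtain ⟨k, hk⟩ := hT
  obtain ⟨K, hK⟩ := hg.qb_comp k
  refine ⟨K, fun n => ?_⟩
  obtain ⟨Q, i, hQ⟩ := hk n
  exact ⟨Q, i, fun P R hP A _ b x y hxy => (hQ P R hP A _ x y (h A b x y hxy)).mono (hK b)⟩

/-- The functions with numbers `i 0`, `i 1`, … compute the relations of the list `l`. -/
def Lib (P : Program) (i : ℕ → ℕ) (k : ℕ) (A : Type u) [AtomSet A] (l : List SRel.{u}) : Prop :=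
  ∀ (j : ℕ) (S : SRel.{u}), l[j]? = some S → ∀ (b : ℕ) (x y : SExp A),
    S A b x y → Fn P (i j) x y (qb k b)

/-- Calls refer to absolute function numbers, so a fragment has to be compiled for the length of the
program in front of it. The fragments are laid out one after another, each compiled for the address
where the preceding ones end. -/
theorem Comp.list (l : List SRel.{u}) (hl : ∀ S ∈ l, Comp S) :
    ∃ k, ∀ n, ∃ (Q : Program) (i : ℕ → ℕ), ∀ P R : Program, P.length = n →
      ∀ (A : Type u) [AtomSet A], Lib (P ++ Q ++ R) i k A l := by
  induction l with
  | nil => exact ⟨0, fun n => ⟨[], fun _ => 0, by simp [Lib]⟩⟩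
  | cons T l ih =>
    obtain ⟨k₁, h₁⟩ := hl T (by simp)
    obtain ⟨k₂, h₂⟩ := ih fun S hS => hl S (by simp [hS])
    refine ⟨max k₁ k₂, fun n => ?_⟩
    obtain ⟨Q₁, i₁, h₁⟩ := h₁ n
    obtain ⟨Q₂, i₂, h₂⟩ := h₂ (n + Q₁.length)
    refine ⟨Q₁ ++ Q₂, fun j => if j = 0 then i₁ else i₂ (j - 1),
      fun P R hP A _ j S hj b x y hxy => ?_⟩
    rcases j with _ | j
    · have hST : T = S := by simpa using hj
      subst hST
      have := h₁ P (Q₂ ++ R) hP A b x y hxy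
      simp only [List.append_assoc] at this ⊢
      exact this.mono (qb_mono (le_max_left _ _) le_rfl)
    · have := h₂ (P ++ Q₁) R (by simp [hP]) A j S (by simpa using hj) b x y hxy
      simp only [List.append_assoc] at this ⊢
      simpa using this.mono (qb_mono (le_max_right _ _) le_rfl)

/-- A relation is computable if a function body computes it that calls itself and functions for
computable relations. -/
theorem Comp.of_body {S : SRel.{u}} (l : List SRel.{u}) (hl : ∀ S ∈ l, Comp S)
    (body : (ℕ → ℕ) → ℕ → Expr)
    (h : ∀ k, ∃ g, IsQP g ∧ ∀ (P : Program) (i : ℕ → ℕ) (self : ℕ),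
      P[self]? = some (body i self) → ∀ (A : Type u) [AtomSet A], Lib P i k A l →
      ∀ (b : ℕ) (x y : SExp A), S A b x y → Fn P self x y (g b)) : Comp S := by
  obtain ⟨k, hk⟩ := Comp.list l hl
  obtain ⟨g, ⟨K, hg⟩, hK⟩ := h k
  refine ⟨K, fun n => ?_⟩
  obtain ⟨Q, i, hQ⟩ := hk n
  -- The new body is placed behind its library. Its own number is thus known in advance, which is
  -- what permits recursive calls.
  refine ⟨Q ++ [body i (n + Q.length)], n + Q.length, fun P R hP A _ b x y hxy => ?_⟩
  refine (hK _ i _ ?_ A (fun j T hT b x y hxy => ?_) b x y hxy).mono (hg b)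
  · simp [← hP]
  · simpa using hQ P ([body i (n + Q.length)] ++ R) hP A j T hT b x y hxy

/-- The case of a body without recursive calls: it suffices to evaluate the body. -/
theorem Comp.of_expr {S : SRel.{u}} (l : List SRel.{u}) (hl : ∀ S ∈ l, Comp S)
    (body : (ℕ → ℕ) → Expr)
    (h : ∀ k, ∃ g, IsQP g ∧ ∀ (P : Program) (i : ℕ → ℕ) (A : Type u) [AtomSet A],
      Lib P i k A l → ∀ (b : ℕ) (x y : SExp A), S A b x y → Ev P [x] (body i) y (g b)) :
    Comp S := by
  refine Comp.of_body l hl (fun i _ => body i) fun k => ?_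
  obtain ⟨g, hg, hK⟩ := h k
  exact ⟨g, hg, fun P i self hs A _ hl b x y hxy => ⟨_, hs, hK P i A hl b x y hxy⟩⟩

end DeepInference

namespace DeepInference

/-! Encodings of data that depend on a set of atoms. -/

/-- A type whose elements are represented by symbolic expressions with leaves in `A`. -/
class Enc (A : Type u) (X : Type v) where
  /-- The representation. -/
  enc : X → SExp A

open Enc

instance (A : Type u) : Enc A (SExp A) := ⟨id⟩
instance (A : Type u) : Enc A A := ⟨.atom⟩
instance (A : Type u) : Enc A Unit := ⟨fun _ => .nil⟩
instance (A : Type u) : Enc A Bool := ⟨fun b => if b then .cons .nil .nil else .nil⟩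
instance (A : Type u) (X : Type v) (Y : Type w) [Enc A X] [Enc A Y] : Enc A (X × Y) :=
  ⟨fun p => .cons (enc p.1) (enc p.2)⟩
instance (A : Type u) (X : Type v) [Enc A X] : Enc A (List X) := ⟨fun l => .ofList (l.map enc)⟩
instance (A : Type u) : Enc A (Formula A) := ⟨Formula.encode⟩
instance (A : Type u) : Enc A (Ctx A) := ⟨Ctx.encode⟩
instance (A : Type u) : Enc A (EqInst A) := ⟨EqInst.encode⟩
instance (A : Type u) : Enc A (Inst A) := ⟨Inst.encode⟩
instance (A : Type u) : Enc A (Step A) := ⟨fun s => .cons s.ctx.encode s.inst.encode⟩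
instance (A : Type u) : Enc A (Derivation A) := ⟨Derivation.encode⟩

/-- The size of the representation. -/
def esize (A : Type u) {X : Type v} [Enc A X] (x : X) : ℕ := (enc x : SExp A).size

/-- The relation between representations of arguments and values of a function. -/
def graph {X : Type u → Type v} {Y : Type u → Type w} [∀ A, Enc A (X A)] [∀ A, Enc A (Y A)]
    (f : ∀ (A : Type u) [AtomSet A], X A → Y A) : SRel.{u} :=
  fun A _ b x y => x.size ≤ b ∧ ∃ a : X A, x = enc a ∧ y = enc (f A a)

/-- Functions computable in quasipolynomial time, uniformly in the set of atoms. -/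
class QPT {X : Type u → Type v} {Y : Type u → Type w} [∀ A, Enc A (X A)] [∀ A, Enc A (Y A)]
    (f : ∀ (A : Type u) [AtomSet A], X A → Y A) : Prop where
  comp : Comp (graph f)

section

variable {X : Type u → Type v} {Y : Type u → Type w} {Z : Type u → Type v'} {W : Type u → Type w'}
  [∀ A, Enc A (X A)] [∀ A, Enc A (Y A)] [∀ A, Enc A (Z A)] [∀ A, Enc A (W A)]
  {f : ∀ (A : Type u) [AtomSet A], X A → Y A} {g : ∀ (A : Type u) [AtomSet A], X A → Z A}
  {h : ∀ (A : Type u) [AtomSet A], X A → W A}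

/-- The running time bounds the size of the output. This controls compositions, where the second
program runs on an output of the first. -/
theorem QPT.exists_size_le (hf : QPT f) : ∃ q, IsQP q ∧ Monotone q ∧ ∀ (A : Type u) [AtomSet A] (x : X A),
    esize A (f A x) ≤ q (esize A x) := by
  obtain ⟨k, hk⟩ := hf.comp
  obtain ⟨Q, i, hQ⟩ := hk 0
  exact ⟨qb k, isQP_qb k, fun m n h => qb_mono le_rfl h, fun A _ x =>
    (hQ [] [] rfl A _ (enc x) (enc (f A x)) ⟨le_rfl, x, rfl, rfl⟩).size_le⟩

/-- Two functions with the same representations of arguments and values. -/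
theorem QPT.of_enc {X' : Type u → Type v'} {Y' : Type u → Type w'}
    [∀ A, Enc A (X' A)] [∀ A, Enc A (Y' A)]
    {f' : ∀ (A : Type u) [AtomSet A], X' A → Y' A} (hf' : QPT f')
    (h : ∀ (A : Type u) [AtomSet A] (x : X A), ∃ x' : X' A,
      (enc x : SExp A) = enc x' ∧ (enc (f A x) : SExp A) = enc (f' A x')) : QPT f := by
  refine ⟨hf'.comp.mono isQP_id fun A _ b x y hxy => ?_⟩
  obtain ⟨hb, a, rfl, rfl⟩ := hxy
  obtain ⟨x', h1, h2⟩ := h A a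
  exact ⟨hb, x', h1, h2⟩

theorem QPT.of_eq {f' : ∀ (A : Type u) [AtomSet A], X A → Y A} (hf : QPT f)
    (h : ∀ (A : Type u) [AtomSet A] (x : X A), f' A x = f A x) : QPT f' :=
  hf.of_enc fun A _ x => ⟨x, rfl, by rw [h]⟩

instance (priority := 2000) QPT.id : QPT (fun (A : Type u) _ (x : X A) => x) := by
  refine ⟨Comp.of_expr [] (by simp) (fun _ => .var 0) fun k =>
    ⟨fun b => b + 1, isQP_id.add (isQP_const 1), ?_⟩⟩
  rintro P i A _ - b _ _ ⟨hb, a, rfl, rfl⟩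
  exact (Ev.var rfl).mono (by dsimp only; omega)

theorem QPT.const_nil : QPT (fun (A : Type u) _ (_ : X A) => (SExp.nil : SExp A)) := by
  refine ⟨Comp.of_expr [] (by simp) (fun _ => .nil) fun k => ⟨fun _ => 1, isQP_const 1, ?_⟩⟩
  rintro P i A _ - b _ _ ⟨hb, a, rfl, rfl⟩
  exact Ev.nil

theorem Comp.compose {S T U : SRel.{u}} (hS : Comp S) (hT : Comp T) {q : ℕ → ℕ} (hq : IsQP q)
    (h : ∀ (A : Type u) [AtomSet A] b x z, U A b x z → x.size ≤ b ∧ ∃ y,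
      S A b x y ∧ T A (q b) y z) : Comp U := by
  refine Comp.of_expr [S, T] (by simp [hS, hT]) (fun i => .call (i 1) (.call (i 0) (.var 0)))
    fun k => ⟨fun b => (b + 1 + qb k b + 1) + qb k (q b) + 1,
      (((isQP_id.add (isQP_const 1)).add (isQP_qb k)).add (isQP_const 1)).add (hq.qb_comp k)
        |>.add (isQP_const 1), ?_⟩
  rintro P i A _ hl b x z hU
  obtain ⟨hb, y, h0, h1⟩ := h A b x z hU
  have h0 := hl 0 _ rfl b x y h0
  have h1 := hl 1 _ rfl (q b) y z h1
  exact (Ev.call h1 (Ev.call h0 (Ev.var rfl))).mono (by dsimp only; omega)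

theorem QPT.compose {g : ∀ (A : Type u) [AtomSet A], Y A → Z A} (hg : QPT g) (hf : QPT f) :
    QPT (fun A _ x => g A (f A x)) := by
  obtain ⟨q, hq, hqm, hq'⟩ := hf.exists_size_le
  refine ⟨hf.comp.compose hg.comp hq ?_⟩
  rintro A _ b _ _ ⟨hb, a, rfl, rfl⟩
  exact ⟨hb, enc (f A a), ⟨hb, a, rfl, rfl⟩, (hq' A a).trans (hqm hb), f A a, rfl, rfl⟩

instance QPT.pair [hf : QPT f] [hg : QPT g] : QPT (fun A _ x => (f A x, g A x)) := by
  refine ⟨Comp.of_expr [graph f, graph g] (by simp [hf.comp, hg.comp])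
    (fun i => .cons (.call (i 0) (.var 0)) (.call (i 1) (.var 0)))
    fun k => ⟨fun b => 2 * (b + 1 + qb k b + 1) + 1, ?_, ?_⟩⟩
  · exact ((isQP_const 2).mul (((isQP_id.add (isQP_const 1)).add (isQP_qb k)).add
      (isQP_const 1))).add (isQP_const 1)
  rintro P i A _ hl b _ _ ⟨hb, a, rfl, rfl⟩
  have h0 := hl 0 _ rfl b (enc a) _ ⟨hb, a, rfl, rfl⟩
  have h1 := hl 1 _ rfl b (enc a) _ ⟨hb, a, rfl, rfl⟩
  exact (Ev.cons (Ev.call h0 (Ev.var rfl)) (Ev.call h1 (Ev.var rfl))).mono (by dsimp only; omega)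

theorem QPT.fst' : QPT (fun (A : Type u) _ (x : X A × Y A) => x.1) := by
  refine ⟨Comp.of_expr [] (by simp) (fun _ => .case (.var 0) .nil .nil (.var 0)) fun k =>
    ⟨fun b => 2 * (b + 1) + 1, ((isQP_const 2).mul (isQP_id.add (isQP_const 1))).add
      (isQP_const 1), ?_⟩⟩
  rintro P i A _ - b _ _ ⟨hb, ⟨a, a'⟩, rfl, rfl⟩
  refine (Ev.caseCons (Ev.var rfl) (Ev.var rfl)).mono ?_
  simp only [enc, SExp.size] at hb ⊢
  omega

theorem QPT.snd' : QPT (fun (A : Type u) _ (x : X A × Y A) => x.2) := by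
  refine ⟨Comp.of_expr [] (by simp) (fun _ => .case (.var 0) .nil .nil (.var 1)) fun k =>
    ⟨fun b => 2 * (b + 1) + 1, ((isQP_const 2).mul (isQP_id.add (isQP_const 1))).add
      (isQP_const 1), ?_⟩⟩
  rintro P i A _ - b _ _ ⟨hb, ⟨a, a'⟩, rfl, rfl⟩
  refine (Ev.caseCons (Ev.var rfl) (Ev.var rfl)).mono ?_
  simp only [enc, SExp.size] at hb ⊢
  omega

instance QPT.fst {f : ∀ (A : Type u) [AtomSet A], X A → Y A × Z A} [hf : QPT f] :
    QPT (fun A _ x => (f A x).1) := QPT.fst'.compose hf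

instance QPT.snd {f : ∀ (A : Type u) [AtomSet A], X A → Y A × Z A} [hf : QPT f] :
    QPT (fun A _ x => (f A x).2) := QPT.snd'.compose hf

theorem QPT.dual' : QPT (fun (A : Type u) _ (a : A) => AtomSet.dual a) := by
  refine ⟨Comp.of_expr [] (by simp) (fun _ => .dual (.var 0)) fun k =>
    ⟨fun _ => 3, isQP_const 3, ?_⟩⟩
  rintro P i A _ - b _ _ ⟨hb, a, rfl, rfl⟩
  exact (Ev.dual (Ev.var rfl)).mono (by simp [SExp.size])

instance QPT.dual {f : ∀ (A : Type u) [AtomSet A], X A → A} [hf : QPT f] :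
    QPT (fun A _ x => AtomSet.dual (f A x)) := QPT.dual'.compose hf

/-- Equality of atoms. -/
noncomputable def aeq {A : Type u} (a b : A) : Bool := open Classical in decide (a = b)

theorem QPT.aeq' : QPT (fun (A : Type u) _ (p : A × A) => aeq p.1 p.2) := by
  refine ⟨Comp.of_expr [] (by simp) (fun _ => .case (.var 0) .nil .nil
    (.ifEq (.var 0) (.var 1) (.cons .nil .nil) .nil)) fun k =>
    ⟨fun _ => 20, isQP_const 20, ?_⟩⟩
  rintro P i A _ - b _ _ ⟨hb, ⟨a, a'⟩, rfl, rfl⟩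
  by_cases h : a = a'
  · subst h
    have h1 : (enc (aeq a a) : SExp A) = .cons .nil .nil := by simp [aeq, enc]
    simp only [h1]
    exact (Ev.caseCons (Ev.var rfl) (Ev.ifEqTrue (a := a) (Ev.var rfl) (Ev.var rfl)
      (Ev.cons Ev.nil Ev.nil))).mono (by simp [enc, SExp.size])
  · have h1 : (enc (aeq a a') : SExp A) = .nil := by simp [aeq, h, enc]
    simp only [h1]
    exact (Ev.caseCons (Ev.var rfl) (Ev.ifEqFalse (Ev.var rfl) (Ev.var rfl) h Ev.nil)).mono
      (by simp [enc, SExp.size])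

instance QPT.aeq {f g : ∀ (A : Type u) [AtomSet A], X A → A} [hf : QPT f] [hg : QPT g] :
    QPT (fun A _ x => DeepInference.aeq (f A x) (g A x)) := QPT.aeq'.compose (QPT.pair (f := f) (g := g))

instance QPT.cond {c : ∀ (A : Type u) [AtomSet A], X A → Bool}
    {f g : ∀ (A : Type u) [AtomSet A], X A → Y A} [hc : QPT c] [hf : QPT f] [hg : QPT g] :
    QPT (fun A _ x => bif c A x then f A x else g A x) := by
  refine ⟨Comp.of_expr [graph c, graph f, graph g] (by simp [hc.comp, hf.comp, hg.comp])
    -- The encoding of `true` is a pair, whose branch binds two variables; there the argument has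
    -- become variable 2.
    (fun i => .case (.call (i 0) (.var 0)) (.call (i 2) (.var 0)) .nil (.call (i 1) (.var 2)))
    fun k => ⟨fun b => 2 * (b + 1 + qb k b + 1) + 1, ?_, ?_⟩⟩
  · exact ((isQP_const 2).mul (((isQP_id.add (isQP_const 1)).add (isQP_qb k)).add
      (isQP_const 1))).add (isQP_const 1)
  rintro P i A _ hl b _ _ ⟨hb, a, rfl, rfl⟩
  have h0 := hl 0 _ rfl b (enc a) _ ⟨hb, a, rfl, rfl⟩
  have h1 := hl 1 _ rfl b (enc a) _ ⟨hb, a, rfl, rfl⟩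
  have h2 := hl 2 _ rfl b (enc a) _ ⟨hb, a, rfl, rfl⟩
  cases hca : c A a
  · replace h0 : Fn P (i 0) (enc a : SExp A) .nil (qb k b) := by rw [hca] at h0; exact h0
    simp only [hca, cond_false]
    refine Ev.mono (Ev.caseNil (Ev.call h0 (Ev.var rfl)) (Ev.call h2 (Ev.var rfl))) ?_
    omega
  · replace h0 : Fn P (i 0) (enc a : SExp A) (.cons .nil .nil) (qb k b) := by rw [hca] at h0; exact h0
    simp only [hca, cond_true]
    refine Ev.mono (Ev.caseCons (Ev.call h0 (Ev.var rfl)) (Ev.call h1 (Ev.var rfl))) ?_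
    omega

end

/-- For the branches of a case distinction that no encoding reaches. -/
theorem Comp.empty : Comp (fun (_ : Type u) _ _ _ _ => False) :=
  Comp.of_expr [] (by simp) (fun _ => .nil) fun _ => ⟨fun _ => 0, isQP_const 0, by simp⟩

/-- Relations between `(z, node k l)` and values, by cases on whether `k` is zero or a successor. -/
inductive NodeCase (S T : SRel.{u}) : SRel.{u}
  | zero {A : Type u} [AtomSet A] {b : ℕ} {z l y : SExp A} (hb : z.size + l.size + 3 ≤ b)
      (h : S A b (.cons z l) y) : NodeCase S T A b (.cons z (.cons .nil l)) y
  | succ {A : Type u} [AtomSet A] {b : ℕ} {z t l y : SExp A} (hb : z.size + l.size + t.size + 4 ≤ b)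
      (h : T A b (.cons z (.cons t l)) y) :
      NodeCase S T A b (.cons z (.cons (.cons .nil t) l)) y

theorem Comp.nodeCase {S T : SRel.{u}} (hS : Comp S) (hT : Comp T) : Comp (NodeCase S T) := by
  refine Comp.of_expr [S, T] (by simp [hS, hT])
    (fun i => .case (.var 0) .nil .nil (.case (.var 1) .nil .nil
      (.case (.var 0) (.call (i 0) (.cons (.var 2) (.var 1))) .nil
        (.call (i 1) (.cons (.var 4) (.cons (.var 1) (.var 3)))))))
    fun k => ⟨fun b => 20 * (b + 1) + qb k b, ?_, ?_⟩
  · exact ((isQP_const 20).mul (isQP_id.add (isQP_const 1))).add (isQP_qb k)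
  rintro P i A _ hl b _ _ (⟨hb, h⟩ | ⟨hb, h⟩)
  · have h := hl 0 _ rfl _ _ _ h
    refine (Ev.caseCons (Ev.var rfl) (Ev.caseCons (Ev.var rfl) (Ev.caseNil (Ev.var rfl)
      (Ev.call h (Ev.cons (Ev.var rfl) (Ev.var rfl)))))).mono ?_
    simp only [SExp.size]
    omega
  · have h := hl 1 _ rfl _ _ _ h
    refine (Ev.caseCons (Ev.var rfl) (Ev.caseCons (Ev.var rfl) (Ev.caseCons (Ev.var rfl)
      (Ev.call h (Ev.cons (Ev.var rfl) (Ev.cons (Ev.var rfl) (Ev.var rfl))))))).mono ?_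
    simp only [SExp.size]
    omega

end DeepInference

/-! ### Computability of case distinctions on encoded data. -/

namespace DeepInference
open Enc

/-- Relations between `(z, s)` and values, by cases on the shape of `s`. -/
inductive ShapeCase (S T U : SRel.{u}) : SRel.{u}
  | nil {A : Type u} [AtomSet A] {b : ℕ} {z y : SExp A} (hb : z.size + (SExp.nil : SExp A).size + 1 ≤ b)
      (h : S A b (.cons z .nil) y) : ShapeCase S T U A b (.cons z .nil) y
  | atom {A : Type u} [AtomSet A] {b : ℕ} {z y : SExp A} {a : A} (hb : z.size + (SExp.atom a).size + 1 ≤ b)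
      (h : T A b (.cons z (.atom a)) y) : ShapeCase S T U A b (.cons z (.atom a)) y
  | cons {A : Type u} [AtomSet A] {b : ℕ} {z s t y : SExp A} (hb : z.size + (SExp.cons s t).size + 1 ≤ b)
      (h : U A b (.cons z (.cons s t)) y) : ShapeCase S T U A b (.cons z (.cons s t)) y

theorem Comp.shapeCase {S T U : SRel.{u}} (hS : Comp S) (hT : Comp T) (hU : Comp U) :
    Comp (ShapeCase S T U) := by
  refine Comp.of_expr [S, T, U] (by simp [hS, hT, hU])
    (fun i => .case (.var 0) .nil .nil (.case (.var 1) (.call (i 0) (.var 2))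
      (.call (i 1) (.var 3)) (.call (i 2) (.var 4))))
    fun k => ⟨fun b => 20 * (b + 1) + qb k b, ?_, ?_⟩
  · exact ((isQP_const 20).mul (isQP_id.add (isQP_const 1))).add (isQP_qb k)
  rintro P i A _ hl b _ _ (⟨hb, h⟩ | ⟨hb, h⟩ | ⟨hb, h⟩)
  · have h := hl 0 _ rfl _ _ _ h
    refine (Ev.caseCons (Ev.var rfl) (Ev.caseNil (Ev.var rfl) (Ev.call h (Ev.var rfl)))).mono ?_
    simp only [SExp.size] at hb ⊢
    omega
  · have h := hl 1 _ rfl _ _ _ h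
    refine (Ev.caseCons (Ev.var rfl) (Ev.caseAtom (Ev.var rfl) (Ev.call h (Ev.var rfl)))).mono ?_
    simp only [SExp.size] at hb ⊢
    omega
  · have h := hl 2 _ rfl _ _ _ h
    refine (Ev.caseCons (Ev.var rfl) (Ev.caseCons (Ev.var rfl) (Ev.call h (Ev.var rfl)))).mono ?_
    simp only [SExp.size] at hb ⊢
    omega

/-- Relations between `(z, node k l)` and values, by cases on the number `k`. -/
def nodeCases : List SRel.{u} → SRel.{u}
  | [] => fun _ _ _ _ _ => False
  | S :: l => NodeCase S (nodeCases l)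

theorem Comp.nodeCases {l : List SRel.{u}} (hl : ∀ S ∈ l, Comp S) :
    Comp (DeepInference.nodeCases l) := by
  induction l with
  | nil => exact Comp.empty
  | cons S l ih =>
    exact Comp.nodeCase (hl S (by simp)) (ih fun T hT => hl T (by simp [hT]))

/-- Each level of `nodeCases` strips one unit from the unary tag. When the tag is used up, the
parameter z and the list of arguments remain, and together they have to be the encoding of p. -/
theorem nodeCases_graph {A : Type u} [AtomSet A] {X : Type u → Type v} {Y : Type u → Type w}
    [∀ A, Enc A (X A)] [∀ A, Enc A (Y A)] {f : ∀ (A : Type u) [AtomSet A], X A → Y A}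
    {l : List SRel.{u}} {k : ℕ} {z y : SExp A} {m : List (SExp A)} {b : ℕ}
    (hb : z.size + (SExp.node k m).size + 1 ≤ b)
    (hk : l[k]? = some (graph f)) (p : X A) (hp : enc p = .cons z (SExp.ofList m))
    (hy : y = enc (f A p)) : nodeCases l A b (.cons z (.node k m)) y := by
  induction l generalizing k with
  | nil => simp at hk
  | cons S l ih =>
    cases k with
    | zero =>
      have hS : S = graph f := by simpa using hk
      subst hS
      simp only [SExp.node, List.replicate, SExp.ofList, SExp.size] at hb
      exact .zero (by omega) ⟨by simp only [SExp.size]; omega, p, hp.symm, hy⟩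
    | succ k =>
      simp only [SExp.node, List.replicate, SExp.ofList, SExp.size] at hb
      refine .succ (by omega) (ih ?_ (by simpa using hk))
      simp only [SExp.node, SExp.size]
      omega

section

variable {X : Type u → Type v} {Y : Type u → Type w} {Z : Type u → Type v'}
  [∀ A, Enc A (X A)] [∀ A, Enc A (Y A)] [∀ A, Enc A (Z A)]

/-- The analysed value is first paired with the whole argument x, so that the branches still have
access to x. -/
theorem QPT.of_case {s : ∀ (A : Type u) [AtomSet A], X A → Y A} (hs : QPT s)
    {f : ∀ (A : Type u) [AtomSet A], X A → Z A} {T : SRel.{u}} (hT : Comp T)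
    (h : ∀ (A : Type u) [AtomSet A] (x : X A) (b : ℕ),
      (enc x : SExp A).size + (enc (s A x) : SExp A).size + 1 ≤ b →
        T A b (.cons (enc x) (enc (s A x))) (enc (f A x))) : QPT f := by
  have hp : QPT (fun A _ x => (x, s A x)) := inferInstance
  obtain ⟨q, hq, hqm, hq'⟩ := hp.exists_size_le
  refine ⟨hp.comp.compose hT hq ?_⟩
  rintro A _ b _ _ ⟨hb, x, rfl, rfl⟩
  exact ⟨hb, _, ⟨hb, x, rfl, rfl⟩, h A x (q b) ((hq' A x).trans (hqm hb))⟩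

/-- Case distinction on a list. -/
def listElim {Y : Type w} {Z : Type v} (l : List Y) (z : Z) (s : Y → List Y → Z) : Z :=
  match l with
  | [] => z
  | y :: l => s y l

instance QPT.listElim {l : ∀ (A : Type u) [AtomSet A], X A → List (Y A)}
    {f : ∀ (A : Type u) [AtomSet A], X A → Z A}
    {g : ∀ (A : Type u) [AtomSet A], X A → Y A → List (Y A) → Z A}
    [hl : QPT l] [hf : QPT f]
    [hg : QPT (fun A _ (p : X A × Y A × List (Y A)) => g A p.1 p.2.1 p.2.2)] :
    QPT (fun A _ x => listElim (l A x) (f A x) (fun y m => g A x y m)) := by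
  have h1 : QPT (fun A _ (p : X A × Unit) => f A p.1) := hf.compose inferInstance
  refine QPT.of_case hl (Comp.shapeCase h1.comp Comp.empty hg.comp) fun A _ x b hb => ?_
  generalize l A x = m at hb ⊢
  cases m with
  | nil => exact .nil hb ⟨hb, (x, ()), rfl, rfl⟩
  | cons y m => exact .cons hb ⟨hb, (x, y, m), rfl, rfl⟩

/-- Case distinction on a formula. -/
def Formula.elim {A : Type u} {Z : Type v} (x : Formula A)
    (f0 : Z) (f1 : Z) (f2 : A → Z) (f3 : Formula A → Formula A → Z) (f4 : Formula A → Formula A → Z) : Z :=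
  match x with
  | .ff => f0
  | .tt => f1
  | .atom α => f2 α
  | .disj α β => f3 α β
  | .conj α β => f4 α β

instance QPT.formulaElim {s : ∀ (A : Type u) [AtomSet A], X A → Formula A}
    {f0 : ∀ (A : Type u) [AtomSet A], X A → Z A}
    {f1 : ∀ (A : Type u) [AtomSet A], X A → Z A}
    {f2 : ∀ (A : Type u) [AtomSet A], X A → A → Z A}
    {f3 : ∀ (A : Type u) [AtomSet A], X A → Formula A → Formula A → Z A}
    {f4 : ∀ (A : Type u) [AtomSet A], X A → Formula A → Formula A → Z A}
    [hs : QPT s] [hf0 : QPT f0] [hf1 : QPT f1]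
    [hf2 : QPT (fun A _ (p : X A × A) => f2 A p.1 p.2)]
    [hf3 : QPT (fun A _ (p : X A × Formula A × Formula A) => f3 A p.1 p.2.1 p.2.2)]
    [hf4 : QPT (fun A _ (p : X A × Formula A × Formula A) => f4 A p.1 p.2.1 p.2.2)] :
    QPT (fun A _ x => (s A x).elim (f0 A x) (f1 A x)
      (fun α => f2 A x α)
      (fun α β => f3 A x α β)
      (fun α β => f4 A x α β)) := by
  -- The list of arguments of a node ends in `nil`, which is the encoding of the trailing component
  -- of type `Unit`.
  have ef0 : QPT (fun A _ (p : X A × Unit) => f0 A p.1) :=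
    hf0.compose (f := fun A _ (p : X A × Unit) => p.1) inferInstance
  have ef1 : QPT (fun A _ (p : X A × Unit) => f1 A p.1) :=
    hf1.compose (f := fun A _ (p : X A × Unit) => p.1) inferInstance
  have ef3 : QPT (fun A _ (p : X A × Formula A × Formula A × Unit) => f3 A p.1 p.2.1 p.2.2.1) :=
    hf3.compose (f := fun A _ (p : X A × Formula A × Formula A × Unit) => (p.1, p.2.1, p.2.2.1)) inferInstance
  have ef4 : QPT (fun A _ (p : X A × Formula A × Formula A × Unit) => f4 A p.1 p.2.1 p.2.2.1) :=
    hf4.compose (f := fun A _ (p : X A × Formula A × Formula A × Unit) => (p.1, p.2.1, p.2.2.1)) inferInstance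
  -- An atomic formula is encoded by a bare atom and every other formula by a node, so the shape is
  -- inspected before the tag.
  refine QPT.of_case hs (Comp.shapeCase Comp.empty hf2.comp (Comp.nodeCases (l := [graph _, graph _, graph _, graph _]) (by
    simp only [List.mem_cons, List.not_mem_nil, or_false, forall_eq_or_imp, forall_eq]
    exact ⟨ef0.comp, ef1.comp, ef3.comp, ef4.comp⟩))) fun A _ x b hb => ?_
  generalize s A x = m at hb ⊢
  cases m with
  | ff => exact .cons hb (nodeCases_graph (k := 0) hb rfl (x, ()) rfl rfl)
  | tt => exact .cons hb (nodeCases_graph (k := 1) hb rfl (x, ()) rfl rfl)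
  | atom α => exact .atom hb ⟨hb, (x, α), rfl, rfl⟩
  | disj α β => exact .cons hb (nodeCases_graph (k := 2) hb rfl (x, α, β, ()) rfl rfl)
  | conj α β => exact .cons hb (nodeCases_graph (k := 3) hb rfl (x, α, β, ()) rfl rfl)

/-- Case distinction on a context. -/
def Ctx.elim {A : Type u} {Z : Type v} (x : Ctx A)
    (f0 : Z) (f1 : Ctx A → Formula A → Z) (f2 : Formula A → Ctx A → Z) (f3 : Ctx A → Formula A → Z) (f4 : Formula A → Ctx A → Z) : Z :=
  match x with
  | .hole => f0
  | .disjL α β => f1 α β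
  | .disjR α β => f2 α β
  | .conjL α β => f3 α β
  | .conjR α β => f4 α β

instance QPT.ctxElim {s : ∀ (A : Type u) [AtomSet A], X A → Ctx A}
    {f0 : ∀ (A : Type u) [AtomSet A], X A → Z A}
    {f1 : ∀ (A : Type u) [AtomSet A], X A → Ctx A → Formula A → Z A}
    {f2 : ∀ (A : Type u) [AtomSet A], X A → Formula A → Ctx A → Z A}
    {f3 : ∀ (A : Type u) [AtomSet A], X A → Ctx A → Formula A → Z A}
    {f4 : ∀ (A : Type u) [AtomSet A], X A → Formula A → Ctx A → Z A}
    [hs : QPT s] [hf0 : QPT f0]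
    [hf1 : QPT (fun A _ (p : X A × Ctx A × Formula A) => f1 A p.1 p.2.1 p.2.2)]
    [hf2 : QPT (fun A _ (p : X A × Formula A × Ctx A) => f2 A p.1 p.2.1 p.2.2)]
    [hf3 : QPT (fun A _ (p : X A × Ctx A × Formula A) => f3 A p.1 p.2.1 p.2.2)]
    [hf4 : QPT (fun A _ (p : X A × Formula A × Ctx A) => f4 A p.1 p.2.1 p.2.2)] :
    QPT (fun A _ x => (s A x).elim (f0 A x)
      (fun α β => f1 A x α β)
      (fun α β => f2 A x α β)
      (fun α β => f3 A x α β)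
      (fun α β => f4 A x α β)) := by
  have ef0 : QPT (fun A _ (p : X A × Unit) => f0 A p.1) :=
    hf0.compose (f := fun A _ (p : X A × Unit) => p.1) inferInstance
  have ef1 : QPT (fun A _ (p : X A × Ctx A × Formula A × Unit) => f1 A p.1 p.2.1 p.2.2.1) :=
    hf1.compose (f := fun A _ (p : X A × Ctx A × Formula A × Unit) => (p.1, p.2.1, p.2.2.1)) inferInstance
  have ef2 : QPT (fun A _ (p : X A × Formula A × Ctx A × Unit) => f2 A p.1 p.2.1 p.2.2.1) :=
    hf2.compose (f := fun A _ (p : X A × Formula A × Ctx A × Unit) => (p.1, p.2.1, p.2.2.1)) inferInstance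
  have ef3 : QPT (fun A _ (p : X A × Ctx A × Formula A × Unit) => f3 A p.1 p.2.1 p.2.2.1) :=
    hf3.compose (f := fun A _ (p : X A × Ctx A × Formula A × Unit) => (p.1, p.2.1, p.2.2.1)) inferInstance
  have ef4 : QPT (fun A _ (p : X A × Formula A × Ctx A × Unit) => f4 A p.1 p.2.1 p.2.2.1) :=
    hf4.compose (f := fun A _ (p : X A × Formula A × Ctx A × Unit) => (p.1, p.2.1, p.2.2.1)) inferInstance
  refine QPT.of_case hs (Comp.nodeCases (l := [graph _, graph _, graph _, graph _, graph _]) (by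
    simp only [List.mem_cons, List.not_mem_nil, or_false, forall_eq_or_imp, forall_eq]
    exact ⟨ef0.comp, ef1.comp, ef2.comp, ef3.comp, ef4.comp⟩)) fun A _ x b hb => ?_
  generalize s A x = m at hb ⊢
  cases m with
  | hole => exact nodeCases_graph (k := 0) hb rfl (x, ()) rfl rfl
  | disjL α β => exact nodeCases_graph (k := 1) hb rfl (x, α, β, ()) rfl rfl
  | disjR α β => exact nodeCases_graph (k := 2) hb rfl (x, α, β, ()) rfl rfl
  | conjL α β => exact nodeCases_graph (k := 3) hb rfl (x, α, β, ()) rfl rfl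
  | conjR α β => exact nodeCases_graph (k := 4) hb rfl (x, α, β, ()) rfl rfl

/-- Case distinction on an instance of an equation. -/
def EqInst.elim {A : Type u} {Z : Type v} (x : EqInst A)
    (f0 : Formula A → Formula A → Z) (f1 : Formula A → Formula A → Z) (f2 : Formula A → Formula A → Formula A → Z) (f3 : Formula A → Formula A → Formula A → Z) (f4 : Formula A → Z) (f5 : Formula A → Z) (f6 : Z) (f7 : Z) : Z :=
  match x with
  | .disjComm α β => f0 α β
  | .conjComm α β => f1 α β
  | .disjAssoc α β γ => f2 α β γ
  | .conjAssoc α β γ => f3 α β γ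
  | .disjFf α => f4 α
  | .conjTt α => f5 α
  | .disjTtTt => f6
  | .conjFfFf => f7

instance QPT.eqInstElim {s : ∀ (A : Type u) [AtomSet A], X A → EqInst A}
    {f0 : ∀ (A : Type u) [AtomSet A], X A → Formula A → Formula A → Z A}
    {f1 : ∀ (A : Type u) [AtomSet A], X A → Formula A → Formula A → Z A}
    {f2 : ∀ (A : Type u) [AtomSet A], X A → Formula A → Formula A → Formula A → Z A}
    {f3 : ∀ (A : Type u) [AtomSet A], X A → Formula A → Formula A → Formula A → Z A}
    {f4 : ∀ (A : Type u) [AtomSet A], X A → Formula A → Z A}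
    {f5 : ∀ (A : Type u) [AtomSet A], X A → Formula A → Z A}
    {f6 : ∀ (A : Type u) [AtomSet A], X A → Z A}
    {f7 : ∀ (A : Type u) [AtomSet A], X A → Z A}
    [hs : QPT s]
    [hf0 : QPT (fun A _ (p : X A × Formula A × Formula A) => f0 A p.1 p.2.1 p.2.2)]
    [hf1 : QPT (fun A _ (p : X A × Formula A × Formula A) => f1 A p.1 p.2.1 p.2.2)]
    [hf2 : QPT (fun A _ (p : X A × Formula A × Formula A × Formula A) => f2 A p.1 p.2.1 p.2.2.1 p.2.2.2)]
    [hf3 : QPT (fun A _ (p : X A × Formula A × Formula A × Formula A) => f3 A p.1 p.2.1 p.2.2.1 p.2.2.2)]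
    [hf4 : QPT (fun A _ (p : X A × Formula A) => f4 A p.1 p.2)]
    [hf5 : QPT (fun A _ (p : X A × Formula A) => f5 A p.1 p.2)] [hf6 : QPT f6] [hf7 : QPT f7] :
    QPT (fun A _ x => (s A x).elim
      (fun α β => f0 A x α β)
      (fun α β => f1 A x α β)
      (fun α β γ => f2 A x α β γ)
      (fun α β γ => f3 A x α β γ)
      (fun α => f4 A x α)
      (fun α => f5 A x α) (f6 A x) (f7 A x)) := by
  have ef0 : QPT (fun A _ (p : X A × Formula A × Formula A × Unit) => f0 A p.1 p.2.1 p.2.2.1) :=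
    hf0.compose (f := fun A _ (p : X A × Formula A × Formula A × Unit) => (p.1, p.2.1, p.2.2.1)) inferInstance
  have ef1 : QPT (fun A _ (p : X A × Formula A × Formula A × Unit) => f1 A p.1 p.2.1 p.2.2.1) :=
    hf1.compose (f := fun A _ (p : X A × Formula A × Formula A × Unit) => (p.1, p.2.1, p.2.2.1)) inferInstance
  have ef2 : QPT (fun A _ (p : X A × Formula A × Formula A × Formula A × Unit) => f2 A p.1 p.2.1 p.2.2.1 p.2.2.2.1) :=
    hf2.compose (f := fun A _ (p : X A × Formula A × Formula A × Formula A × Unit) => (p.1, p.2.1, p.2.2.1, p.2.2.2.1)) inferInstance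
  have ef3 : QPT (fun A _ (p : X A × Formula A × Formula A × Formula A × Unit) => f3 A p.1 p.2.1 p.2.2.1 p.2.2.2.1) :=
    hf3.compose (f := fun A _ (p : X A × Formula A × Formula A × Formula A × Unit) => (p.1, p.2.1, p.2.2.1, p.2.2.2.1)) inferInstance
  have ef4 : QPT (fun A _ (p : X A × Formula A × Unit) => f4 A p.1 p.2.1) :=
    hf4.compose (f := fun A _ (p : X A × Formula A × Unit) => (p.1, p.2.1)) inferInstance
  have ef5 : QPT (fun A _ (p : X A × Formula A × Unit) => f5 A p.1 p.2.1) :=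
    hf5.compose (f := fun A _ (p : X A × Formula A × Unit) => (p.1, p.2.1)) inferInstance
  have ef6 : QPT (fun A _ (p : X A × Unit) => f6 A p.1) :=
    hf6.compose (f := fun A _ (p : X A × Unit) => p.1) inferInstance
  have ef7 : QPT (fun A _ (p : X A × Unit) => f7 A p.1) :=
    hf7.compose (f := fun A _ (p : X A × Unit) => p.1) inferInstance
  refine QPT.of_case hs (Comp.nodeCases (l := [graph _, graph _, graph _, graph _, graph _, graph _, graph _, graph _]) (by
    simp only [List.mem_cons, List.not_mem_nil, or_false, forall_eq_or_imp, forall_eq]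
    exact ⟨ef0.comp, ef1.comp, ef2.comp, ef3.comp, ef4.comp, ef5.comp, ef6.comp, ef7.comp⟩)) fun A _ x b hb => ?_
  generalize s A x = m at hb ⊢
  cases m with
  | disjComm α β => exact nodeCases_graph (k := 0) hb rfl (x, α, β, ()) rfl rfl
  | conjComm α β => exact nodeCases_graph (k := 1) hb rfl (x, α, β, ()) rfl rfl
  | disjAssoc α β γ => exact nodeCases_graph (k := 2) hb rfl (x, α, β, γ, ()) rfl rfl
  | conjAssoc α β γ => exact nodeCases_graph (k := 3) hb rfl (x, α, β, γ, ()) rfl rfl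
  | disjFf α => exact nodeCases_graph (k := 4) hb rfl (x, α, ()) rfl rfl
  | conjTt α => exact nodeCases_graph (k := 5) hb rfl (x, α, ()) rfl rfl
  | disjTtTt => exact nodeCases_graph (k := 6) hb rfl (x, ()) rfl rfl
  | conjFfFf => exact nodeCases_graph (k := 7) hb rfl (x, ()) rfl rfl

/-- Case distinction on a rule instance. -/
def Inst.elim {A : Type u} {Z : Type v} (x : Inst A)
    (f0 : A → Z) (f1 : A → Z) (f2 : A → Z) (f3 : A → Z) (f4 : A → Z) (f5 : A → Z) (f6 : Formula A → Formula A → Formula A → Z) (f7 : Formula A → Formula A → Formula A → Formula A → Z) (f8 : EqInst A → Z) (f9 : EqInst A → Z) : Z :=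
  match x with
  | .aiDown α => f0 α
  | .awDown α => f1 α
  | .acDown α => f2 α
  | .aiUp α => f3 α
  | .awUp α => f4 α
  | .acUp α => f5 α
  | .switch α β γ => f6 α β γ
  | .medial α β γ δ => f7 α β γ δ
  | .eqLR α => f8 α
  | .eqRL α => f9 α

instance QPT.instElim {s : ∀ (A : Type u) [AtomSet A], X A → Inst A}
    {f0 : ∀ (A : Type u) [AtomSet A], X A → A → Z A}
    {f1 : ∀ (A : Type u) [AtomSet A], X A → A → Z A}
    {f2 : ∀ (A : Type u) [AtomSet A], X A → A → Z A}
    {f3 : ∀ (A : Type u) [AtomSet A], X A → A → Z A}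
    {f4 : ∀ (A : Type u) [AtomSet A], X A → A → Z A}
    {f5 : ∀ (A : Type u) [AtomSet A], X A → A → Z A}
    {f6 : ∀ (A : Type u) [AtomSet A], X A → Formula A → Formula A → Formula A → Z A}
    {f7 : ∀ (A : Type u) [AtomSet A], X A → Formula A → Formula A → Formula A → Formula A → Z A}
    {f8 : ∀ (A : Type u) [AtomSet A], X A → EqInst A → Z A}
    {f9 : ∀ (A : Type u) [AtomSet A], X A → EqInst A → Z A}
    [hs : QPT s]
    [hf0 : QPT (fun A _ (p : X A × A) => f0 A p.1 p.2)]
    [hf1 : QPT (fun A _ (p : X A × A) => f1 A p.1 p.2)]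
    [hf2 : QPT (fun A _ (p : X A × A) => f2 A p.1 p.2)]
    [hf3 : QPT (fun A _ (p : X A × A) => f3 A p.1 p.2)]
    [hf4 : QPT (fun A _ (p : X A × A) => f4 A p.1 p.2)]
    [hf5 : QPT (fun A _ (p : X A × A) => f5 A p.1 p.2)]
    [hf6 : QPT (fun A _ (p : X A × Formula A × Formula A × Formula A) => f6 A p.1 p.2.1 p.2.2.1 p.2.2.2)]
    [hf7 : QPT (fun A _ (p : X A × Formula A × Formula A × Formula A × Formula A) => f7 A p.1 p.2.1 p.2.2.1 p.2.2.2.1 p.2.2.2.2)]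
    [hf8 : QPT (fun A _ (p : X A × EqInst A) => f8 A p.1 p.2)]
    [hf9 : QPT (fun A _ (p : X A × EqInst A) => f9 A p.1 p.2)] :
    QPT (fun A _ x => (s A x).elim
      (fun α => f0 A x α)
      (fun α => f1 A x α)
      (fun α => f2 A x α)
      (fun α => f3 A x α)
      (fun α => f4 A x α)
      (fun α => f5 A x α)
      (fun α β γ => f6 A x α β γ)
      (fun α β γ δ => f7 A x α β γ δ)
      (fun α => f8 A x α)
      (fun α => f9 A x α)) := by
  have ef0 : QPT (fun A _ (p : X A × A × Unit) => f0 A p.1 p.2.1) :=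
    hf0.compose (f := fun A _ (p : X A × A × Unit) => (p.1, p.2.1)) inferInstance
  have ef1 : QPT (fun A _ (p : X A × A × Unit) => f1 A p.1 p.2.1) :=
    hf1.compose (f := fun A _ (p : X A × A × Unit) => (p.1, p.2.1)) inferInstance
  have ef2 : QPT (fun A _ (p : X A × A × Unit) => f2 A p.1 p.2.1) :=
    hf2.compose (f := fun A _ (p : X A × A × Unit) => (p.1, p.2.1)) inferInstance
  have ef3 : QPT (fun A _ (p : X A × A × Unit) => f3 A p.1 p.2.1) :=
    hf3.compose (f := fun A _ (p : X A × A × Unit) => (p.1, p.2.1)) inferInstance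
  have ef4 : QPT (fun A _ (p : X A × A × Unit) => f4 A p.1 p.2.1) :=
    hf4.compose (f := fun A _ (p : X A × A × Unit) => (p.1, p.2.1)) inferInstance
  have ef5 : QPT (fun A _ (p : X A × A × Unit) => f5 A p.1 p.2.1) :=
    hf5.compose (f := fun A _ (p : X A × A × Unit) => (p.1, p.2.1)) inferInstance
  have ef6 : QPT (fun A _ (p : X A × Formula A × Formula A × Formula A × Unit) => f6 A p.1 p.2.1 p.2.2.1 p.2.2.2.1) :=
    hf6.compose (f := fun A _ (p : X A × Formula A × Formula A × Formula A × Unit) => (p.1, p.2.1, p.2.2.1, p.2.2.2.1)) inferInstance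
  have ef7 : QPT (fun A _ (p : X A × Formula A × Formula A × Formula A × Formula A × Unit) => f7 A p.1 p.2.1 p.2.2.1 p.2.2.2.1 p.2.2.2.2.1) :=
    hf7.compose (f := fun A _ (p : X A × Formula A × Formula A × Formula A × Formula A × Unit) => (p.1, p.2.1, p.2.2.1, p.2.2.2.1, p.2.2.2.2.1)) inferInstance
  have ef8 : QPT (fun A _ (p : X A × EqInst A × Unit) => f8 A p.1 p.2.1) :=
    hf8.compose (f := fun A _ (p : X A × EqInst A × Unit) => (p.1, p.2.1)) inferInstance
  have ef9 : QPT (fun A _ (p : X A × EqInst A × Unit) => f9 A p.1 p.2.1) :=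
    hf9.compose (f := fun A _ (p : X A × EqInst A × Unit) => (p.1, p.2.1)) inferInstance
  refine QPT.of_case hs (Comp.nodeCases (l := [graph _, graph _, graph _, graph _, graph _, graph _, graph _, graph _, graph _, graph _]) (by
    simp only [List.mem_cons, List.not_mem_nil, or_false, forall_eq_or_imp, forall_eq]
    exact ⟨ef0.comp, ef1.comp, ef2.comp, ef3.comp, ef4.comp, ef5.comp, ef6.comp, ef7.comp, ef8.comp, ef9.comp⟩)) fun A _ x b hb => ?_
  generalize s A x = m at hb ⊢
  cases m with
  | aiDown α => exact nodeCases_graph (k := 0) hb rfl (x, α, ()) rfl rfl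
  | awDown α => exact nodeCases_graph (k := 1) hb rfl (x, α, ()) rfl rfl
  | acDown α => exact nodeCases_graph (k := 2) hb rfl (x, α, ()) rfl rfl
  | aiUp α => exact nodeCases_graph (k := 3) hb rfl (x, α, ()) rfl rfl
  | awUp α => exact nodeCases_graph (k := 4) hb rfl (x, α, ()) rfl rfl
  | acUp α => exact nodeCases_graph (k := 5) hb rfl (x, α, ()) rfl rfl
  | switch α β γ => exact nodeCases_graph (k := 6) hb rfl (x, α, β, γ, ()) rfl rfl
  | medial α β γ δ => exact nodeCases_graph (k := 7) hb rfl (x, α, β, γ, δ, ()) rfl rfl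
  | eqLR α => exact nodeCases_graph (k := 8) hb rfl (x, α, ()) rfl rfl
  | eqRL α => exact nodeCases_graph (k := 9) hb rfl (x, α, ()) rfl rfl

end

end DeepInference

/-! ### Computability of constructors and projections. -/

namespace DeepInference
open Enc

section

variable {X : Type u → Type v} {Y : Type u → Type w} {Z : Type u → Type v'}
  [∀ A, Enc A (X A)] [∀ A, Enc A (Y A)] [∀ A, Enc A (Z A)]

theorem QPT.enc {f : ∀ (A : Type u) [AtomSet A], X A → Y A} (hf : QPT f) :
    QPT (fun A _ x => (enc (f A x) : SExp A)) :=
  hf.of_enc fun A _ x => ⟨x, rfl, rfl⟩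

theorem QPT.sexp_cons {f g : ∀ (A : Type u) [AtomSet A], X A → SExp A} (hf : QPT f)
    (hg : QPT g) : QPT (fun A _ x => SExp.cons (f A x) (g A x)) :=
  (QPT.pair (f := f) (g := g)).of_enc fun A _ x => ⟨x, rfl, rfl⟩

theorem QPT.sexp_tag (k : ℕ) :
    QPT (fun (A : Type u) _ (_ : X A) => SExp.ofList (List.replicate k (SExp.nil : SExp A))) := by
  induction k with
  | zero => exact QPT.const_nil
  | succ k ih => exact QPT.const_nil.sexp_cons ih

theorem QPT.sexp_node (k : ℕ) {f : ∀ (A : Type u) [AtomSet A], X A → SExp A} (hf : QPT f) :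
    QPT (fun A _ x => SExp.cons (SExp.ofList (List.replicate k .nil)) (f A x)) :=
  (QPT.sexp_tag k).sexp_cons hf

instance (priority := 2000) QPT.unit : QPT (fun (A : Type u) _ (_ : X A) => ()) :=
  QPT.const_nil.of_enc fun A _ x => ⟨x, rfl, rfl⟩

instance QPT.bool_false : QPT (fun (A : Type u) _ (_ : X A) => false) :=
  QPT.const_nil.of_enc fun A _ x => ⟨x, rfl, rfl⟩

instance QPT.bool_true : QPT (fun (A : Type u) _ (_ : X A) => true) :=
  (QPT.const_nil.sexp_cons QPT.const_nil).of_enc fun A _ x => ⟨x, rfl, rfl⟩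

instance QPT.list_nil : QPT (fun (A : Type u) _ (_ : X A) => ([] : List (Y A))) :=
  QPT.const_nil.of_enc fun A _ x => ⟨x, rfl, rfl⟩

instance QPT.list_cons {f : ∀ (A : Type u) [AtomSet A], X A → Y A}
    {g : ∀ (A : Type u) [AtomSet A], X A → List (Y A)} [hf : QPT f] [hg : QPT g] :
    QPT (fun A _ x => f A x :: g A x) :=
  (hf.enc.sexp_cons hg.enc).of_enc fun A _ x => ⟨x, rfl, rfl⟩

instance QPT.atom {f : ∀ (A : Type u) [AtomSet A], X A → A} [hf : QPT f] :
    QPT (fun A _ x => Formula.atom (f A x)) :=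
  hf.of_enc fun A _ x => ⟨x, rfl, rfl⟩

instance QPT.step {f : ∀ (A : Type u) [AtomSet A], X A → Ctx A}
    {g : ∀ (A : Type u) [AtomSet A], X A → Inst A} [hf : QPT f] [hg : QPT g] :
    QPT (fun A _ x => Step.mk (f A x) (g A x)) :=
  (hf.enc.sexp_cons hg.enc).of_enc fun A _ x => ⟨x, rfl, rfl⟩

instance QPT.step_ctx {f : ∀ (A : Type u) [AtomSet A], X A → Step A} [hf : QPT f] :
    QPT (fun A _ x => (f A x).ctx) :=
  ((QPT.fst' (X := Ctx) (Y := Inst)).of_enc (f := fun _ _ (s : Step _) => s.ctx)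
    fun A _ s => ⟨(s.ctx, s.inst), rfl, rfl⟩).compose hf

instance QPT.step_inst {f : ∀ (A : Type u) [AtomSet A], X A → Step A} [hf : QPT f] :
    QPT (fun A _ x => (f A x).inst) :=
  ((QPT.snd' (X := Ctx) (Y := Inst)).of_enc (f := fun _ _ (s : Step _) => s.inst)
    fun A _ s => ⟨(s.ctx, s.inst), rfl, rfl⟩).compose hf

instance QPT.derivation {f : ∀ (A : Type u) [AtomSet A], X A → Formula A}
    {g : ∀ (A : Type u) [AtomSet A], X A → List (Step A)} [hf : QPT f] [hg : QPT g] :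
    QPT (fun A _ x => Derivation.mk (f A x) (g A x)) :=
  (hf.enc.sexp_cons hg.enc).of_enc fun A _ x => ⟨x, rfl, rfl⟩

instance QPT.derivation_premiss {f : ∀ (A : Type u) [AtomSet A], X A → Derivation A}
    [hf : QPT f] : QPT (fun A _ x => (f A x).premiss) :=
  ((QPT.fst' (X := Formula) (Y := fun A => List (Step A))).of_enc
    (f := fun _ _ (D : Derivation _) => D.premiss)
    fun A _ D => ⟨(D.premiss, D.steps), rfl, rfl⟩).compose hf

instance QPT.derivation_steps {f : ∀ (A : Type u) [AtomSet A], X A → Derivation A}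
    [hf : QPT f] : QPT (fun A _ x => (f A x).steps) :=
  ((QPT.snd' (X := Formula) (Y := fun A => List (Step A))).of_enc
    (f := fun _ _ (D : Derivation _) => D.steps)
    fun A _ D => ⟨(D.premiss, D.steps), rfl, rfl⟩).compose hf

instance QPT.formula_ff :
    QPT (fun (A : Type u) _ (_ : X A) => (Formula.ff : Formula A)) :=
  (QPT.sexp_node 0 QPT.const_nil).of_enc fun A _ x => ⟨x, rfl, rfl⟩

instance QPT.formula_tt :
    QPT (fun (A : Type u) _ (_ : X A) => (Formula.tt : Formula A)) :=
  (QPT.sexp_node 1 QPT.const_nil).of_enc fun A _ x => ⟨x, rfl, rfl⟩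

instance QPT.formula_disj {f : ∀ (A : Type u) [AtomSet A], X A → Formula A} {g : ∀ (A : Type u) [AtomSet A], X A → Formula A}
    [hf : QPT f] [hg : QPT g] :
    QPT (fun A _ x => Formula.disj (f A x) (g A x)) :=
  (QPT.sexp_node 2 (hf.enc.sexp_cons (hg.enc.sexp_cons QPT.const_nil))).of_enc fun A _ x => ⟨x, rfl, rfl⟩

instance QPT.formula_conj {f : ∀ (A : Type u) [AtomSet A], X A → Formula A} {g : ∀ (A : Type u) [AtomSet A], X A → Formula A}
    [hf : QPT f] [hg : QPT g] :
    QPT (fun A _ x => Formula.conj (f A x) (g A x)) :=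
  (QPT.sexp_node 3 (hf.enc.sexp_cons (hg.enc.sexp_cons QPT.const_nil))).of_enc fun A _ x => ⟨x, rfl, rfl⟩

instance QPT.ctx_hole :
    QPT (fun (A : Type u) _ (_ : X A) => (Ctx.hole : Ctx A)) :=
  (QPT.sexp_node 0 QPT.const_nil).of_enc fun A _ x => ⟨x, rfl, rfl⟩

instance QPT.ctx_disjL {f : ∀ (A : Type u) [AtomSet A], X A → Ctx A} {g : ∀ (A : Type u) [AtomSet A], X A → Formula A}
    [hf : QPT f] [hg : QPT g] :
    QPT (fun A _ x => Ctx.disjL (f A x) (g A x)) :=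
  (QPT.sexp_node 1 (hf.enc.sexp_cons (hg.enc.sexp_cons QPT.const_nil))).of_enc fun A _ x => ⟨x, rfl, rfl⟩

instance QPT.ctx_disjR {f : ∀ (A : Type u) [AtomSet A], X A → Formula A} {g : ∀ (A : Type u) [AtomSet A], X A → Ctx A}
    [hf : QPT f] [hg : QPT g] :
    QPT (fun A _ x => Ctx.disjR (f A x) (g A x)) :=
  (QPT.sexp_node 2 (hf.enc.sexp_cons (hg.enc.sexp_cons QPT.const_nil))).of_enc fun A _ x => ⟨x, rfl, rfl⟩

instance QPT.ctx_conjL {f : ∀ (A : Type u) [AtomSet A], X A → Ctx A} {g : ∀ (A : Type u) [AtomSet A], X A → Formula A}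
    [hf : QPT f] [hg : QPT g] :
    QPT (fun A _ x => Ctx.conjL (f A x) (g A x)) :=
  (QPT.sexp_node 3 (hf.enc.sexp_cons (hg.enc.sexp_cons QPT.const_nil))).of_enc fun A _ x => ⟨x, rfl, rfl⟩

instance QPT.ctx_conjR {f : ∀ (A : Type u) [AtomSet A], X A → Formula A} {g : ∀ (A : Type u) [AtomSet A], X A → Ctx A}
    [hf : QPT f] [hg : QPT g] :
    QPT (fun A _ x => Ctx.conjR (f A x) (g A x)) :=
  (QPT.sexp_node 4 (hf.enc.sexp_cons (hg.enc.sexp_cons QPT.const_nil))).of_enc fun A _ x => ⟨x, rfl, rfl⟩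

instance QPT.eqInst_disjComm {f : ∀ (A : Type u) [AtomSet A], X A → Formula A} {g : ∀ (A : Type u) [AtomSet A], X A → Formula A}
    [hf : QPT f] [hg : QPT g] :
    QPT (fun A _ x => EqInst.disjComm (f A x) (g A x)) :=
  (QPT.sexp_node 0 (hf.enc.sexp_cons (hg.enc.sexp_cons QPT.const_nil))).of_enc fun A _ x => ⟨x, rfl, rfl⟩

instance QPT.eqInst_conjComm {f : ∀ (A : Type u) [AtomSet A], X A → Formula A} {g : ∀ (A : Type u) [AtomSet A], X A → Formula A}
    [hf : QPT f] [hg : QPT g] :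
    QPT (fun A _ x => EqInst.conjComm (f A x) (g A x)) :=
  (QPT.sexp_node 1 (hf.enc.sexp_cons (hg.enc.sexp_cons QPT.const_nil))).of_enc fun A _ x => ⟨x, rfl, rfl⟩

instance QPT.eqInst_disjAssoc
    {f : ∀ (A : Type u) [AtomSet A], X A → Formula A} {g : ∀ (A : Type u) [AtomSet A], X A → Formula A}
    {h : ∀ (A : Type u) [AtomSet A], X A → Formula A}
    [hf : QPT f] [hg : QPT g] [hh : QPT h] :
    QPT (fun A _ x => EqInst.disjAssoc (f A x) (g A x) (h A x)) :=
  (QPT.sexp_node 2 (hf.enc.sexp_cons (hg.enc.sexp_cons (hh.enc.sexp_cons QPT.const_nil)))).of_enc fun A _ x => ⟨x, rfl, rfl⟩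

instance QPT.eqInst_conjAssoc
    {f : ∀ (A : Type u) [AtomSet A], X A → Formula A} {g : ∀ (A : Type u) [AtomSet A], X A → Formula A}
    {h : ∀ (A : Type u) [AtomSet A], X A → Formula A}
    [hf : QPT f] [hg : QPT g] [hh : QPT h] :
    QPT (fun A _ x => EqInst.conjAssoc (f A x) (g A x) (h A x)) :=
  (QPT.sexp_node 3 (hf.enc.sexp_cons (hg.enc.sexp_cons (hh.enc.sexp_cons QPT.const_nil)))).of_enc fun A _ x => ⟨x, rfl, rfl⟩

instance QPT.eqInst_disjFf {f : ∀ (A : Type u) [AtomSet A], X A → Formula A}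
    [hf : QPT f] :
    QPT (fun A _ x => EqInst.disjFf (f A x)) :=
  (QPT.sexp_node 4 (hf.enc.sexp_cons QPT.const_nil)).of_enc fun A _ x => ⟨x, rfl, rfl⟩

instance QPT.eqInst_conjTt {f : ∀ (A : Type u) [AtomSet A], X A → Formula A}
    [hf : QPT f] :
    QPT (fun A _ x => EqInst.conjTt (f A x)) :=
  (QPT.sexp_node 5 (hf.enc.sexp_cons QPT.const_nil)).of_enc fun A _ x => ⟨x, rfl, rfl⟩

instance QPT.eqInst_disjTtTt :
    QPT (fun (A : Type u) _ (_ : X A) => (EqInst.disjTtTt : EqInst A)) :=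
  (QPT.sexp_node 6 QPT.const_nil).of_enc fun A _ x => ⟨x, rfl, rfl⟩

instance QPT.eqInst_conjFfFf :
    QPT (fun (A : Type u) _ (_ : X A) => (EqInst.conjFfFf : EqInst A)) :=
  (QPT.sexp_node 7 QPT.const_nil).of_enc fun A _ x => ⟨x, rfl, rfl⟩

instance QPT.inst_aiDown {f : ∀ (A : Type u) [AtomSet A], X A → A}
    [hf : QPT f] :
    QPT (fun A _ x => Inst.aiDown (f A x)) :=
  (QPT.sexp_node 0 (hf.enc.sexp_cons QPT.const_nil)).of_enc fun A _ x => ⟨x, rfl, rfl⟩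

instance QPT.inst_awDown {f : ∀ (A : Type u) [AtomSet A], X A → A}
    [hf : QPT f] :
    QPT (fun A _ x => Inst.awDown (f A x)) :=
  (QPT.sexp_node 1 (hf.enc.sexp_cons QPT.const_nil)).of_enc fun A _ x => ⟨x, rfl, rfl⟩

instance QPT.inst_acDown {f : ∀ (A : Type u) [AtomSet A], X A → A}
    [hf : QPT f] :
    QPT (fun A _ x => Inst.acDown (f A x)) :=
  (QPT.sexp_node 2 (hf.enc.sexp_cons QPT.const_nil)).of_enc fun A _ x => ⟨x, rfl, rfl⟩

instance QPT.inst_awUp {f : ∀ (A : Type u) [AtomSet A], X A → A}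
    [hf : QPT f] :
    QPT (fun A _ x => Inst.awUp (f A x)) :=
  (QPT.sexp_node 4 (hf.enc.sexp_cons QPT.const_nil)).of_enc fun A _ x => ⟨x, rfl, rfl⟩

instance QPT.inst_acUp {f : ∀ (A : Type u) [AtomSet A], X A → A}
    [hf : QPT f] :
    QPT (fun A _ x => Inst.acUp (f A x)) :=
  (QPT.sexp_node 5 (hf.enc.sexp_cons QPT.const_nil)).of_enc fun A _ x => ⟨x, rfl, rfl⟩

instance QPT.inst_switch
    {f : ∀ (A : Type u) [AtomSet A], X A → Formula A} {g : ∀ (A : Type u) [AtomSet A], X A → Formula A}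
    {h : ∀ (A : Type u) [AtomSet A], X A → Formula A}
    [hf : QPT f] [hg : QPT g] [hh : QPT h] :
    QPT (fun A _ x => Inst.switch (f A x) (g A x) (h A x)) :=
  (QPT.sexp_node 6 (hf.enc.sexp_cons (hg.enc.sexp_cons (hh.enc.sexp_cons QPT.const_nil)))).of_enc fun A _ x => ⟨x, rfl, rfl⟩

instance QPT.inst_medial
    {f : ∀ (A : Type u) [AtomSet A], X A → Formula A} {g : ∀ (A : Type u) [AtomSet A], X A → Formula A}
    {h : ∀ (A : Type u) [AtomSet A], X A → Formula A} {j : ∀ (A : Type u) [AtomSet A], X A → Formula A}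
    [hf : QPT f] [hg : QPT g] [hh : QPT h] [hj : QPT j] :
    QPT (fun A _ x => Inst.medial (f A x) (g A x) (h A x) (j A x)) :=
  (QPT.sexp_node 7 (hf.enc.sexp_cons (hg.enc.sexp_cons (hh.enc.sexp_cons (hj.enc.sexp_cons QPT.const_nil))))).of_enc fun A _ x => ⟨x, rfl, rfl⟩

instance QPT.inst_eqLR {f : ∀ (A : Type u) [AtomSet A], X A → EqInst A}
    [hf : QPT f] :
    QPT (fun A _ x => Inst.eqLR (f A x)) :=
  (QPT.sexp_node 8 (hf.enc.sexp_cons QPT.const_nil)).of_enc fun A _ x => ⟨x, rfl, rfl⟩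

instance QPT.inst_eqRL {f : ∀ (A : Type u) [AtomSet A], X A → EqInst A}
    [hf : QPT f] :
    QPT (fun A _ x => Inst.eqRL (f A x)) :=
  (QPT.sexp_node 9 (hf.enc.sexp_cons QPT.const_nil)).of_enc fun A _ x => ⟨x, rfl, rfl⟩

end

/-! Recursion. -/

section

variable {X : Type u → Type v} {Z : Type u → Type w} {W : Type u → Type v'}
  [∀ A, Enc A (X A)] [∀ A, Enc A (Z A)] [∀ A, Enc A (W A)]

/-- The time spent in one call of a recursive function on arguments of size at most `b`. -/
def callCost (k b : ℕ) : ℕ := 50 * (b + 1) + 10 * qb k (3 * b + 3)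

theorem isQP_callCost (k : ℕ) : IsQP (callCost k) :=
  ((isQP_const 50).mul (isQP_id.add (isQP_const 1))).add ((isQP_const 10).mul
    ((((isQP_const 3).mul isQP_id).add (isQP_const 3)).qb_comp k))

/-- The measures of the two recursive arguments add up to less than that of x, so the whole
recursion consists of at most 2μ + 1 calls. Each of them costs at most `callCost`, because B bounds
all arguments and values and does not increase from call to call. The second argument may depend on
the first result; this is needed to run two scripts in sequence. -/
theorem QPT.rec_comp {f : ∀ (A : Type u) [AtomSet A], X A → Z A}
    (p : ∀ (A : Type u) [AtomSet A], X A → Bool) (g : ∀ (A : Type u) [AtomSet A], X A → Z A)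
    (d₁ : ∀ (A : Type u) [AtomSet A], X A → X A)
    (d₂ : ∀ (A : Type u) [AtomSet A], X A × Z A → X A)
    (G : ∀ (A : Type u) [AtomSet A], X A × Z A × Z A → Z A)
    [hp : QPT p] [hg : QPT g] [hd₁ : QPT d₁] [hd₂ : QPT d₂] [hG : QPT G]
    (h₀ : ∀ (A : Type u) [AtomSet A] (x : X A), p A x = true → f A x = g A x)
    (h₁ : ∀ (A : Type u) [AtomSet A] (x : X A), p A x = false →
      f A x = G A (x, f A (d₁ A x), f A (d₂ A (x, f A (d₁ A x)))))
    (μ B : ∀ (A : Type u) [AtomSet A], X A → ℕ)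
    (hμ : ∀ (A : Type u) [AtomSet A] (x : X A), p A x = false →
      μ A (d₁ A x) + μ A (d₂ A (x, f A (d₁ A x))) + 1 ≤ μ A x)
    (hB₁ : ∀ (A : Type u) [AtomSet A] (x : X A), p A x = false → B A (d₁ A x) ≤ B A x)
    (hB₂ : ∀ (A : Type u) [AtomSet A] (x : X A), p A x = false →
      B A (d₂ A (x, f A (d₁ A x))) ≤ B A x)
    (hx : ∀ (A : Type u) [AtomSet A] (x : X A), esize A x ≤ B A x)
    (hf : ∀ (A : Type u) [AtomSet A] (x : X A), esize A (f A x) ≤ B A x) :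
    Comp (fun A _ b x y => ∃ a : X A, B A a ≤ b ∧ μ A a ≤ b ∧ x = Enc.enc a ∧
      y = Enc.enc (f A a)) := by
  refine Comp.of_body [graph p, graph g, graph d₁, graph d₂, graph G]
    (by simp [hp.comp, hg.comp, hd₁.comp, hd₂.comp, hG.comp])
    (fun i self => .case (.call (i 0) (.var 0))
      (.letIn (.call self (.call (i 2) (.var 0)))
        (.letIn (.call self (.call (i 3) (.cons (.var 1) (.var 0))))
          (.call (i 4) (.cons (.var 2) (.cons (.var 1) (.var 0)))))) .nil
      (.call (i 1) (.var 2))) fun k => ⟨fun b => (2 * b + 1) * callCost k b, ?_, ?_⟩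
  · exact (((isQP_const 2).mul isQP_id).add (isQP_const 1)).mul (isQP_callCost k)
  intro P i self hself A _ hl b x y hxy
  have leaf : ∀ a : X A, B A a ≤ b → p A a = true →
      Fn (A := A) P self (Enc.enc a) (Enc.enc (f A a)) (callCost k b) := by
    intro a hb hpa
    have hs : (Enc.enc a : SExp A).size ≤ b := (hx A a).trans hb
    have h1 := hl 0 _ rfl b (Enc.enc a) _ ⟨hs, a, rfl, rfl⟩
    have h2 := hl 1 _ rfl b (Enc.enc a) _ ⟨hs, a, rfl, rfl⟩
    have hq : qb k b ≤ qb k (3 * b + 3) := qb_mono le_rfl (by omega)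
    rw [hpa] at h1
    rw [h₀ A a hpa]
    refine ⟨_, hself, Ev.mono (Ev.caseCons (x := .nil) (y := .nil)
      (Ev.call h1 (Ev.var rfl)) (Ev.call h2 (Ev.var rfl))) ?_⟩
    simp only [callCost]
    omega
  have node : ∀ a : X A, B A a ≤ b → p A a = false → ∀ c₁ c₂,
      Fn (A := A) P self (Enc.enc (d₁ A a)) (Enc.enc (f A (d₁ A a))) c₁ →
      Fn (A := A) P self (Enc.enc (d₂ A (a, f A (d₁ A a)))) (Enc.enc (f A (d₂ A (a, f A (d₁ A a))))) c₂ →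
      Fn (A := A) P self (Enc.enc a) (Enc.enc (f A a)) (callCost k b + c₁ + c₂) := by
    intro a hb hpa c₁ c₂ r₁ r₂
    have hs : (Enc.enc a : SExp A).size ≤ b := (hx A a).trans hb
    have s₁ : (Enc.enc (f A (d₁ A a)) : SExp A).size ≤ b :=
      (hf A _).trans ((hB₁ A a hpa).trans hb)
    have s₂ : (Enc.enc (f A (d₂ A (a, f A (d₁ A a)))) : SExp A).size ≤ b :=
      (hf A _).trans ((hB₂ A a hpa).trans hb)
    have h1 := hl 0 _ rfl b (Enc.enc a) _ ⟨hs, a, rfl, rfl⟩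
    have h2 := hl 2 _ rfl b (Enc.enc a) _ ⟨hs, a, rfl, rfl⟩
    have h3 := hl 3 _ rfl (3 * b + 3) (Enc.enc (a, f A (d₁ A a))) _
      ⟨by simp only [Enc.enc, SExp.size] at *; omega, _, rfl, rfl⟩
    -- A triple whose components have size at most b is encoded in size at most 3b + 2.
    have h4 := hl 4 _ rfl (3 * b + 3)
      (Enc.enc (a, f A (d₁ A a), f A (d₂ A (a, f A (d₁ A a))))) _
      ⟨by simp only [Enc.enc, SExp.size] at *; omega, _, rfl, rfl⟩
    have hq : qb k b ≤ qb k (3 * b + 3) := qb_mono le_rfl (by omega)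
    rw [hpa] at h1
    rw [h₁ A a hpa]
    refine ⟨_, hself, Ev.mono (Ev.caseNil (Ev.call h1 (Ev.var rfl))
      (Ev.letIn (Ev.call r₁ (Ev.call h2 (Ev.var rfl)))
      (Ev.letIn (Ev.call r₂ (Ev.call h3 (Ev.cons (Ev.var rfl) (Ev.var rfl))))
        (Ev.call h4 (Ev.cons (Ev.var rfl) (Ev.cons (Ev.var rfl) (Ev.var rfl))))))) ?_⟩
    simp only [callCost]
    omega
  have key : ∀ n, ∀ a : X A, μ A a ≤ n → B A a ≤ b →
      Fn (A := A) P self (Enc.enc a) (Enc.enc (f A a)) ((2 * μ A a + 1) * callCost k b) := by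
    intro n
    induction n with
    | zero =>
      intro a hn hb
      cases hpa : p A a
      · have := hμ A a hpa
        omega
      · exact (leaf a hb hpa).mono (Nat.le_mul_of_pos_left _ (by omega))
    | succ n ih =>
      intro a hn hb
      cases hpa : p A a
      · have hm := hμ A a hpa
        refine (node a hb hpa _ _ (ih _ (by omega) ((hB₁ A a hpa).trans hb))
          (ih _ (by omega) ((hB₂ A a hpa).trans hb))).mono ?_
        -- One call for the node and 2μᵢ + 1 for each of the two subtrees, where μ₁ + μ₂ + 1 ≤ μ.
        calc _ = (1 + (2 * μ A (d₁ A a) + 1) + (2 * μ A (d₂ A (a, f A (d₁ A a))) + 1)) *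
              callCost k b := by ring
          _ ≤ _ := Nat.mul_le_mul_right _ (by omega)
      · exact (leaf a hb hpa).mono (Nat.le_mul_of_pos_left _ (by omega))
  obtain ⟨a, hB, hm, rfl, rfl⟩ := hxy
  refine (key _ a le_rfl hB).mono ?_
  exact Nat.mul_le_mul_right _ (by omega)

/-- Recursion with one recursive call. -/
theorem QPT.rec_comp_one {f : ∀ (A : Type u) [AtomSet A], X A → Z A}
    (p : ∀ (A : Type u) [AtomSet A], X A → Bool) (g : ∀ (A : Type u) [AtomSet A], X A → Z A)
    (d₁ : ∀ (A : Type u) [AtomSet A], X A → X A)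
    (G : ∀ (A : Type u) [AtomSet A], X A × Z A → Z A)
    [hp : QPT p] [hg : QPT g] [hd₁ : QPT d₁] [hG : QPT G]
    (h₀ : ∀ (A : Type u) [AtomSet A] (x : X A), p A x = true → f A x = g A x)
    (h₁ : ∀ (A : Type u) [AtomSet A] (x : X A), p A x = false →
      f A x = G A (x, f A (d₁ A x)))
    (μ B : ∀ (A : Type u) [AtomSet A], X A → ℕ)
    (hμ : ∀ (A : Type u) [AtomSet A] (x : X A), p A x = false → μ A (d₁ A x) + 1 ≤ μ A x)
    (hB₁ : ∀ (A : Type u) [AtomSet A] (x : X A), p A x = false → B A (d₁ A x) ≤ B A x)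
    (hx : ∀ (A : Type u) [AtomSet A] (x : X A), esize A x ≤ B A x)
    (hf : ∀ (A : Type u) [AtomSet A] (x : X A), esize A (f A x) ≤ B A x) :
    Comp (fun A _ b x y => ∃ a : X A, B A a ≤ b ∧ μ A a ≤ b ∧ x = Enc.enc a ∧
      y = Enc.enc (f A a)) := by
  refine Comp.of_body [graph p, graph g, graph d₁, graph G]
    (by simp [hp.comp, hg.comp, hd₁.comp, hG.comp])
    (fun i self => .case (.call (i 0) (.var 0))
      (.letIn (.call self (.call (i 2) (.var 0)))
        (.call (i 3) (.cons (.var 1) (.var 0)))) .nil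
      (.call (i 1) (.var 2))) fun k => ⟨fun b => (2 * b + 1) * callCost k b, ?_, ?_⟩
  · exact (((isQP_const 2).mul isQP_id).add (isQP_const 1)).mul (isQP_callCost k)
  intro P i self hself A _ hl b x y hxy
  have leaf : ∀ a : X A, B A a ≤ b → p A a = true →
      Fn (A := A) P self (Enc.enc a) (Enc.enc (f A a)) (callCost k b) := by
    intro a hb hpa
    have hs : (Enc.enc a : SExp A).size ≤ b := (hx A a).trans hb
    have h1 := hl 0 _ rfl b (Enc.enc a) _ ⟨hs, a, rfl, rfl⟩
    have h2 := hl 1 _ rfl b (Enc.enc a) _ ⟨hs, a, rfl, rfl⟩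
    have hq : qb k b ≤ qb k (3 * b + 3) := qb_mono le_rfl (by omega)
    rw [hpa] at h1
    rw [h₀ A a hpa]
    refine ⟨_, hself, Ev.mono (Ev.caseCons (x := .nil) (y := .nil)
      (Ev.call h1 (Ev.var rfl)) (Ev.call h2 (Ev.var rfl))) ?_⟩
    simp only [callCost]
    omega
  have node : ∀ a : X A, B A a ≤ b → p A a = false → ∀ c₁,
      Fn (A := A) P self (Enc.enc (d₁ A a)) (Enc.enc (f A (d₁ A a))) c₁ →
      Fn (A := A) P self (Enc.enc a) (Enc.enc (f A a)) (callCost k b + c₁) := by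
    intro a hb hpa c₁ r₁
    have hs : (Enc.enc a : SExp A).size ≤ b := (hx A a).trans hb
    have s₁ : (Enc.enc (f A (d₁ A a)) : SExp A).size ≤ b :=
      (hf A _).trans ((hB₁ A a hpa).trans hb)
    have h1 := hl 0 _ rfl b (Enc.enc a) _ ⟨hs, a, rfl, rfl⟩
    have h2 := hl 2 _ rfl b (Enc.enc a) _ ⟨hs, a, rfl, rfl⟩
    have h4 := hl 3 _ rfl (3 * b + 3) (Enc.enc (a, f A (d₁ A a))) _
      ⟨by simp only [Enc.enc, SExp.size] at *; omega, _, rfl, rfl⟩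
    have hq : qb k b ≤ qb k (3 * b + 3) := qb_mono le_rfl (by omega)
    rw [hpa] at h1
    rw [h₁ A a hpa]
    refine ⟨_, hself, Ev.mono (Ev.caseNil (Ev.call h1 (Ev.var rfl))
      (Ev.letIn (Ev.call r₁ (Ev.call h2 (Ev.var rfl)))
        (Ev.call h4 (Ev.cons (Ev.var rfl) (Ev.var rfl))))) ?_⟩
    simp only [callCost]
    omega
  have key : ∀ n, ∀ a : X A, μ A a ≤ n → B A a ≤ b →
      Fn (A := A) P self (Enc.enc a) (Enc.enc (f A a)) ((2 * μ A a + 1) * callCost k b) := by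
    intro n
    induction n with
    | zero =>
      intro a hn hb
      cases hpa : p A a
      · have := hμ A a hpa
        omega
      · exact (leaf a hb hpa).mono (Nat.le_mul_of_pos_left _ (by omega))
    | succ n ih =>
      intro a hn hb
      cases hpa : p A a
      · have hm := hμ A a hpa
        refine (node a hb hpa _ (ih _ (by omega) ((hB₁ A a hpa).trans hb))).mono ?_
        calc _ = (1 + (2 * μ A (d₁ A a) + 1)) * callCost k b := by ring
          _ ≤ _ := Nat.mul_le_mul_right _ (by omega)
      · exact (leaf a hb hpa).mono (Nat.le_mul_of_pos_left _ (by omega))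
  obtain ⟨a, hB, hm, rfl, rfl⟩ := hxy
  refine (key _ a le_rfl hB).mono ?_
  exact Nat.mul_le_mul_right _ (by omega)

/-- A function given by recursion, on arguments for which the recursion is bounded. -/
theorem QPT.of_rec_comp {f : ∀ (A : Type u) [AtomSet A], X A → Z A}
    {μ B : ∀ (A : Type u) [AtomSet A], X A → ℕ}
    (hf : Comp (fun A _ b x y => ∃ a : X A, B A a ≤ b ∧ μ A a ≤ b ∧ x = Enc.enc a ∧
      y = Enc.enc (f A a)))
    (ι : ∀ (A : Type u) [AtomSet A], W A → X A) [hι : QPT ι] {q : ℕ → ℕ} (hq : IsQP q)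
    (hB : ∀ (A : Type u) [AtomSet A] (x : W A), B A (ι A x) ≤ q (esize A x))
    (hμ : ∀ (A : Type u) [AtomSet A] (x : W A), μ A (ι A x) ≤ q (esize A x)) :
    QPT (fun A _ x => f A (ι A x)) := by
  obtain ⟨k, hk⟩ := hq
  refine ⟨hι.comp.compose hf (isQP_qb k) ?_⟩
  rintro A _ b _ _ ⟨hb, a, rfl, rfl⟩
  have hm : q (esize A a) ≤ qb k b := (hk _).trans (qb_mono le_rfl hb)
  exact ⟨hb, _, ⟨hb, a, rfl, rfl⟩, ι A a, (hB A a).trans hm, (hμ A a).trans hm, rfl, rfl⟩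

end

end DeepInference

namespace DeepInference
open Enc

/-! Sizes of representations. -/

section

variable {A : Type u}

@[simp] theorem esize_pair {X : Type v} {Y : Type w} [Enc A X] [Enc A Y] (x : X) (y : Y) :
    esize A (x, y) = esize A x + esize A y + 1 := rfl

@[simp] theorem esize_nil {X : Type v} [Enc A X] : esize A ([] : List X) = 1 := rfl

@[simp] theorem esize_cons {X : Type v} [Enc A X] (x : X) (l : List X) :
    esize A (x :: l) = esize A x + esize A l + 1 := rfl

@[simp] theorem esize_atom (a : A) : esize A a = 1 := rfl

@[simp] theorem esize_unit : esize A () = 1 := rfl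

theorem one_le_esize {X : Type v} [Enc A X] (x : X) : 1 ≤ esize A x := SExp.one_le_size _

theorem esize_bool_le (b : Bool) : esize A b ≤ 3 := by
  cases b <;> exact Nat.le_of_ble_eq_true rfl

@[simp] theorem esize_ff : esize A (Formula.ff : Formula A) = 3 := rfl
@[simp] theorem esize_tt : esize A (Formula.tt : Formula A) = 5 := rfl
@[simp] theorem esize_formula_atom (a : A) : esize A (Formula.atom a) = 1 := rfl
@[simp] theorem esize_disj (α β : Formula A) :
    esize A (Formula.disj α β) = esize A α + esize A β + 9 := by
  change SExp.size (.node 2 _) = _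
  simp [SExp.node, SExp.ofList, SExp.size, List.replicate, esize, enc]; omega
@[simp] theorem esize_conj (α β : Formula A) :
    esize A (Formula.conj α β) = esize A α + esize A β + 11 := by
  change SExp.size (.node 3 _) = _
  simp [SExp.node, SExp.ofList, SExp.size, List.replicate, esize, enc]; omega
@[simp] theorem esize_hole : esize A (Ctx.hole : Ctx A) = 3 := rfl
@[simp] theorem esize_disjL (ξ : Ctx A) (β : Formula A) :
    esize A (Ctx.disjL ξ β) = esize A ξ + esize A β + 7 := by
  change SExp.size (.node 1 _) = _
  simp [SExp.node, SExp.ofList, SExp.size, List.replicate, esize, enc]; omega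
@[simp] theorem esize_disjR (ξ : Ctx A) (β : Formula A) :
    esize A (Ctx.disjR β ξ) = esize A β + esize A ξ + 9 := by
  change SExp.size (.node 2 _) = _
  simp [SExp.node, SExp.ofList, SExp.size, List.replicate, esize, enc]; omega
@[simp] theorem esize_conjL (ξ : Ctx A) (β : Formula A) :
    esize A (Ctx.conjL ξ β) = esize A ξ + esize A β + 11 := by
  change SExp.size (.node 3 _) = _
  simp [SExp.node, SExp.ofList, SExp.size, List.replicate, esize, enc]; omega
@[simp] theorem esize_conjR (ξ : Ctx A) (β : Formula A) :
    esize A (Ctx.conjR β ξ) = esize A β + esize A ξ + 13 := by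
  change SExp.size (.node 4 _) = _
  simp [SExp.node, SExp.ofList, SExp.size, List.replicate, esize, enc]; omega
@[simp] theorem esize_step (s : Step A) : esize A s = esize A s.ctx + esize A s.inst + 1 := rfl

end

/-! ### Structural recursion on formulae, contexts and lists. -/

section

variable {X : Type u → Type v} {Y : Type u → Type w} {Z : Type u → Type v'}
  {W : Type u → Type w'}
  [∀ A, Enc A (X A)] [∀ A, Enc A (Y A)] [∀ A, Enc A (Z A)] [∀ A, Enc A (W A)]

/-- Recursion on formulae, with a bound `B` for all values that occur in the recursion. -/
theorem QPT.formulaRec_of_bound {f : ∀ (A : Type u) [AtomSet A], Formula A → Y A → Z A}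
    (g₀ g₁ : ∀ (A : Type u) [AtomSet A], Y A → Z A)
    (g₂ : ∀ (A : Type u) [AtomSet A], A → Y A → Z A)
    (g₃ g₄ : ∀ (A : Type u) [AtomSet A], Formula A → Formula A → Y A → Z A → Z A → Z A)
    [h0 : QPT g₀] [h1 : QPT g₁] [h2 : QPT (fun A _ (p : A × Y A) => g₂ A p.1 p.2)]
    [h3 : QPT (fun A _ (p : Formula A × Formula A × Y A × Z A × Z A) =>
      g₃ A p.1 p.2.1 p.2.2.1 p.2.2.2.1 p.2.2.2.2)]
    [h4 : QPT (fun A _ (p : Formula A × Formula A × Y A × Z A × Z A) =>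
      g₄ A p.1 p.2.1 p.2.2.1 p.2.2.2.1 p.2.2.2.2)]
    (e₀ : ∀ (A : Type u) [AtomSet A] y, f A .ff y = g₀ A y)
    (e₁ : ∀ (A : Type u) [AtomSet A] y, f A .tt y = g₁ A y)
    (e₂ : ∀ (A : Type u) [AtomSet A] a y, f A (.atom a) y = g₂ A a y)
    (e₃ : ∀ (A : Type u) [AtomSet A] α β y,
      f A (.disj α β) y = g₃ A α β y (f A α y) (f A β y))
    (e₄ : ∀ (A : Type u) [AtomSet A] α β y,
      f A (.conj α β) y = g₄ A α β y (f A α y) (f A β y))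
    (B : ∀ (A : Type u) [AtomSet A], Formula A → Y A → ℕ)
    (hy : ∀ (A : Type u) [AtomSet A] φ y, esize A y ≤ B A φ y)
    (hf : ∀ (A : Type u) [AtomSet A] φ y, esize A (f A φ y) ≤ B A φ y)
    (hd : ∀ (A : Type u) [AtomSet A] α β y,
      B A α y ≤ B A (.disj α β) y ∧ B A β y ≤ B A (.disj α β) y)
    (hc : ∀ (A : Type u) [AtomSet A] α β y,
      B A α y ≤ B A (.conj α β) y ∧ B A β y ≤ B A (.conj α β) y)
    (φ : ∀ (A : Type u) [AtomSet A], W A → Formula A) (y : ∀ (A : Type u) [AtomSet A], W A → Y A)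
    [hφ : QPT φ] [hy' : QPT y] {q : ℕ → ℕ} (hq : IsQP q)
    (hB : ∀ (A : Type u) [AtomSet A] (x : W A), B A (φ A x) (y A x) ≤ q (esize A x)) :
    QPT (fun A _ x => f A (φ A x) (y A x)) := by
  obtain ⟨r, hr, -, hr'⟩ := hφ.exists_size_le
  have i3 : QPT (fun A _ (p : (((Formula A × Y A) × Z A × Z A) × Formula A × Formula A)) =>
      g₃ A p.2.1 p.2.2 p.1.1.2 p.1.2.1 p.1.2.2) := h3.compose
    (f := fun A _ (p : (((Formula A × Y A) × Z A × Z A) × Formula A × Formula A)) =>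
      (p.2.1, p.2.2, p.1.1.2, p.1.2.1, p.1.2.2)) inferInstance
  have i4 : QPT (fun A _ (p : (((Formula A × Y A) × Z A × Z A) × Formula A × Formula A)) =>
      g₄ A p.2.1 p.2.2 p.1.1.2 p.1.2.1 p.1.2.2) := h4.compose
    (f := fun A _ (p : (((Formula A × Y A) × Z A × Z A) × Formula A × Formula A)) =>
      (p.2.1, p.2.2, p.1.1.2, p.1.2.1, p.1.2.2)) inferInstance
  have i0 : QPT (fun A _ (p : Formula A × Y A) => g₀ A p.2) := h0.compose inferInstance
  have i1 : QPT (fun A _ (p : Formula A × Y A) => g₁ A p.2) := h1.compose inferInstance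
  have i2 : QPT (fun A _ (p : (Formula A × Y A) × A) => g₂ A p.2 p.1.2) :=
    h2.compose (f := fun A _ (p : (Formula A × Y A) × A) => (p.2, p.1.2)) inferInstance
  have i5 : QPT (fun A _ (p : (Formula A × Y A) × Formula A × Formula A) => g₀ A p.1.2) :=
    h0.compose inferInstance
  have i6 : QPT (fun A _ (p : (Formula A × Y A) × Z A × Z A) => g₀ A p.1.2) :=
    h0.compose inferInstance
  have i7 : QPT (fun A _ (p : ((Formula A × Y A) × Z A × Z A) × A) => g₀ A p.1.1.2) :=
    h0.compose inferInstance
  have key := QPT.rec_comp (X := fun A => Formula A × Y A) (f := fun A _ p => f A p.1 p.2)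
    (fun A _ p => p.1.elim true true (fun _ => true) (fun _ _ => false) (fun _ _ => false))
    (fun A _ p => p.1.elim (g₀ A p.2) (g₁ A p.2) (fun a => g₂ A a p.2) (fun _ _ => g₀ A p.2)
      (fun _ _ => g₀ A p.2))
    (fun A _ p => p.1.elim p p (fun _ => p) (fun α _ => (α, p.2)) (fun α _ => (α, p.2)))
    (fun A _ p => p.1.1.elim p.1 p.1 (fun _ => p.1) (fun _ β => (β, p.1.2))
      (fun _ β => (β, p.1.2)))
    (fun A _ p => p.1.1.elim (g₀ A p.1.2) (g₀ A p.1.2) (fun _ => g₀ A p.1.2)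
      (fun α β => g₃ A α β p.1.2 p.2.1 p.2.2) (fun α β => g₄ A α β p.1.2 p.2.1 p.2.2))
    (by rintro A _ ⟨φ, y⟩; cases φ <;> simp [Formula.elim, e₀, e₁, e₂])
    (by rintro A _ ⟨φ, y⟩; cases φ <;> simp [Formula.elim, e₃, e₄])
    -- The size of the encoding is the measure: an encoded node is larger than its two components
    -- together.
    (fun A _ p => esize A p.1) (fun A _ p => esize A p.1 + B A p.1 p.2 + 1)
    (by rintro A _ ⟨φ, y⟩; cases φ <;> simp [Formula.elim])
    (by
      rintro A _ ⟨φ, y⟩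
      rcases φ with _ | _ | _ | ⟨α, β⟩ | ⟨α, β⟩ <;> simp [Formula.elim]
      · have := hd A α β y; omega
      · have := hc A α β y; omega)
    (by
      rintro A _ ⟨φ, y⟩
      rcases φ with _ | _ | _ | ⟨α, β⟩ | ⟨α, β⟩ <;> simp [Formula.elim]
      · have := hd A α β y; omega
      · have := hc A α β y; omega)
    (by rintro A _ ⟨φ, y⟩; have := hy A φ y; simp; omega)
    (by rintro A _ ⟨φ, y⟩; have := hf A φ y; simp; omega)
  exact QPT.of_rec_comp key (fun A _ x => (φ A x, y A x))
    (q := fun n => r n + q n + 1) ((hr.add hq).add (isQP_const 1))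
    (fun A _ x => by have := hB A x; have := hr' A x; simp; omega)
    (fun A _ x => by have := hr' A x; simp; omega)

/-- Recursion on formulae. -/
theorem QPT.formulaRec {f : ∀ (A : Type u) [AtomSet A], Formula A → Y A → Z A}
    (g₀ g₁ : ∀ (A : Type u) [AtomSet A], Y A → Z A)
    (g₂ : ∀ (A : Type u) [AtomSet A], A → Y A → Z A)
    (g₃ g₄ : ∀ (A : Type u) [AtomSet A], Formula A → Formula A → Y A → Z A → Z A → Z A)
    [h0 : QPT g₀] [h1 : QPT g₁] [h2 : QPT (fun A _ (p : A × Y A) => g₂ A p.1 p.2)]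
    [h3 : QPT (fun A _ (p : Formula A × Formula A × Y A × Z A × Z A) =>
      g₃ A p.1 p.2.1 p.2.2.1 p.2.2.2.1 p.2.2.2.2)]
    [h4 : QPT (fun A _ (p : Formula A × Formula A × Y A × Z A × Z A) =>
      g₄ A p.1 p.2.1 p.2.2.1 p.2.2.2.1 p.2.2.2.2)]
    (e₀ : ∀ (A : Type u) [AtomSet A] y, f A .ff y = g₀ A y)
    (e₁ : ∀ (A : Type u) [AtomSet A] y, f A .tt y = g₁ A y)
    (e₂ : ∀ (A : Type u) [AtomSet A] a y, f A (.atom a) y = g₂ A a y)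
    (e₃ : ∀ (A : Type u) [AtomSet A] α β y,
      f A (.disj α β) y = g₃ A α β y (f A α y) (f A β y))
    (e₄ : ∀ (A : Type u) [AtomSet A] α β y,
      f A (.conj α β) y = g₄ A α β y (f A α y) (f A β y))
    {q : ℕ → ℕ} (hq : IsQP q)
    (hf : ∀ (A : Type u) [AtomSet A] φ y, esize A (f A φ y) ≤ q (esize A φ + esize A y))
    {φ : ∀ (A : Type u) [AtomSet A], W A → Formula A}
    {y : ∀ (A : Type u) [AtomSet A], W A → Y A} [hφ : QPT φ] [hy' : QPT y] :
    QPT (fun A _ x => f A (φ A x) (y A x)) := by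
  obtain ⟨k, hk⟩ := hq
  obtain ⟨r, hr, -, hr'⟩ := hφ.exists_size_le
  obtain ⟨s, hs, -, hs'⟩ := hy'.exists_size_le
  have hm : ∀ (A : Type u) [AtomSet A] (α β : Formula A) (y : Y A), esize A α ≤ esize A β →
      qb k (esize A α + esize A y) + esize A y ≤ qb k (esize A β + esize A y) + esize A y :=
    fun A _ α β y h => Nat.add_le_add_right (qb_mono le_rfl (by omega)) _
  refine QPT.formulaRec_of_bound g₀ g₁ g₂ g₃ g₄ e₀ e₁ e₂ e₃ e₄
    (fun A _ φ y => qb k (esize A φ + esize A y) + esize A y) (fun A _ φ y => by omega)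
    (fun A _ φ y => (hf A φ y).trans ((hk _).trans (by omega)))
    (fun A _ α β y => ⟨hm A _ _ y ?_, hm A _ _ y ?_⟩)
    (fun A _ α β y => ⟨hm A _ _ y ?_, hm A _ _ y ?_⟩) φ y
    (q := fun n => qb k (r n + s n) + s n) (((hr.add hs).qb_comp k).add hs) (fun A _ x => ?_)
  any_goals simp; omega
  have h1 := hr' A x
  have h2 := hs' A x
  exact Nat.add_le_add (qb_mono le_rfl (by omega)) h2

/-- Recursion on contexts. -/
theorem QPT.ctxRec {f : ∀ (A : Type u) [AtomSet A], Ctx A → Y A → Z A}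
    (g₀ : ∀ (A : Type u) [AtomSet A], Y A → Z A)
    (g₁ g₂ g₃ g₄ : ∀ (A : Type u) [AtomSet A], Formula A → Y A → Z A → Z A)
    [h0 : QPT g₀]
    [h1 : QPT (fun A _ (p : Formula A × Y A × Z A) => g₁ A p.1 p.2.1 p.2.2)]
    [h2 : QPT (fun A _ (p : Formula A × Y A × Z A) => g₂ A p.1 p.2.1 p.2.2)]
    [h3 : QPT (fun A _ (p : Formula A × Y A × Z A) => g₃ A p.1 p.2.1 p.2.2)]
    [h4 : QPT (fun A _ (p : Formula A × Y A × Z A) => g₄ A p.1 p.2.1 p.2.2)]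
    (e₀ : ∀ (A : Type u) [AtomSet A] y, f A .hole y = g₀ A y)
    (e₁ : ∀ (A : Type u) [AtomSet A] ξ β y, f A (.disjL ξ β) y = g₁ A β y (f A ξ y))
    (e₂ : ∀ (A : Type u) [AtomSet A] ξ β y, f A (.disjR β ξ) y = g₂ A β y (f A ξ y))
    (e₃ : ∀ (A : Type u) [AtomSet A] ξ β y, f A (.conjL ξ β) y = g₃ A β y (f A ξ y))
    (e₄ : ∀ (A : Type u) [AtomSet A] ξ β y, f A (.conjR β ξ) y = g₄ A β y (f A ξ y))
    {q : ℕ → ℕ} (hq : IsQP q)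
    (hf : ∀ (A : Type u) [AtomSet A] ξ y, esize A (f A ξ y) ≤ q (esize A ξ + esize A y))
    {ξ : ∀ (A : Type u) [AtomSet A], W A → Ctx A}
    {y : ∀ (A : Type u) [AtomSet A], W A → Y A} [hξ : QPT ξ] [hy' : QPT y] :
    QPT (fun A _ x => f A (ξ A x) (y A x)) := by
  obtain ⟨k, hk⟩ := hq
  obtain ⟨r, hr, -, hr'⟩ := hξ.exists_size_le
  obtain ⟨s, hs, -, hs'⟩ := hy'.exists_size_le
  have i0 : QPT (fun A _ (p : Ctx A × Y A) => g₀ A p.2) := h0.compose inferInstance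
  have i0' : QPT (fun A _ (p : (Ctx A × Y A) × Z A) => g₀ A p.1.2) := h0.compose inferInstance
  have i0'' : QPT (fun A _ (p : (Ctx A × Y A) × Formula A × Ctx A) => g₀ A p.1.2) :=
    h0.compose inferInstance
  have j0 : QPT (fun A _ (p : (Ctx A × Y A) × Ctx A × Formula A) => g₀ A p.1.2) :=
    h0.compose inferInstance
  have i1 : QPT (fun A _ (p : ((Ctx A × Y A) × Z A) × Ctx A × Formula A) =>
      g₁ A p.2.2 p.1.1.2 p.1.2) := h1.compose
    (f := fun A _ (p : ((Ctx A × Y A) × Z A) × Ctx A × Formula A) =>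
      (p.2.2, p.1.1.2, p.1.2)) inferInstance
  have i2 : QPT (fun A _ (p : ((Ctx A × Y A) × Z A) × Formula A × Ctx A) =>
      g₂ A p.2.1 p.1.1.2 p.1.2) := h2.compose
    (f := fun A _ (p : ((Ctx A × Y A) × Z A) × Formula A × Ctx A) =>
      (p.2.1, p.1.1.2, p.1.2)) inferInstance
  have i3 : QPT (fun A _ (p : ((Ctx A × Y A) × Z A) × Ctx A × Formula A) =>
      g₃ A p.2.2 p.1.1.2 p.1.2) := h3.compose
    (f := fun A _ (p : ((Ctx A × Y A) × Z A) × Ctx A × Formula A) =>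
      (p.2.2, p.1.1.2, p.1.2)) inferInstance
  have i4 : QPT (fun A _ (p : ((Ctx A × Y A) × Z A) × Formula A × Ctx A) =>
      g₄ A p.2.1 p.1.1.2 p.1.2) := h4.compose
    (f := fun A _ (p : ((Ctx A × Y A) × Z A) × Formula A × Ctx A) =>
      (p.2.1, p.1.1.2, p.1.2)) inferInstance
  have hm : ∀ (A : Type u) [AtomSet A] (ξ η : Ctx A) (y : Y A), esize A ξ ≤ esize A η →
      qb k (esize A ξ + esize A y) ≤ qb k (esize A η + esize A y) :=
    fun A _ α β y h => qb_mono le_rfl (by omega)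
  have key := QPT.rec_comp_one (X := fun A => Ctx A × Y A) (f := fun A _ p => f A p.1 p.2)
    (fun A _ p => p.1.elim true (fun _ _ => false) (fun _ _ => false) (fun _ _ => false)
      (fun _ _ => false))
    (fun A _ p => g₀ A p.2)
    (fun A _ p => p.1.elim p (fun ξ _ => (ξ, p.2)) (fun _ ξ => (ξ, p.2)) (fun ξ _ => (ξ, p.2))
      (fun _ ξ => (ξ, p.2)))
    (fun A _ p => p.1.1.elim (g₀ A p.1.2) (fun _ β => g₁ A β p.1.2 p.2)
      (fun β _ => g₂ A β p.1.2 p.2) (fun _ β => g₃ A β p.1.2 p.2)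
      (fun β _ => g₄ A β p.1.2 p.2))
    (by rintro A _ ⟨ξ, y⟩; cases ξ <;> simp [Ctx.elim, e₀])
    (by rintro A _ ⟨ξ, y⟩; cases ξ <;> simp [Ctx.elim, e₁, e₂, e₃, e₄])
    (fun A _ p => esize A p.1)
    (fun A _ p => esize A p.1 + esize A p.2 + qb k (esize A p.1 + esize A p.2) + 1)
    (by rintro A _ ⟨ξ, y⟩; cases ξ <;> simp [Ctx.elim]; all_goals omega)
    (by
      rintro A _ ⟨ξ, y⟩ hp
      have : ∀ η, esize A η ≤ esize A ξ →
          esize A η + esize A y + qb k (esize A η + esize A y) + 1 ≤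
          esize A ξ + esize A y + qb k (esize A ξ + esize A y) + 1 := fun η h => by
        have := hm A η ξ y h
        omega
      cases ξ with
      | hole => simp [Ctx.elim] at hp
      | _ => exact this _ (by
          simp only [Ctx.elim, esize_disjL, esize_disjR, esize_conjL, esize_conjR]; omega))
    (by rintro A _ ⟨ξ, y⟩; simp only [esize_pair]; omega)
    (by rintro A _ ⟨ξ, y⟩; have := (hf A ξ y).trans (hk _); simp; omega)
  exact QPT.of_rec_comp key (fun A _ x => (ξ A x, y A x))
    (q := fun n => r n + s n + qb k (r n + s n) + 1)
    (((hr.add hs).add ((hr.add hs).qb_comp k)).add (isQP_const 1))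
    (fun A _ x => by
      have h1 := hr' A x
      have h2 := hs' A x
      have : qb k (esize A (ξ A x) + esize A (y A x)) ≤ qb k (r (esize A x) + s (esize A x)) :=
        qb_mono le_rfl (by omega)
      simp only; omega)
    (fun A _ x => by have := hr' A x; simp; omega)

/-- Recursion on lists. The parameter `y` may change from call to call; `B` bounds all values that
occur in the recursion. -/
theorem QPT.listRec {f : ∀ (A : Type u) [AtomSet A], List (X A) → Y A → Z A}
    (g₀ : ∀ (A : Type u) [AtomSet A], Y A → Z A)
    (h : ∀ (A : Type u) [AtomSet A], X A → List (X A) → Y A → Y A)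
    (g₁ : ∀ (A : Type u) [AtomSet A], X A → List (X A) → Y A → Z A → Z A)
    [h0 : QPT g₀]
    [hh : QPT (fun A _ (p : X A × List (X A) × Y A) => h A p.1 p.2.1 p.2.2)]
    [h1 : QPT (fun A _ (p : X A × List (X A) × Y A × Z A) => g₁ A p.1 p.2.1 p.2.2.1 p.2.2.2)]
    (e₀ : ∀ (A : Type u) [AtomSet A] y, f A [] y = g₀ A y)
    (e₁ : ∀ (A : Type u) [AtomSet A] x l y,
      f A (x :: l) y = g₁ A x l y (f A l (h A x l y)))
    (B : ∀ (A : Type u) [AtomSet A], List (X A) → Y A → ℕ)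
    (hy : ∀ (A : Type u) [AtomSet A] l y, esize A y ≤ B A l y)
    (hf : ∀ (A : Type u) [AtomSet A] l y, esize A (f A l y) ≤ B A l y)
    (hc : ∀ (A : Type u) [AtomSet A] x l y, B A l (h A x l y) ≤ B A (x :: l) y)
    {q : ℕ → ℕ} (hq : IsQP q)
    (hB : ∀ (A : Type u) [AtomSet A] l y, B A l y ≤ q (esize A l + esize A y))
    {l : ∀ (A : Type u) [AtomSet A], W A → List (X A)}
    {y : ∀ (A : Type u) [AtomSet A], W A → Y A} [hl : QPT l] [hy' : QPT y] :
    QPT (fun A _ x => f A (l A x) (y A x)) := by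
  obtain ⟨k, hk⟩ := hq
  obtain ⟨r, hr, -, hr'⟩ := hl.exists_size_le
  obtain ⟨s, hs, -, hs'⟩ := hy'.exists_size_le
  have i0 : QPT (fun A _ (p : List (X A) × Y A) => g₀ A p.2) := h0.compose inferInstance
  have i0' : QPT (fun A _ (p : (List (X A) × Y A) × Z A) => g₀ A p.1.2) :=
    h0.compose inferInstance
  have i1 : QPT (fun A _ (p : ((List (X A) × Y A) × Z A) × X A × List (X A)) =>
      g₁ A p.2.1 p.2.2 p.1.1.2 p.1.2) := h1.compose
    (f := fun A _ (p : ((List (X A) × Y A) × Z A) × X A × List (X A)) =>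
      (p.2.1, p.2.2, p.1.1.2, p.1.2)) inferInstance
  have i2 : QPT (fun A _ (p : (List (X A) × Y A) × X A × List (X A)) =>
      h A p.2.1 p.2.2 p.1.2) := hh.compose
    (f := fun A _ (p : (List (X A) × Y A) × X A × List (X A)) =>
      (p.2.1, p.2.2, p.1.2)) inferInstance
  have key := QPT.rec_comp_one (X := fun A => List (X A) × Y A) (f := fun A _ p => f A p.1 p.2)
    (fun A _ p => DeepInference.listElim p.1 true (fun _ _ => false))
    (fun A _ p => g₀ A p.2)
    (fun A _ p => DeepInference.listElim p.1 p (fun x l => (l, h A x l p.2)))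
    (fun A _ p => DeepInference.listElim p.1.1 (g₀ A p.1.2) (fun x l => g₁ A x l p.1.2 p.2))
    (by rintro A _ ⟨l, y⟩; cases l <;> simp [DeepInference.listElim, e₀])
    (by rintro A _ ⟨l, y⟩; cases l <;> simp [DeepInference.listElim, e₁])
    (fun A _ p => esize A p.1)
    (fun A _ p => esize A p.1 + B A p.1 p.2 + 1)
    (by rintro A _ ⟨l, y⟩; cases l <;> simp [DeepInference.listElim])
    (by
      rintro A _ ⟨l, y⟩
      rcases l with _ | ⟨x, l⟩ <;> simp [DeepInference.listElim]
      have := hc A x l y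
      omega)
    (by rintro A _ ⟨l, y⟩; have := hy A l y; simp; omega)
    (by rintro A _ ⟨l, y⟩; have := hf A l y; simp; omega)
  exact QPT.of_rec_comp key (fun A _ x => (l A x, y A x))
    (q := fun n => r n + qb k (r n + s n) + 1)
    ((hr.add ((hr.add hs).qb_comp k)).add (isQP_const 1))
    (fun A _ x => by
      have h1 := hr' A x
      have h2 := hs' A x
      have h3 := (hB A (l A x) (y A x)).trans (hk _)
      have : qb k (esize A (l A x) + esize A (y A x)) ≤ qb k (r (esize A x) + s (esize A x)) :=
        qb_mono le_rfl (by omega)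
      simp only; omega)
    (fun A _ x => by have := hr' A x; simp; omega)

end

end DeepInference

namespace DeepInference
open Enc

/-! Scripts: descriptions of derivations in which the formulae are left implicit. -/

/-- Scripts. In `rule i` only the rule (and the atom, for the rules that introduce one) matters;
`disj` and `conj` work inside the two components of the formula. -/
inductive Scr (A : Type u) : Type u where
  | nop : Scr A
  | rule (i : Inst A) : Scr A
  | seq (s t : Scr A) : Scr A
  | disj (s t : Scr A) : Scr A
  | conj (s t : Scr A) : Scr A

/-- Encoding of scripts. -/
def Scr.encode {A : Type u} : Scr A → SExp A
  | .nop => .node 0 []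
  | .rule i => .node 1 [i.encode]
  | .seq s t => .node 2 [s.encode, t.encode]
  | .disj s t => .node 3 [s.encode, t.encode]
  | .conj s t => .node 4 [s.encode, t.encode]

instance (A : Type u) : Enc A (Scr A) := ⟨Scr.encode⟩

section

variable {X : Type u → Type v} {Y : Type u → Type w} {Z : Type u → Type v'}
  [∀ A, Enc A (X A)] [∀ A, Enc A (Y A)] [∀ A, Enc A (Z A)]

/-- Case distinction on a script. -/
def Scr.elim {A : Type u} {Z : Type v} (x : Scr A)
    (f0 : Z) (f1 : Inst A → Z) (f2 : Scr A → Scr A → Z) (f3 : Scr A → Scr A → Z) (f4 : Scr A → Scr A → Z) : Z :=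
  match x with
  | .nop => f0
  | .rule α => f1 α
  | .seq α β => f2 α β
  | .disj α β => f3 α β
  | .conj α β => f4 α β

instance QPT.scrElim {s : ∀ (A : Type u) [AtomSet A], X A → Scr A}
    {f0 : ∀ (A : Type u) [AtomSet A], X A → Z A}
    {f1 : ∀ (A : Type u) [AtomSet A], X A → Inst A → Z A}
    {f2 : ∀ (A : Type u) [AtomSet A], X A → Scr A → Scr A → Z A}
    {f3 : ∀ (A : Type u) [AtomSet A], X A → Scr A → Scr A → Z A}
    {f4 : ∀ (A : Type u) [AtomSet A], X A → Scr A → Scr A → Z A}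
    [hs : QPT s] [hf0 : QPT f0]
    [hf1 : QPT (fun A _ (p : X A × Inst A) => f1 A p.1 p.2)]
    [hf2 : QPT (fun A _ (p : X A × Scr A × Scr A) => f2 A p.1 p.2.1 p.2.2)]
    [hf3 : QPT (fun A _ (p : X A × Scr A × Scr A) => f3 A p.1 p.2.1 p.2.2)]
    [hf4 : QPT (fun A _ (p : X A × Scr A × Scr A) => f4 A p.1 p.2.1 p.2.2)] :
    QPT (fun A _ x => (s A x).elim (f0 A x)
      (fun α => f1 A x α)
      (fun α β => f2 A x α β)
      (fun α β => f3 A x α β)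
      (fun α β => f4 A x α β)) := by
  have ef0 : QPT (fun A _ (p : X A × Unit) => f0 A p.1) :=
    hf0.compose (f := fun A _ (p : X A × Unit) => p.1) inferInstance
  have ef1 : QPT (fun A _ (p : X A × Inst A × Unit) => f1 A p.1 p.2.1) :=
    hf1.compose (f := fun A _ (p : X A × Inst A × Unit) => (p.1, p.2.1)) inferInstance
  have ef2 : QPT (fun A _ (p : X A × Scr A × Scr A × Unit) => f2 A p.1 p.2.1 p.2.2.1) :=
    hf2.compose (f := fun A _ (p : X A × Scr A × Scr A × Unit) => (p.1, p.2.1, p.2.2.1)) inferInstance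
  have ef3 : QPT (fun A _ (p : X A × Scr A × Scr A × Unit) => f3 A p.1 p.2.1 p.2.2.1) :=
    hf3.compose (f := fun A _ (p : X A × Scr A × Scr A × Unit) => (p.1, p.2.1, p.2.2.1)) inferInstance
  have ef4 : QPT (fun A _ (p : X A × Scr A × Scr A × Unit) => f4 A p.1 p.2.1 p.2.2.1) :=
    hf4.compose (f := fun A _ (p : X A × Scr A × Scr A × Unit) => (p.1, p.2.1, p.2.2.1)) inferInstance
  refine QPT.of_case hs (Comp.nodeCases (l := [graph _, graph _, graph _, graph _, graph _]) (by
    simp only [List.mem_cons, List.not_mem_nil, or_false, forall_eq_or_imp, forall_eq]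
    exact ⟨ef0.comp, ef1.comp, ef2.comp, ef3.comp, ef4.comp⟩)) fun A _ x b hb => ?_
  generalize s A x = m at hb ⊢
  cases m with
  | nop => exact nodeCases_graph (k := 0) hb rfl (x, ()) rfl rfl
  | rule α => exact nodeCases_graph (k := 1) hb rfl (x, α, ()) rfl rfl
  | seq α β => exact nodeCases_graph (k := 2) hb rfl (x, α, β, ()) rfl rfl
  | disj α β => exact nodeCases_graph (k := 3) hb rfl (x, α, β, ()) rfl rfl
  | conj α β => exact nodeCases_graph (k := 4) hb rfl (x, α, β, ()) rfl rfl

instance QPT.scr_nop :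
    QPT (fun (A : Type u) _ (_ : X A) => (Scr.nop : Scr A)) :=
  (QPT.sexp_node 0 QPT.const_nil).of_enc fun A _ x => ⟨x, rfl, rfl⟩

instance QPT.scr_rule {f : ∀ (A : Type u) [AtomSet A], X A → Inst A}
    [hf : QPT f] :
    QPT (fun A _ x => Scr.rule (f A x)) :=
  (QPT.sexp_node 1 (hf.enc.sexp_cons QPT.const_nil)).of_enc fun A _ x => ⟨x, rfl, rfl⟩

instance QPT.scr_seq {f : ∀ (A : Type u) [AtomSet A], X A → Scr A} {g : ∀ (A : Type u) [AtomSet A], X A → Scr A}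
    [hf : QPT f] [hg : QPT g] :
    QPT (fun A _ x => Scr.seq (f A x) (g A x)) :=
  (QPT.sexp_node 2 (hf.enc.sexp_cons (hg.enc.sexp_cons QPT.const_nil))).of_enc fun A _ x => ⟨x, rfl, rfl⟩

instance QPT.scr_disj {f : ∀ (A : Type u) [AtomSet A], X A → Scr A} {g : ∀ (A : Type u) [AtomSet A], X A → Scr A}
    [hf : QPT f] [hg : QPT g] :
    QPT (fun A _ x => Scr.disj (f A x) (g A x)) :=
  (QPT.sexp_node 3 (hf.enc.sexp_cons (hg.enc.sexp_cons QPT.const_nil))).of_enc fun A _ x => ⟨x, rfl, rfl⟩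

instance QPT.scr_conj {f : ∀ (A : Type u) [AtomSet A], X A → Scr A} {g : ∀ (A : Type u) [AtomSet A], X A → Scr A}
    [hf : QPT f] [hg : QPT g] :
    QPT (fun A _ x => Scr.conj (f A x) (g A x)) :=
  (QPT.sexp_node 4 (hf.enc.sexp_cons (hg.enc.sexp_cons QPT.const_nil))).of_enc fun A _ x => ⟨x, rfl, rfl⟩


end

/-! ### The total interpretation of scripts. -/

section

variable {A : Type u}

@[simp] theorem esize_nop : esize A (Scr.nop : Scr A) = 3 := rfl
@[simp] theorem esize_rule (i : Inst A) : esize A (Scr.rule i) = esize A i + 6 := by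
  change SExp.size (.node 1 _) = _
  simp [SExp.node, SExp.ofList, SExp.size, List.replicate, esize, enc]; omega
@[simp] theorem esize_seq (s t : Scr A) :
    esize A (Scr.seq s t) = esize A s + esize A t + 9 := by
  change SExp.size (.node 2 _) = _
  simp [SExp.node, SExp.ofList, SExp.size, List.replicate, esize, enc]; omega
@[simp] theorem esize_scr_disj (s t : Scr A) :
    esize A (Scr.disj s t) = esize A s + esize A t + 11 := by
  change SExp.size (.node 3 _) = _
  simp [SExp.node, SExp.ofList, SExp.size, List.replicate, esize, enc]; omega
@[simp] theorem esize_scr_conj (s t : Scr A) :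
    esize A (Scr.conj s t) = esize A s + esize A t + 13 := by
  change SExp.size (.node 4 _) = _
  simp [SExp.node, SExp.ofList, SExp.size, List.replicate, esize, enc]; omega

/-- The instance of the rule of `e`, read from left to right, that applies to a formula. -/
def EqInst.applyLR (e : EqInst A) (φ : Formula A) (d : Inst A) : Inst A :=
  e.elim
    (fun _ _ => φ.elim d d (fun _ => d) (fun α β => .eqLR (.disjComm α β)) (fun _ _ => d))
    (fun _ _ => φ.elim d d (fun _ => d) (fun _ _ => d) (fun α β => .eqLR (.conjComm α β)))
    (fun _ _ _ => φ.elim d d (fun _ => d) (fun ψ γ => ψ.elim d d (fun _ => d)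
      (fun α β => .eqLR (.disjAssoc α β γ)) (fun _ _ => d)) (fun _ _ => d))
    (fun _ _ _ => φ.elim d d (fun _ => d) (fun _ _ => d) (fun ψ γ => ψ.elim d d (fun _ => d)
      (fun _ _ => d) (fun α β => .eqLR (.conjAssoc α β γ))))
    (fun _ => φ.elim d d (fun _ => d) (fun α β => β.elim (.eqLR (.disjFf α)) d (fun _ => d)
      (fun _ _ => d) (fun _ _ => d)) (fun _ _ => d))
    (fun _ => φ.elim d d (fun _ => d) (fun _ _ => d) (fun α β => β.elim d (.eqLR (.conjTt α))
      (fun _ => d) (fun _ _ => d) (fun _ _ => d)))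
    (φ.elim d d (fun _ => d) (fun α β => α.elim d (β.elim d (.eqLR .disjTtTt) (fun _ => d)
      (fun _ _ => d) (fun _ _ => d)) (fun _ => d) (fun _ _ => d) (fun _ _ => d)) (fun _ _ => d))
    (φ.elim d d (fun _ => d) (fun _ _ => d) (fun α β => α.elim (β.elim (.eqLR .conjFfFf) d
      (fun _ => d) (fun _ _ => d) (fun _ _ => d)) d (fun _ => d) (fun _ _ => d) (fun _ _ => d)))

/-- The instance of the rule of `e`, read from right to left, that applies to a formula. -/
def EqInst.applyRL (e : EqInst A) (φ : Formula A) (d : Inst A) : Inst A :=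
  e.elim
    (fun _ _ => φ.elim d d (fun _ => d) (fun α β => .eqRL (.disjComm β α)) (fun _ _ => d))
    (fun _ _ => φ.elim d d (fun _ => d) (fun _ _ => d) (fun α β => .eqRL (.conjComm β α)))
    (fun _ _ _ => φ.elim d d (fun _ => d) (fun α ψ => ψ.elim d d (fun _ => d)
      (fun β γ => .eqRL (.disjAssoc α β γ)) (fun _ _ => d)) (fun _ _ => d))
    (fun _ _ _ => φ.elim d d (fun _ => d) (fun _ _ => d) (fun α ψ => ψ.elim d d (fun _ => d)
      (fun _ _ => d) (fun β γ => .eqRL (.conjAssoc α β γ))))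
    (fun _ => .eqRL (.disjFf φ))
    (fun _ => .eqRL (.conjTt φ))
    (φ.elim d (.eqRL .disjTtTt) (fun _ => d) (fun _ _ => d) (fun _ _ => d))
    (φ.elim (.eqRL .conjFfFf) d (fun _ => d) (fun _ _ => d) (fun _ _ => d))

/-- The instance of the rule of `i` that applies to the formula `φ`. If there is none, then the
result is an instance of `=`. -/
noncomputable def Inst.apply (i : Inst A) (φ : Formula A) (d : Inst A) : Inst A :=
  i.elim
    (fun a => φ.elim d (.aiDown a) (fun _ => d) (fun _ _ => d) (fun _ _ => d))
    (fun a => φ.elim (.awDown a) d (fun _ => d) (fun _ _ => d) (fun _ _ => d))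
    (fun _ => φ.elim d d (fun _ => d)
      (fun α β => α.elim d d (fun b => β.elim d d (fun c => bif aeq b c then .acDown b else d)
        (fun _ _ => d) (fun _ _ => d)) (fun _ _ => d) (fun _ _ => d)) (fun _ _ => d))
    (fun _ => d)
    (fun _ => φ.elim d d (fun b => .awUp b) (fun _ _ => d) (fun _ _ => d))
    (fun _ => φ.elim d d (fun b => .acUp b) (fun _ _ => d) (fun _ _ => d))
    (fun _ _ _ => φ.elim d d (fun _ => d) (fun _ _ => d) (fun α ψ => ψ.elim d d (fun _ => d)
      (fun β γ => .switch α β γ) (fun _ _ => d)))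
    (fun _ _ _ _ => φ.elim d d (fun _ => d)
      (fun ψ χ => ψ.elim d d (fun _ => d) (fun _ _ => d)
        (fun α β => χ.elim d d (fun _ => d) (fun _ _ => d) (fun γ δ => .medial α β γ δ)))
      (fun _ _ => d))
    (fun e => e.applyLR φ d)
    (fun e => e.applyRL φ d)

/-- The instance of the rule of `i` that applies to `φ`, or else `φ = (φ ∧ t)`. -/
noncomputable def Inst.at (i : Inst A) (φ : Formula A) : Inst A :=
  i.apply φ (.eqRL (.conjTt φ))

variable [AtomSet A]

/-- If the pattern of the rule matches φ, the new instance is built from the matching parts of φ;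
otherwise d is returned. The clause for the cut returns d in any case. For this reason no script can
produce an invalid derivation or a cut. -/
theorem Inst.apply_spec (i : Inst A) (φ : Formula A) (d : Inst A) (hd : d.premiss = φ)
    (hd' : d.rule = .eq) : (i.apply φ d).premiss = φ ∧ (i.apply φ d).rule ≠ .aiUp := by
  have hd'' : d.rule ≠ .aiUp := by rw [hd']; simp
  have H : d.premiss = φ ∧ d.rule ≠ .aiUp := ⟨hd, hd''⟩
  have haeq : ∀ a b : A, aeq a b = true → a = b := fun a b h => by simpa [aeq] using h
  rcases i with _ | _ | _ | _ | _ | _ | _ | _ | e | e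
  case eqLR =>
    cases e <;> simp only [Inst.apply, EqInst.applyLR, Inst.elim, EqInst.elim]
    all_goals rcases φ with _ | _ | _ | ⟨α, β⟩ | ⟨α, β⟩ <;> simp only [Formula.elim] <;>
      first | exact H | exact ⟨rfl, by simp [Inst.rule]⟩ | skip
    all_goals (first
      | (cases α <;> simp only [Formula.elim] <;> first | exact H | exact ⟨rfl, by simp [Inst.rule]⟩)
      | (cases β <;> simp only [Formula.elim] <;> first | exact H | exact ⟨rfl, by simp [Inst.rule]⟩)
      | (cases α <;> cases β <;> simp only [Formula.elim] <;>
          first | exact H | exact ⟨rfl, by simp [Inst.rule]⟩))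
  case eqRL =>
    cases e <;> simp only [Inst.apply, EqInst.applyRL, Inst.elim, EqInst.elim] <;>
      first | exact ⟨rfl, by simp [Inst.rule]⟩ | skip
    all_goals rcases φ with _ | _ | _ | ⟨α, β⟩ | ⟨α, β⟩ <;> simp only [Formula.elim] <;>
      first | exact H | exact ⟨rfl, by simp [Inst.rule]⟩ | skip
    all_goals (cases β <;> simp only [Formula.elim] <;>
      first | exact H | exact ⟨rfl, by simp [Inst.rule]⟩)
  all_goals simp only [Inst.apply, Inst.elim]
  all_goals first | exact H | skip
  all_goals rcases φ with _ | _ | _ | ⟨α, β⟩ | ⟨α, β⟩ <;> simp only [Formula.elim] <;>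
    first | exact H | exact ⟨rfl, by simp [Inst.rule]⟩ | skip
  · rcases α with _ | _ | a | _ | _ <;> simp only [Formula.elim] <;> first | exact H | skip
    rcases β with _ | _ | b | _ | _ <;> simp only [Formula.elim] <;> first | exact H | skip
    cases h : aeq a b
    · exact H
    · rw [haeq a b h]
      exact ⟨rfl, by simp [Inst.rule]⟩
  · cases β <;> simp only [Formula.elim] <;> first | exact H | exact ⟨rfl, by simp [Inst.rule]⟩
  · cases α <;> cases β <;> simp only [Formula.elim] <;>
      first | exact H | exact ⟨rfl, by simp [Inst.rule]⟩

theorem Inst.at_premiss (i : Inst A) (φ : Formula A) : (i.at φ).premiss = φ :=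
  (i.apply_spec φ _ rfl rfl).1

theorem Inst.at_rule (i : Inst A) (φ : Formula A) : (i.at φ).rule ≠ .aiUp :=
  (i.apply_spec φ _ rfl rfl).2

/-- The conclusion of the derivation that a script describes. -/
noncomputable def Scr.act : Scr A → Formula A → Formula A
  | .nop, φ => φ
  | .rule i, φ => (i.at φ).conclusion
  | .seq s t, φ => t.act (s.act φ)
  | .disj s t, φ =>
    φ.elim φ φ (fun _ => φ) (fun α β => .disj (s.act α) (t.act β)) (fun _ _ => φ)
  | .conj s t, φ =>
    φ.elim φ φ (fun _ => φ) (fun _ _ => φ) (fun α β => .conj (s.act α) (t.act β))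

/-- A step inside the left component of a disjunction. -/
def Step.disjL (s : Step A) (β : Formula A) : Step A := ⟨.disjL s.ctx β, s.inst⟩
/-- A step inside the right component of a disjunction. -/
def Step.disjR (α : Formula A) (s : Step A) : Step A := ⟨.disjR α s.ctx, s.inst⟩
/-- A step inside the left component of a conjunction. -/
def Step.conjL (s : Step A) (β : Formula A) : Step A := ⟨.conjL s.ctx β, s.inst⟩
/-- A step inside the right component of a conjunction. -/
def Step.conjR (α : Formula A) (s : Step A) : Step A := ⟨.conjR α s.ctx, s.inst⟩

/-- The steps of the derivation that a script describes. -/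
noncomputable def Scr.steps : Scr A → Formula A → List (Step A)
  | .nop, _ => []
  | .rule i, φ => [⟨.hole, i.at φ⟩]
  | .seq s t, φ => s.steps φ ++ t.steps (s.act φ)
  | .disj s t, φ =>
    φ.elim [] [] (fun _ => []) (fun α β => (s.steps α).map (fun x => x.disjL β) ++
      (t.steps β).map (fun x => x.disjR (s.act α))) (fun _ _ => [])
  | .conj s t, φ =>
    φ.elim [] [] (fun _ => []) (fun _ _ => []) (fun α β => (s.steps α).map (fun x => x.conjL β) ++
      (t.steps β).map (fun x => x.conjR (s.act α)))

theorem IsChain.append {α β γ : Formula A} {l m : List (Step A)} (hl : IsChain α l β)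
    (hm : IsChain β m γ) : IsChain α (l ++ m) γ := by
  induction l generalizing α with
  | nil => obtain rfl : α = β := hl; exact hm
  | cons s l ih => exact ⟨hl.1, ih hl.2⟩

theorem IsChain.map {α β : Formula A} {l : List (Step A)} (hl : IsChain α l β)
    {F : Formula A → Formula A} {G : Step A → Step A}
    (hp : ∀ s, (G s).premiss = F s.premiss) (hc : ∀ s, (G s).conclusion = F s.conclusion) :
    IsChain (F α) (l.map G) (F β) := by
  induction l generalizing α with
  | nil => exact congrArg F hl
  | cons s l ih =>
    refine ⟨(hp s).trans (congrArg F hl.1), ?_⟩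
    rw [hc]
    exact ih hl.2

/-- No hypothesis on φ is needed: an instruction that does not fit is replaced by an equation or
skipped. To verify a derived rule it is therefore enough to compute `Scr.act`. -/
theorem Scr.isChain (s : Scr A) (φ : Formula A) : IsChain φ (s.steps φ) (s.act φ) := by
  induction s generalizing φ with
  | nop => rfl
  | rule i => exact ⟨i.at_premiss φ, rfl⟩
  | seq s t hs ht => exact (hs φ).append (ht _)
  | disj s t hs ht =>
    rcases φ with _ | _ | _ | ⟨α, β⟩ | ⟨α, β⟩ <;> first | rfl | skip
    exact ((hs α).map (F := fun α => .disj α β) (fun _ => rfl) (fun _ => rfl)).append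
      ((ht β).map (F := fun β => .disj (s.act α) β) (fun _ => rfl) (fun _ => rfl))
  | conj s t hs ht =>
    rcases φ with _ | _ | _ | ⟨α, β⟩ | ⟨α, β⟩ <;> first | rfl | skip
    exact ((hs α).map (F := fun α => .conj α β) (fun _ => rfl) (fun _ => rfl)).append
      ((ht β).map (F := fun β => .conj (s.act α) β) (fun _ => rfl) (fun _ => rfl))

theorem Scr.rule_ne (s : Scr A) (φ : Formula A) : ∀ x ∈ s.steps φ, x.inst.rule ≠ .aiUp := by
  induction s generalizing φ with
  | nop => simp [Scr.steps]
  | rule i => simpa [Scr.steps] using i.at_rule φ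
  | seq s t hs ht =>
    intro x hx
    rcases List.mem_append.1 hx with hx | hx
    · exact hs _ x hx
    · exact ht _ x hx
  | disj s t hs ht =>
    cases φ <;> simp only [Scr.steps, Formula.elim, List.not_mem_nil, false_imp_iff,
      implies_true, List.mem_append, List.mem_map]
    rintro x (⟨y, hy, rfl⟩ | ⟨y, hy, rfl⟩)
    · exact hs _ y hy
    · exact ht _ y hy
  | conj s t hs ht =>
    cases φ <;> simp only [Scr.steps, Formula.elim, List.not_mem_nil, false_imp_iff,
      implies_true, List.mem_append, List.mem_map]
    rintro x (⟨y, hy, rfl⟩ | ⟨y, hy, rfl⟩)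
    · exact hs _ y hy
    · exact ht _ y hy

end

end DeepInference

/-! ### Computability of operations on lists. -/

namespace DeepInference
open Enc

section

variable {X : Type u → Type v} {Y : Type u → Type w} {Z : Type u → Type v'} {W : Type u → Type w'}
  [∀ A, Enc A (X A)] [∀ A, Enc A (Y A)] [∀ A, Enc A (Z A)] [∀ A, Enc A (W A)]

theorem esize_append {A : Type u} {T : Type v} [Enc A T] (l m : List T) :
    esize A (l ++ m) + 1 = esize A l + esize A m := by
  induction l with
  | nil => simp; omega
  | cons x l ih => simp; omega

instance QPT.list_append {f g : ∀ (A : Type u) [AtomSet A], X A → List (Y A)} [hf : QPT f]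
    [hg : QPT g] : QPT (fun A _ x => f A x ++ g A x) :=
  QPT.listRec (f := fun A _ (l m : List (Y A)) => l ++ m) (fun A _ m => m) (fun A _ _ _ m => m)
    (fun A _ x _ _ z => x :: z) (fun _ _ _ => rfl) (fun _ _ _ _ _ => rfl)
    (fun A _ l m => esize A l + esize A m) (fun _ _ _ _ => by omega)
    (fun A _ l m => by have := esize_append l m (A := A); omega)
    (fun A _ x l m => by simp; omega) isQP_id (fun _ _ _ _ => le_rfl)

theorem esize_mem_le {A : Type u} {T : Type v} [Enc A T] {l : List T} {x : T} (h : x ∈ l) :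
    esize A x + 1 ≤ esize A l := by
  induction l with
  | nil => simp at h
  | cons y l ih =>
    rcases List.mem_cons.1 h with rfl | h
    · simp
    · have := ih h
      simp; omega

theorem length_le_esize {A : Type u} {T : Type v} [Enc A T] (l : List T) :
    l.length + 1 ≤ esize A l := by
  induction l with
  | nil => simp
  | cons y l ih => simp; omega

theorem esize_le_of_forall {A : Type u} {T : Type v} [Enc A T] {l : List T} {b : ℕ}
    (h : ∀ x ∈ l, esize A x ≤ b) : esize A l ≤ l.length * (b + 1) + 1 := by
  induction l with
  | nil => simp
  | cons y l ih =>
    have h1 := h y (by simp)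
    have h2 := ih fun x hx => h x (by simp [hx])
    rw [esize_cons, List.length_cons, Nat.succ_mul]
    omega

/-- The image of a list under a function with a parameter. -/
theorem QPT.list_map {g : ∀ (A : Type u) [AtomSet A], Y A → Z A → W A}
    {f : ∀ (A : Type u) [AtomSet A], X A → List (Y A)}
    {y : ∀ (A : Type u) [AtomSet A], X A → Z A} [hf : QPT f] [hy : QPT y]
    [hg : QPT (fun A _ (p : Y A × Z A) => g A p.1 p.2)] :
    QPT (fun A _ x => (f A x).map (fun t => g A t (y A x))) := by
  obtain ⟨r, hr, hm, hr'⟩ := hg.exists_size_le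
  have i1 : QPT (fun A _ (p : Y A × List (Y A) × Z A × List (W A)) => g A p.1 p.2.2.1) :=
    hg.compose (f := fun A _ (p : Y A × List (Y A) × Z A × List (W A)) => (p.1, p.2.2.1))
      inferInstance
  refine QPT.listRec (f := fun A _ (l : List (Y A)) (y : Z A) => l.map (fun t => g A t y))
    (fun A _ _ => []) (fun A _ _ _ y => y)
    (fun A _ t _ y z => g A t y :: z) (fun _ _ _ => rfl) (fun _ _ _ _ _ => rfl)
    (fun A _ l y => esize A y + esize A l * (r (esize A l + esize A y) + 1) + 1)
    (fun _ _ _ _ => by omega) (fun A _ l y => ?_) (fun A _ x l y => ?_)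
    (q := fun n => n + n * (r n + 1) + 1)
    ((isQP_id.add (isQP_id.mul (hr.add (isQP_const 1)))).add (isQP_const 1)) (fun A _ l y => ?_)
  · have h1 : ∀ w ∈ l.map (fun t => g A t y), esize A w ≤ r (esize A l + esize A y) := by
      intro w hw
      obtain ⟨t, ht, rfl⟩ := List.mem_map.1 hw
      refine (hr' A (t, y)).trans (hm ?_)
      have := esize_mem_le (A := A) ht
      simp; omega
    have h2 := esize_le_of_forall h1
    rw [List.length_map] at h2
    have h3 := Nat.mul_le_mul_right (r (esize A l + esize A y) + 1)
      ((Nat.le_succ _).trans (length_le_esize (A := A) l))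
    omega
  · have h1 : esize A l ≤ esize A (x :: l) := by simp; omega
    have h2 : r (esize A l + esize A y) + 1 ≤ r (esize A (x :: l) + esize A y) + 1 :=
      Nat.add_le_add_right (hm (by omega)) 1
    have := Nat.mul_le_mul h1 h2
    omega
  · have h2 := Nat.mul_le_mul (show esize A l ≤ esize A l + esize A y by omega)
      (le_refl (r (esize A l + esize A y) + 1))
    omega

end

/-! Sizes of formulae and of their representations. -/

section

variable {A : Type u}

theorem Formula.one_le_size (φ : Formula A) : 1 ≤ φ.size := by
  induction φ <;> simp only [Formula.size] <;> omega

/-- The slack 11 drives the induction: the overhead of a node is at most 11, and two components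
bring twice the slack that is needed afterwards. -/
theorem Formula.esize_le (φ : Formula A) : esize A φ + 11 ≤ 20 * φ.size := by
  induction φ <;> simp [Formula.size] <;> omega

theorem Formula.size_le_esize (φ : Formula A) : φ.size ≤ esize A φ := by
  induction φ <;> simp [Formula.size] <;> omega

theorem Ctx.size_le_fill (ξ : Ctx A) (γ : Formula A) : γ.size ≤ (ξ.fill γ).size := by
  induction ξ <;> simp only [Ctx.fill, Formula.size] <;> omega

theorem Ctx.esize_le (ξ : Ctx A) (γ : Formula A) : esize A ξ + 20 ≤ 40 * (ξ.fill γ).size := by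
  induction ξ with
  | hole => have := γ.one_le_size; simp [Ctx.fill]; omega
  | disjL ξ β ih | disjR β ξ ih | conjL ξ β ih | conjR β ξ ih =>
    have h1 := β.esize_le
    have h2 := β.one_le_size
    simp only [Ctx.fill, Formula.size, esize_disjL, esize_disjR, esize_conjL, esize_conjR]
    omega

theorem EqInst.esize_le (e : EqInst A) : esize A e ≤ 20 * (e.lhs.size + e.rhs.size) := by
  cases e
  case disjTtTt => exact Nat.le_of_ble_eq_true rfl
  case conjFfFf => exact Nat.le_of_ble_eq_true rfl
  all_goals
    simp only [EqInst.lhs, EqInst.rhs, Formula.size]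
    change SExp.size (.node _ _) ≤ _
    simp only [SExp.node, SExp.ofList, SExp.size, List.replicate]
  case disjComm α β | conjComm α β =>
    have h1 : α.encode.size + 11 ≤ 20 * α.size := α.esize_le
    have h2 : β.encode.size + 11 ≤ 20 * β.size := β.esize_le
    omega
  case disjAssoc α β γ | conjAssoc α β γ =>
    have h1 : α.encode.size + 11 ≤ 20 * α.size := α.esize_le
    have h2 : β.encode.size + 11 ≤ 20 * β.size := β.esize_le
    have h3 : γ.encode.size + 11 ≤ 20 * γ.size := γ.esize_le
    omega
  case disjFf α | conjTt α =>
    have h1 : α.encode.size + 11 ≤ 20 * α.size := α.esize_le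
    omega

theorem Inst.esize_le [AtomSet A] (i : Inst A) :
    esize A i ≤ 40 * (i.premiss.size + i.conclusion.size) := by
  cases i
  case switch α β γ =>
    have h1 : α.encode.size + 11 ≤ 20 * α.size := α.esize_le
    have h2 : β.encode.size + 11 ≤ 20 * β.size := β.esize_le
    have h3 : γ.encode.size + 11 ≤ 20 * γ.size := γ.esize_le
    simp only [Inst.premiss, Inst.conclusion, Formula.size]
    change SExp.size (.node _ _) ≤ _
    simp only [SExp.node, SExp.ofList, SExp.size, List.replicate]
    omega
  case medial α β γ δ =>
    have h1 : α.encode.size + 11 ≤ 20 * α.size := α.esize_le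
    have h2 : β.encode.size + 11 ≤ 20 * β.size := β.esize_le
    have h3 : γ.encode.size + 11 ≤ 20 * γ.size := γ.esize_le
    have h4 : δ.encode.size + 11 ≤ 20 * δ.size := δ.esize_le
    simp only [Inst.premiss, Inst.conclusion, Formula.size]
    change SExp.size (.node _ _) ≤ _
    simp only [SExp.node, SExp.ofList, SExp.size, List.replicate]
    omega
  case eqLR e | eqRL e =>
    have h1 : e.encode.size ≤ 20 * (e.lhs.size + e.rhs.size) := e.esize_le
    have h2 := e.lhs.one_le_size
    have h3 := e.rhs.one_le_size
    simp only [Inst.premiss, Inst.conclusion]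
    change SExp.size (.node _ _) ≤ _
    simp only [SExp.node, SExp.ofList, SExp.size, List.replicate]
    omega
  all_goals exact Nat.le_of_ble_eq_true rfl

/-- The size of a derivation counts only its formulae. The context and the rule instance recorded in
a step are made from parts of the premiss and the conclusion, so the encoding is not much larger. -/
theorem Step.esize_le [AtomSet A] (s : Step A) :
    esize A s ≤ 80 * (s.premiss.size + s.conclusion.size) := by
  have h1 := s.inst.esize_le
  have h2 := s.ctx.esize_le s.inst.premiss
  have h3 := s.ctx.size_le_fill s.inst.premiss
  have h4 := s.ctx.size_le_fill s.inst.conclusion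
  simp only [esize_step, Step.premiss, Step.conclusion]
  omega

/-- The increase by one occurs for identity, cocontraction and the equations that introduce a unit.
Along a derivation, formulae therefore grow at most by the number of steps. -/
theorem Inst.conclusion_size_le [AtomSet A] (i : Inst A) :
    i.conclusion.size ≤ i.premiss.size + 1 := by
  rcases i with _ | _ | _ | _ | _ | _ | _ | _ | e | e <;>
    first
    | (simp only [Inst.premiss, Inst.conclusion, Formula.size]; omega)
    | (cases e <;> simp only [Inst.premiss, Inst.conclusion, EqInst.lhs, EqInst.rhs,
        Formula.size] <;> omega)

theorem Scr.act_size_le [AtomSet A] (s : Scr A) (φ : Formula A) :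
    (s.act φ).size + 2 ≤ φ.size + esize A s := by
  induction s generalizing φ with
  | nop => simp [Scr.act]
  | rule i =>
    have := (i.at φ).conclusion_size_le
    rw [i.at_premiss] at this
    simp only [Scr.act, esize_rule]; omega
  | seq s t hs ht =>
    have h1 := hs φ
    have h2 := ht (s.act φ)
    simp only [Scr.act, esize_seq]; omega
  | disj s t hs ht =>
    rcases φ with _ | _ | _ | ⟨α, β⟩ | ⟨α, β⟩ <;>
      simp only [Scr.act, Formula.elim, Formula.size, esize_scr_disj] <;> try omega
    have h1 := hs α
    have h2 := ht β
    omega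
  | conj s t hs ht =>
    rcases φ with _ | _ | _ | ⟨α, β⟩ | ⟨α, β⟩ <;>
      simp only [Scr.act, Formula.elim, Formula.size, esize_scr_conj] <;> try omega
    have h1 := hs α
    have h2 := ht β
    omega

theorem Scr.steps_size_le [AtomSet A] (s : Scr A) (φ : Formula A) :
    ∀ x ∈ s.steps φ, x.premiss.size + 1 ≤ φ.size + esize A s ∧
      x.conclusion.size + 1 ≤ φ.size + esize A s := by
  induction s generalizing φ with
  | nop => simp [Scr.steps]
  | rule i =>
    intro x hx
    obtain rfl : x = ⟨.hole, i.at φ⟩ := by simpa [Scr.steps] using hx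
    have := (i.at φ).conclusion_size_le
    rw [i.at_premiss] at this
    simp only [Step.premiss, Step.conclusion, Ctx.fill, i.at_premiss, esize_rule]
    omega
  | seq s t hs ht =>
    intro x hx
    have h := s.act_size_le φ
    rw [esize_seq]
    rcases List.mem_append.1 hx with hx | hx
    · have := hs _ x hx
      omega
    · have := ht _ x hx
      omega
  | disj s t hs ht =>
    rcases φ with _ | _ | _ | ⟨α, β⟩ | ⟨α, β⟩ <;>
      simp only [Scr.steps, Formula.elim, List.not_mem_nil, false_imp_iff,
      implies_true, List.mem_append, List.mem_map, Formula.size, esize_scr_disj]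
    rintro x (⟨y, hy, rfl⟩ | ⟨y, hy, rfl⟩)
    · have := hs _ y hy
      simp only [Step.premiss, Step.conclusion, Step.disjL, Ctx.fill, Formula.size] at this ⊢
      omega
    · have := ht _ y hy
      have h := s.act_size_le α
      simp only [Step.premiss, Step.conclusion, Step.disjR, Ctx.fill, Formula.size] at this ⊢
      omega
  | conj s t hs ht =>
    rcases φ with _ | _ | _ | ⟨α, β⟩ | ⟨α, β⟩ <;>
      simp only [Scr.steps, Formula.elim, List.not_mem_nil, false_imp_iff,
      implies_true, List.mem_append, List.mem_map, Formula.size, esize_scr_conj]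
    rintro x (⟨y, hy, rfl⟩ | ⟨y, hy, rfl⟩)
    · have := hs _ y hy
      simp only [Step.premiss, Step.conclusion, Step.conjL, Ctx.fill, Formula.size] at this ⊢
      omega
    · have := ht _ y hy
      have h := s.act_size_le α
      simp only [Step.premiss, Step.conclusion, Step.conjR, Ctx.fill, Formula.size] at this ⊢
      omega

theorem Scr.steps_length_le [AtomSet A] (s : Scr A) (φ : Formula A) :
    (s.steps φ).length ≤ esize A s := by
  induction s generalizing φ with
  | nop => simp [Scr.steps]
  | rule i => simp [Scr.steps]
  | seq s t hs ht =>
    have h1 := hs φ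
    have h2 := ht (s.act φ)
    simp only [Scr.steps, esize_seq, List.length_append]; omega
  | disj s t hs ht =>
    rcases φ with _ | _ | _ | ⟨α, β⟩ | ⟨α, β⟩ <;>
      simp only [Scr.steps, Formula.elim, List.length_nil, List.length_append, List.length_map,
        esize_scr_disj] <;> try omega
    have h1 := hs α
    have h2 := ht β
    omega
  | conj s t hs ht =>
    rcases φ with _ | _ | _ | ⟨α, β⟩ | ⟨α, β⟩ <;>
      simp only [Scr.steps, Formula.elim, List.length_nil, List.length_append, List.length_map,
        esize_scr_conj] <;> try omega
    have h1 := hs α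
    have h2 := ht β
    omega

/-- Both the number of steps and the size of each are linear in the formula and the script, so
expansion costs no more than a square. From here on it suffices to control the sizes of scripts. -/
theorem Scr.esize_steps_le [AtomSet A] (s : Scr A) (φ : Formula A) :
    esize A (s.steps φ) ≤ 160 * (φ.size + esize A s) ^ 2 := by
  have h1 : ∀ x ∈ s.steps φ, esize A x ≤ 160 * (φ.size + esize A s) - 160 := fun x hx => by
    have := s.steps_size_le φ x hx
    have := x.esize_le
    omega
  have h2 := esize_le_of_forall h1
  have h3 := s.steps_length_le φ
  have h4 := φ.one_le_size
  have h5 := one_le_esize (A := A) s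
  obtain ⟨m, hm⟩ : ∃ m, φ.size + esize A s = m + 1 := ⟨φ.size + esize A s - 1, by omega⟩
  rw [hm] at h2 ⊢
  rw [show 160 * (m + 1) - 160 + 1 = 160 * m + 1 by omega] at h2
  have h6 := Nat.mul_le_mul_right (160 * m + 1) (show (s.steps φ).length ≤ m by omega)
  nlinarith

end

/-! ### Computability of the interpreter of scripts. -/

section

variable {X : Type u → Type v} {Y : Type u → Type w} {Z : Type u → Type v'} {W : Type u → Type w'}
  [∀ A, Enc A (X A)] [∀ A, Enc A (Y A)] [∀ A, Enc A (Z A)] [∀ A, Enc A (W A)]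

set_option synthInstance.maxSize 10000 in
set_option synthInstance.maxHeartbeats 400000 in
set_option maxHeartbeats 1000000 in
instance QPT.applyLR {e : ∀ (A : Type u) [AtomSet A], X A → EqInst A}
    {φ : ∀ (A : Type u) [AtomSet A], X A → Formula A}
    {d : ∀ (A : Type u) [AtomSet A], X A → Inst A} [he : QPT e] [hφ : QPT φ] [hd : QPT d] :
    QPT (fun A _ x => (e A x).applyLR (φ A x) (d A x)) := by
  have : QPT (fun A _ (p : EqInst A × Formula A × Inst A) => p.1.applyLR p.2.1 p.2.2) := by
    unfold EqInst.applyLR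
    infer_instance
  exact this.compose (f := fun A _ x => (e A x, φ A x, d A x)) inferInstance

set_option synthInstance.maxSize 10000 in
set_option synthInstance.maxHeartbeats 400000 in
set_option maxHeartbeats 1000000 in
instance QPT.applyRL {e : ∀ (A : Type u) [AtomSet A], X A → EqInst A}
    {φ : ∀ (A : Type u) [AtomSet A], X A → Formula A}
    {d : ∀ (A : Type u) [AtomSet A], X A → Inst A} [he : QPT e] [hφ : QPT φ] [hd : QPT d] :
    QPT (fun A _ x => (e A x).applyRL (φ A x) (d A x)) := by
  have : QPT (fun A _ (p : EqInst A × Formula A × Inst A) => p.1.applyRL p.2.1 p.2.2) := by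
    unfold EqInst.applyRL
    infer_instance
  exact this.compose (f := fun A _ x => (e A x, φ A x, d A x)) inferInstance

set_option synthInstance.maxSize 10000 in
set_option synthInstance.maxHeartbeats 400000 in
set_option maxHeartbeats 1000000 in
instance QPT.inst_apply {i : ∀ (A : Type u) [AtomSet A], X A → Inst A}
    {φ : ∀ (A : Type u) [AtomSet A], X A → Formula A}
    {d : ∀ (A : Type u) [AtomSet A], X A → Inst A} [hi : QPT i] [hφ : QPT φ] [hd : QPT d] :
    QPT (fun A _ x => (i A x).apply (φ A x) (d A x)) := by
  have : QPT (fun A _ (p : Inst A × Formula A × Inst A) => p.1.apply p.2.1 p.2.2) := by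
    unfold Inst.apply
    infer_instance
  exact this.compose (f := fun A _ x => (i A x, φ A x, d A x)) inferInstance

instance QPT.inst_at {i : ∀ (A : Type u) [AtomSet A], X A → Inst A}
    {φ : ∀ (A : Type u) [AtomSet A], X A → Formula A} [hi : QPT i] [hφ : QPT φ] :
    QPT (fun A _ x => (i A x).at (φ A x)) := by
  unfold Inst.at
  infer_instance

theorem QPT.lhs' : QPT (fun (A : Type u) _ (e : EqInst A) => e.lhs) := by
  have : QPT (fun (A : Type u) _ (e : EqInst A) => e.elim (fun α β => Formula.disj α β)
      (fun α β => Formula.conj α β) (fun α β γ => Formula.disj (Formula.disj α β) γ)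
      (fun α β γ => Formula.conj (Formula.conj α β) γ) (fun α => Formula.disj α Formula.ff) (fun α => Formula.conj α Formula.tt)
      (Formula.disj Formula.tt Formula.tt) (Formula.conj (Formula.ff : Formula A) Formula.ff)) := inferInstance
  exact this.of_eq fun A _ e => by cases e <;> rfl

theorem QPT.rhs' : QPT (fun (A : Type u) _ (e : EqInst A) => e.rhs) := by
  have : QPT (fun (A : Type u) _ (e : EqInst A) => e.elim (fun α β => Formula.disj β α)
      (fun α β => Formula.conj β α) (fun α β γ => Formula.disj α (Formula.disj β γ))
      (fun α β γ => Formula.conj α (Formula.conj β γ)) (fun α => α) (fun α => α)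
      Formula.tt (Formula.ff : Formula A)) := inferInstance
  exact this.of_eq fun A _ e => by cases e <;> rfl

instance QPT.inst_conclusion {i : ∀ (A : Type u) [AtomSet A], X A → Inst A} [hi : QPT i] :
    QPT (fun A _ x => (i A x).conclusion) := by
  have h1 : QPT (fun (A : Type u) _ (p : Inst A × EqInst A) => p.2.lhs) :=
    QPT.lhs'.compose inferInstance
  have h2 : QPT (fun (A : Type u) _ (p : Inst A × EqInst A) => p.2.rhs) :=
    QPT.rhs'.compose inferInstance
  have : QPT (fun (A : Type u) _ (i : Inst A) => i.elim
      (fun a => Formula.disj (Formula.atom a) (Formula.atom (AtomSet.dual a)))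
      (fun a => Formula.atom a) (fun a => Formula.atom a) (fun _ => Formula.ff) (fun _ => Formula.tt)
      (fun a => Formula.conj (Formula.atom a) (Formula.atom a)) (fun α β γ => Formula.disj (Formula.conj α β) γ)
      (fun α β γ δ => Formula.conj (Formula.disj α γ) (Formula.disj β δ)) (fun e => e.rhs) (fun e => e.lhs)) :=
    inferInstance
  exact (this.of_eq (f' := fun A _ i => i.conclusion) fun A _ e => by cases e <;> rfl).compose hi

instance QPT.fill {ξ : ∀ (A : Type u) [AtomSet A], X A → Ctx A}
    {φ : ∀ (A : Type u) [AtomSet A], X A → Formula A} [hξ : QPT ξ] [hφ : QPT φ] :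
    QPT (fun A _ x => (ξ A x).fill (φ A x)) :=
  QPT.ctxRec (f := fun A _ ξ φ => ξ.fill φ) (fun A _ φ => φ)
    (fun A _ β _ z => .disj z β) (fun A _ β _ z => .disj β z)
    (fun A _ β _ z => .conj z β) (fun A _ β _ z => .conj β z)
    (fun _ _ _ => rfl) (fun _ _ _ _ _ => rfl) (fun _ _ _ _ _ => rfl) (fun _ _ _ _ _ => rfl)
    (fun _ _ _ _ _ => rfl) (q := fun n => 2 * n) ((isQP_const 2).mul isQP_id)
    (fun A _ ξ φ => by induction ξ <;> simp [Ctx.fill] <;> omega)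

instance QPT.map_disjL {l : ∀ (A : Type u) [AtomSet A], X A → List (Step A)}
    {φ : ∀ (A : Type u) [AtomSet A], X A → Formula A} [hl : QPT l] [hφ : QPT φ] :
    QPT (fun A _ x => (l A x).map (fun s => s.disjL (φ A x))) :=
  QPT.list_map (g := fun A _ (x : Step A) (y : Formula A) => Step.mk (.disjL x.ctx y) x.inst)

instance QPT.map_disjR {l : ∀ (A : Type u) [AtomSet A], X A → List (Step A)}
    {φ : ∀ (A : Type u) [AtomSet A], X A → Formula A} [hl : QPT l] [hφ : QPT φ] :
    QPT (fun A _ x => (l A x).map (fun s => s.disjR (φ A x))) :=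
  QPT.list_map (g := fun A _ (x : Step A) (y : Formula A) => Step.mk (.disjR y x.ctx) x.inst)

instance QPT.map_conjL {l : ∀ (A : Type u) [AtomSet A], X A → List (Step A)}
    {φ : ∀ (A : Type u) [AtomSet A], X A → Formula A} [hl : QPT l] [hφ : QPT φ] :
    QPT (fun A _ x => (l A x).map (fun s => s.conjL (φ A x))) :=
  QPT.list_map (g := fun A _ (x : Step A) (y : Formula A) => Step.mk (.conjL x.ctx y) x.inst)

instance QPT.map_conjR {l : ∀ (A : Type u) [AtomSet A], X A → List (Step A)}
    {φ : ∀ (A : Type u) [AtomSet A], X A → Formula A} [hl : QPT l] [hφ : QPT φ] :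
    QPT (fun A _ x => (l A x).map (fun s => s.conjR (φ A x))) :=
  QPT.list_map (g := fun A _ (x : Step A) (y : Formula A) => Step.mk (.conjR y x.ctx) x.inst)

/-- The derivation that a script describes and its conclusion. -/
noncomputable def Scr.run {A : Type u} [AtomSet A] (s : Scr A) (φ : Formula A) :
    List (Step A) × Formula A := (s.steps φ, s.act φ)

set_option synthInstance.maxSize 10000 in
set_option synthInstance.maxHeartbeats 400000 in
set_option maxHeartbeats 1000000 in
theorem QPT.run {s : ∀ (A : Type u) [AtomSet A], X A → Scr A}
    {φ : ∀ (A : Type u) [AtomSet A], X A → Formula A} [hs : QPT s] [hφ : QPT φ] :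
    QPT (fun A _ x => (s A x).run (φ A x)) := by
  obtain ⟨r, hr, -, hr'⟩ := hs.exists_size_le
  obtain ⟨t, ht, -, ht'⟩ := hφ.exists_size_le
  have key := QPT.rec_comp (X := fun A => Scr A × Formula A)
    (Z := fun A => List (Step A) × Formula A) (f := fun A _ p => p.1.run p.2)
    (fun A _ p => p.1.elim true (fun _ => true) (fun _ _ => false)
      (fun _ _ => p.2.elim true true (fun _ => true) (fun _ _ => false) (fun _ _ => true))
      (fun _ _ => p.2.elim true true (fun _ => true) (fun _ _ => true) (fun _ _ => false)))
    (fun A _ p => p.1.elim ([], p.2)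
      (fun i => ([Step.mk Ctx.hole (i.at p.2)], (i.at p.2).conclusion))
      (fun _ _ => ([], p.2)) (fun _ _ => ([], p.2)) (fun _ _ => ([], p.2)))
    (fun A _ p => p.1.elim p (fun _ => p) (fun s _ => (s, p.2))
      (fun s _ => p.2.elim p p (fun _ => p) (fun α _ => (s, α)) (fun α _ => (s, α)))
      (fun s _ => p.2.elim p p (fun _ => p) (fun α _ => (s, α)) (fun α _ => (s, α))))
    (fun A _ p => p.1.1.elim p.1 (fun _ => p.1) (fun _ t => (t, p.2.2))
      (fun _ t => p.1.2.elim p.1 p.1 (fun _ => p.1) (fun _ β => (t, β)) (fun _ β => (t, β)))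
      (fun _ t => p.1.2.elim p.1 p.1 (fun _ => p.1) (fun _ β => (t, β)) (fun _ β => (t, β))))
    (fun A _ p => p.1.1.elim p.2.1 (fun _ => p.2.1)
      (fun _ _ => (p.2.1.1 ++ p.2.2.1, p.2.2.2))
      (fun _ _ => p.1.2.elim p.2.1 p.2.1 (fun _ => p.2.1)
        (fun _ β => (p.2.1.1.map (fun x => x.disjL β) ++
          p.2.2.1.map (fun x => x.disjR p.2.1.2), Formula.disj p.2.1.2 p.2.2.2))
        (fun _ _ => p.2.1))
      (fun _ _ => p.1.2.elim p.2.1 p.2.1 (fun _ => p.2.1) (fun _ _ => p.2.1)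
        (fun _ β => (p.2.1.1.map (fun x => x.conjL β) ++
          p.2.2.1.map (fun x => x.conjR p.2.1.2), Formula.conj p.2.1.2 p.2.2.2))))
    (by
      rintro A _ ⟨s, φ⟩ h
      cases s <;> cases φ <;> first | rfl | simp [Scr.elim, Formula.elim] at h)
    (by
      rintro A _ ⟨s, φ⟩ h
      cases s <;> cases φ <;> first | rfl | simp [Scr.elim, Formula.elim] at h)
    -- The sum of the sizes of formula and script does not increase, even for the second part of a
    -- sequence: by `Scr.act_size_le` the formula grows by less than the size of the first part,
    -- which has been used up.
    (fun A _ p => esize A p.1) (fun A _ p => 200 * (p.2.size + esize A p.1) ^ 2)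
    (by
      rintro A _ ⟨s, φ⟩ h
      cases s <;> cases φ <;> simp [Scr.elim, Formula.elim] at h ⊢)
    (by
      rintro A _ ⟨s, φ⟩ h
      refine Nat.mul_le_mul_left _ (Nat.pow_le_pow_left ?_ 2)
      cases s <;> cases φ <;> simp [Scr.elim, Formula.elim, Formula.size] at h ⊢ <;> omega)
    (by
      rintro A _ ⟨s, φ⟩ h
      refine Nat.mul_le_mul_left _ (Nat.pow_le_pow_left ?_ 2)
      rcases s with _ | _ | ⟨s, t⟩ | ⟨s, t⟩ | ⟨s, t⟩
      case seq =>
        have := s.act_size_le φ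
        simp only [Scr.elim, Scr.run, esize_seq]
        omega
      all_goals
        cases φ <;> simp [Scr.elim, Formula.elim, Formula.size] at h ⊢ <;> omega)
    (by
      rintro A _ ⟨s, φ⟩
      have h1 := φ.esize_le
      have h2 := φ.one_le_size
      have h3 := one_le_esize (A := A) s
      simp only [esize_pair]
      nlinarith)
    (by
      rintro A _ ⟨s, φ⟩
      have h1 := (s.act φ).esize_le
      have h2 := s.act_size_le φ
      have h3 := s.esize_steps_le φ
      have h4 := φ.one_le_size
      have h5 := one_le_esize (A := A) s
      simp only [Scr.run, esize_pair]
      nlinarith)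
  refine QPT.of_rec_comp key (fun A _ x => (s A x, φ A x))
    (q := fun n => r n + 200 * (t n + r n) ^ 2)
    (hr.add ((isQP_const 200).mul ((ht.add hr).pow 2))) (fun A _ x => ?_) (fun A _ x => ?_)
  · have h1 := hr' A x
    have h2 := ht' A x
    have h3 := (φ A x).size_le_esize
    refine le_trans (Nat.mul_le_mul_left _ (Nat.pow_le_pow_left ?_ 2)) (Nat.le_add_left _ _)
    simp only
    omega
  · exact (hr' A x).trans (Nat.le_add_right _ _)

end

end DeepInference

namespace DeepInference

/-! Scripts for derived rules. -/

infixr:60 " ⟫ " => Scr.seq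

namespace Scr

variable {A : Type u}

/-- `α ∨ β → β ∨ α` -/
def dComm : Scr A := .rule (.eqLR (.disjComm .ff .ff))
/-- `α ∧ β → β ∧ α` -/
def cComm : Scr A := .rule (.eqLR (.conjComm .ff .ff))
/-- `(α ∨ β) ∨ γ → α ∨ (β ∨ γ)` -/
def dAssoc : Scr A := .rule (.eqLR (.disjAssoc .ff .ff .ff))
/-- `α ∨ (β ∨ γ) → (α ∨ β) ∨ γ` -/
def dAssoc' : Scr A := .rule (.eqRL (.disjAssoc .ff .ff .ff))
/-- `(α ∧ β) ∧ γ → α ∧ (β ∧ γ)` -/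
def cAssoc : Scr A := .rule (.eqLR (.conjAssoc .ff .ff .ff))
/-- `α ∧ (β ∧ γ) → (α ∧ β) ∧ γ` -/
def cAssoc' : Scr A := .rule (.eqRL (.conjAssoc .ff .ff .ff))
/-- `α ∨ f → α` -/
def dUnit : Scr A := .rule (.eqLR (.disjFf .ff))
/-- `α → α ∨ f` -/
def dUnit' : Scr A := .rule (.eqRL (.disjFf .ff))
/-- `α ∧ t → α` -/
def cUnit : Scr A := .rule (.eqLR (.conjTt .ff))
/-- `α → α ∧ t` -/
def cUnit' : Scr A := .rule (.eqRL (.conjTt .ff))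
/-- `t ∨ t → t` -/
def tt : Scr A := .rule (.eqLR .disjTtTt)
/-- `t → t ∨ t` -/
def tt' : Scr A := .rule (.eqRL .disjTtTt)
/-- `f → f ∧ f` -/
def ff' : Scr A := .rule (.eqRL .conjFfFf)
/-- switch -/
def sw : Scr A := .rule (.switch .ff .ff .ff)
/-- medial -/
def med : Scr A := .rule (.medial .ff .ff .ff .ff)
/-- `α → f ∨ α` -/
def dUnitL : Scr A := dUnit' ⟫ dComm
/-- `t ∧ α → α` -/
def cUnitL : Scr A := cComm ⟫ cUnit
/-- `(α ∨ β) ∨ (γ ∨ δ) → (α ∨ γ) ∨ (β ∨ δ)` -/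
def dSwap : Scr A :=
  dAssoc ⟫ .disj .nop (dAssoc' ⟫ .disj dComm .nop ⟫ dAssoc) ⟫ dAssoc'
/-- `(α ∧ β) ∧ (γ ∧ δ) → (α ∧ γ) ∧ (β ∧ δ)` -/
def cSwap : Scr A :=
  cAssoc ⟫ .conj .nop (cAssoc' ⟫ .conj cComm .nop ⟫ cAssoc) ⟫ cAssoc'
/-- `f → t` -/
def ffTt : Scr A := cUnit' ⟫ .conj .nop tt' ⟫ sw ⟫ .disj cUnit .nop ⟫ dComm ⟫ dUnit
/-- Contraction of an atom. -/
def ac (a : A) : Scr A := .rule (.acDown a)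
/-- Cocontraction of an atom. -/
def ac' (a : A) : Scr A := .rule (.acUp a)
/-- Coweakening of an atom. -/
def aw' (a : A) : Scr A := .rule (.awUp a)
/-- `a ∧ α → α` -/
def dropL (a : A) : Scr A := .conj (aw' a) .nop ⟫ cUnitL
/-- `a ∧ (α ∨ β) → (a ∧ α) ∨ (a ∧ β)` -/
def dist (a : A) : Scr A :=
  .conj (ac' a) .nop ⟫ cAssoc ⟫ .conj .nop (sw ⟫ dComm) ⟫ sw ⟫ dComm

variable [AtomSet A]

section act

variable (α β γ δ φ : Formula A) (a b : A) (s t : Scr A)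

@[simp] theorem act_nop : Scr.nop.act φ = φ := rfl
@[simp] theorem act_seq : (s ⟫ t).act φ = t.act (s.act φ) := rfl
@[simp] theorem act_disj :
    (Scr.disj s t).act (.disj α β) = .disj (s.act α) (t.act β) := rfl
@[simp] theorem act_conj :
    (Scr.conj s t).act (.conj α β) = .conj (s.act α) (t.act β) := rfl
@[simp] theorem act_dComm : dComm.act (.disj α β) = .disj β α := rfl
@[simp] theorem act_cComm : cComm.act (.conj α β) = .conj β α := rfl
@[simp] theorem act_dAssoc :
    dAssoc.act (.disj (.disj α β) γ) = .disj α (.disj β γ) := rfl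
@[simp] theorem act_dAssoc' :
    dAssoc'.act (.disj α (.disj β γ)) = .disj (.disj α β) γ := rfl
@[simp] theorem act_cAssoc :
    cAssoc.act (.conj (.conj α β) γ) = .conj α (.conj β γ) := rfl
@[simp] theorem act_cAssoc' :
    cAssoc'.act (.conj α (.conj β γ)) = .conj (.conj α β) γ := rfl
@[simp] theorem act_dUnit : dUnit.act (.disj α .ff) = α := rfl
@[simp] theorem act_dUnit' : dUnit'.act α = .disj α .ff := rfl
@[simp] theorem act_cUnit : cUnit.act (.conj α .tt) = α := rfl
@[simp] theorem act_cUnit' : cUnit'.act α = .conj α .tt := rfl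
@[simp] theorem act_tt : tt.act (.disj .tt .tt : Formula A) = .tt := rfl
@[simp] theorem act_tt' : tt'.act (.tt : Formula A) = .disj .tt .tt := rfl
@[simp] theorem act_ff' : ff'.act (.ff : Formula A) = .conj .ff .ff := rfl
@[simp] theorem act_sw : sw.act (.conj α (.disj β γ)) = .disj (.conj α β) γ := rfl
@[simp] theorem act_med : med.act (.disj (.conj α β) (.conj γ δ)) =
    .conj (.disj α γ) (.disj β δ) := rfl
@[simp] theorem act_dUnitL : dUnitL.act α = .disj .ff α := rfl
@[simp] theorem act_cUnitL : cUnitL.act (.conj .tt α) = α := rfl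
@[simp] theorem act_dSwap : dSwap.act (.disj (.disj α β) (.disj γ δ)) =
    .disj (.disj α γ) (.disj β δ) := rfl
@[simp] theorem act_cSwap : cSwap.act (.conj (.conj α β) (.conj γ δ)) =
    .conj (.conj α γ) (.conj β δ) := rfl
@[simp] theorem act_ffTt : ffTt.act (.ff : Formula A) = .tt := rfl
@[simp] theorem act_ai : (Scr.rule (.aiDown a)).act .tt =
    .disj (.atom a) (.atom (AtomSet.dual a)) := rfl
@[simp] theorem act_aw : (Scr.rule (.awDown a)).act .ff = .atom a := rfl
@[simp] theorem act_ac : (ac b).act (.disj (.atom a) (.atom a)) = .atom a := by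
  have : aeq a a = true := by simp [aeq]
  simp [ac, Scr.act, Inst.at, Inst.apply, Inst.elim, Formula.elim, this, Inst.conclusion]
@[simp] theorem act_ac' : (ac' b).act (.atom a) = .conj (.atom a) (.atom a) := rfl
@[simp] theorem act_aw' : (aw' b).act (.atom a) = .tt := rfl
@[simp] theorem act_dropL : (dropL a).act (.conj (.atom a) α) = α := rfl
@[simp] theorem act_dist : (dist a).act (.conj (.atom a) (.disj α β)) =
    .disj (.conj (.atom a) α) (.conj (.atom a) β) := rfl

end act

/-- Weakening: `f → φ`. -/
def weak : Formula A → Scr A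
  | .ff => .nop
  | .tt => ffTt
  | .atom a => .rule (.awDown a)
  | .disj α β => dUnit' ⟫ .disj (weak α) (weak β)
  | .conj α β => ff' ⟫ .conj (weak α) (weak β)

/-- Coweakening: `φ → t`. -/
def coweak : Formula A → Scr A
  | .ff => ffTt
  | .tt => .nop
  | .atom a => aw' a
  | .disj α β => .disj (coweak α) (coweak β) ⟫ tt
  | .conj α β => .conj (coweak α) (coweak β) ⟫ cUnit

/-- Contraction: `φ ∨ φ → φ`. -/
def contr : Formula A → Scr A
  | .ff => dUnit
  | .tt => tt
  | .atom a => ac a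
  | .disj α β => dSwap ⟫ .disj (contr α) (contr β)
  | .conj α β => med ⟫ .conj (contr α) (contr β)

/-- Cocontraction: `φ → φ ∧ φ`. -/
def cocontr : Formula A → Scr A
  | .ff => ff'
  | .tt => cUnit'
  | .atom a => ac' a
  | .disj α β => .disj (cocontr α) (cocontr β) ⟫ med
  | .conj α β => .conj (cocontr α) (cocontr β) ⟫ cSwap

@[simp] theorem act_weak (φ : Formula A) : (weak φ).act .ff = φ := by
  induction φ <;> simp_all [weak]

@[simp] theorem act_coweak (φ : Formula A) : (coweak φ).act φ = .tt := by
  induction φ <;> simp_all [coweak]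

@[simp] theorem act_contr (φ : Formula A) : (contr φ).act (.disj φ φ) = φ := by
  induction φ <;> simp_all [contr]

@[simp] theorem act_cocontr (φ : Formula A) : (cocontr φ).act φ = .conj φ φ := by
  induction φ <;> simp_all [cocontr]

end Scr

/-! ### Substitution of false for an atom, and refutation by a valuation. -/

variable {A : Type u}

@[simp] theorem aeq_self (a : A) : aeq a a = true := by simp [aeq]

theorem aeq_eq_true {a b : A} : aeq a b = true ↔ a = b := by simp [aeq]

theorem aeq_eq_false {a b : A} : aeq a b = false ↔ a ≠ b := by simp [aeq]

variable [AtomSet A]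

/-- Replacement of an atom by false. -/
noncomputable def Formula.sub : Formula A → A → Formula A
  | .ff, _ => .ff
  | .tt, _ => .tt
  | .atom b, a => bif aeq b a then .ff else .atom b
  | .disj α β, a => .disj (α.sub a) (β.sub a)
  | .conj α β, a => .conj (α.sub a) (β.sub a)

namespace Scr

/-- Extraction of an atom: `φ → φ[a := f] ∨ a`. -/
noncomputable def ext : Formula A → A → Scr A
  | .ff, a => dUnit' ⟫ .disj .nop (.rule (.awDown a))
  | .tt, a => dUnit' ⟫ .disj .nop (.rule (.awDown a))
  | .atom b, a => bif aeq b a then dUnitL else dUnit' ⟫ .disj .nop (.rule (.awDown a))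
  | .disj α β, a => .disj (ext α a) (ext β a) ⟫ dSwap ⟫ .disj .nop (ac a)
  | .conj α β, a => .conj (ext α a) (ext β a) ⟫ sw ⟫
      .disj (cComm ⟫ sw ⟫ .disj cComm .nop) .nop ⟫ dAssoc ⟫ .disj .nop (ac a)

/-- Weakening of the occurrences of an atom: `φ[a := f] → φ`. -/
noncomputable def unsub : Formula A → A → Scr A
  | .ff, _ => .nop
  | .tt, _ => .nop
  | .atom b, a => bif aeq b a then .rule (.awDown a) else .nop
  | .disj α β, a => .disj (unsub α a) (unsub β a)
  | .conj α β, a => .conj (unsub α a) (unsub β a)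

-- Formulae are monotone in their atoms, so an occurrence of a may be replaced by f at the price of
-- a disjunct a outside. At a connective the copies of a from both components are moved outwards, by
-- switch in the case of a conjunction, and contracted into one.
@[simp] theorem act_ext (φ : Formula A) (a : A) :
    (ext φ a).act φ = .disj (φ.sub a) (.atom a) := by
  induction φ with
  | atom b =>
    cases h : aeq b a
    · simp [ext, Formula.sub, h]
    · obtain rfl := aeq_eq_true.1 h
      simp [ext, Formula.sub]
  | _ => simp_all [ext, Formula.sub]

@[simp] theorem act_unsub (φ : Formula A) (a : A) : (unsub φ a).act (φ.sub a) = φ := by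
  induction φ with
  | atom b =>
    cases h : aeq b a
    · simp [unsub, Formula.sub, h]
    · obtain rfl := aeq_eq_true.1 h
      simp [unsub, Formula.sub]
  | _ => simp_all [unsub, Formula.sub]

end Scr

/-- The value of a formula when all atoms are true. -/
def Formula.val : Formula A → Bool
  | .ff => false
  | .tt => true
  | .atom _ => true
  | .disj α β => bif α.val then true else β.val
  | .conj α β => bif α.val then β.val else false

/-- A derivation `φ → f` for a formula that is false when all atoms are true. -/
def Scr.refute : Formula A → Scr A
  | .ff => .nop
  | .tt => .nop
  | .atom _ => .nop
  | .disj α β => .disj (refute α) (refute β) ⟫ dUnit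
  | .conj α β => bif α.val then .conj (coweak α) (refute β) ⟫ cUnitL
      else .conj (refute α) (coweak β) ⟫ cUnit

/-- In a false disjunction both components are refuted. In a false conjunction one component is
refuted and the other, whatever its value, is coweakened to t. Making a and ā both true is harmless
here: negation never enters, and a false formula needs no cut to reach f. -/
theorem Scr.act_refute (φ : Formula A) (h : φ.val = false) : (refute φ).act φ = .ff := by
  induction φ with
  | ff => rfl
  | tt => simp [Formula.val] at h
  | atom => simp [Formula.val] at h
  | disj α β ihα ihβ =>
    cases hα : α.val <;> simp [Formula.val, hα] at h
    simp [refute, ihα hα, ihβ h]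
  | conj α β ihα ihβ =>
    cases hα : α.val <;> simp [Formula.val, hα] at h
    · simp [refute, ihα hα, hα]
    · simp [refute, ihβ h, hα]

end DeepInference

namespace DeepInference

/-! Threshold formulae. They are computed along a formula `t`, of which only the tree structure
and the sequence of the leaves matters: the `k`-th threshold formula says that at least `k` of the
leaves are true. -/

namespace Threshold

variable {A : Type u}

/-- The disjunction of the conjunctions of the members of `U` with those of the other list. -/
def dot : List (Formula A) → List (Formula A) → Formula A
  | [], _ => .ff
  | w :: rev, U => .disj (.conj (U.headD .ff) w) (dot rev U.tail)

/-- The convolution of `U` with a list, of which `acc` (reversed) has been read. -/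
def conv : List (Formula A) → List (Formula A) → List (Formula A) → List (Formula A)
  | [], _, _ => []
  | w :: W, U, acc => dot (w :: acc) U :: conv W U (w :: acc)

/-- The threshold formulae for `0, 1, …`; those that exceed the number of leaves of a leaf are
given by `pad`. -/
def vec : Formula A → List (Formula A) → List (Formula A)
  | .ff, pad => .tt :: .ff :: pad
  | .tt, pad => .tt :: .tt :: pad
  | .atom a, pad => .tt :: .atom a :: pad
  | .disj l r, pad => conv (vec r pad) (vec l pad) []
  | .conj l r, pad => conv (vec r pad) (vec l pad) []

/-- A derivation of the threshold formula for `0`. -/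
def zero : Formula A → Scr A
  | .ff => .nop
  | .tt => .nop
  | .atom _ => .nop
  | .disj l r => .cUnit' ⟫ .conj (zero l) (zero r) ⟫ .dUnit'
  | .conj l r => .cUnit' ⟫ .conj (zero l) (zero r) ⟫ .dUnit'

section

variable [AtomSet A]

/-- Addition of the atom `a` to `dot rev U`, by means of the members of `U`. -/
noncomputable def addDotL (a : A) : List (Formula A) → List (Scr A) → Scr A
  | [], _ => .dropL a
  | w :: rev, S => .dist a ⟫ .disj (.cAssoc' ⟫ .conj (S.headD .nop) (.unsub w a))
      (addDotL a rev S.tail)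

/-- Addition of an atom to the members of a convolution, by means of the members of `U`. -/
noncomputable def addConvL (a : A) (S : List (Scr A)) (u₀ : Formula A) :
    List (Formula A) → List (Formula A) → List (Scr A)
  | [], _ => []
  | w :: W, acc => (addDotL a acc S ⟫ .dUnitL ⟫ .disj (.weak (.conj u₀ w)) .nop) ::
      addConvL a S u₀ W (w :: acc)

/-- Addition of the atom `a` to `dot rev U`, by means of the members of `rev`. -/
noncomputable def addDotR (a : A) (w₀ : Formula A) :
    List (Scr A) → List (Formula A) → Scr A
  | [], U => .dropL a ⟫ .dUnit' ⟫ .disj (.weak (.conj (U.headD .ff) w₀)) .nop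
  | s :: rev, U => .dist a ⟫
      .disj (.cAssoc' ⟫ .conj .cComm .nop ⟫ .cAssoc ⟫ .conj (.unsub (U.headD .ff) a) s)
        (addDotR a w₀ rev U.tail)

/-- Addition of an atom to the members of a convolution, by means of the members of the list
other than `U`. -/
noncomputable def addConvR (a : A) (U : List (Formula A)) (w₀ : Formula A) :
    List (Scr A) → List (Scr A) → List (Scr A)
  | [], _ => []
  | s :: S, acc => addDotR a w₀ (s :: acc) U :: addConvR a U w₀ S (s :: acc)

/-- For an atom `a` among the leaves of `t`, derivations from `a ∧ Tₖ[a := f]` to `Tₖ₊₁`, where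
`Tₖ` are the threshold formulae. -/
noncomputable def add (a : A) : Formula A → List (Formula A) → List (Scr A)
  | .ff, _ => []
  | .tt, _ => []
  | .atom b, pad => bif aeq b a then .cUnit :: pad.map (fun _ => .dropL a) else []
  | .disj l r, pad => listElim (add a l pad)
      (addConvR a (vec l pad) ((vec r pad).headD .ff) (add a r pad) [])
      (fun _ _ => addConvL a (add a l pad) ((vec l pad).headD .ff) (vec r pad).tail
        [(vec r pad).headD .ff])
  | .conj l r, pad => listElim (add a l pad)
      (addConvR a (vec l pad) ((vec r pad).headD .ff) (add a r pad) [])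
      (fun _ _ => addConvL a (add a l pad) ((vec l pad).headD .ff) (vec r pad).tail
        [(vec r pad).headD .ff])

end

/-! ### Correctness of the threshold formulae. -/

theorem length_conv (W U acc : List (Formula A)) : (conv W U acc).length = W.length := by
  induction W generalizing acc with
  | nil => rfl
  | cons w W ih => simp [conv, ih]

/-- A convolution is as long as its first argument, so all the lists along the tree have one and the
same length. The padding thus fixes in advance how many thresholds there are, and a long padding
provides one that exceeds the number of leaves. -/
theorem length_vec (t : Formula A) (pad : List (Formula A)) :
    (vec t pad).length = pad.length + 2 := by
  induction t <;> simp_all [vec, length_conv]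

theorem vec_eq_cons (t : Formula A) (pad : List (Formula A)) :
    ∃ w w' W, vec t pad = w :: w' :: W := by
  have h := length_vec t pad
  rcases hv : vec t pad with _ | ⟨w, _ | ⟨w', W⟩⟩ <;> rw [hv] at h
  · simp at h
  · simp at h
  · exact ⟨w, w', W, rfl⟩

theorem length_addConvL (a : A) (S : List (Scr A)) (u₀ : Formula A) (W acc : List (Formula A)) :
    (addConvL a S u₀ W acc).length = W.length := by
  induction W generalizing acc with
  | nil => rfl
  | cons w W ih => simp [addConvL, ih]

theorem length_addConvR (a : A) (U : List (Formula A)) (w₀ : Formula A) (S acc : List (Scr A)) :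
    (addConvR a U w₀ S acc).length = S.length := by
  induction S generalizing acc with
  | nil => rfl
  | cons w W ih => simp [addConvR, ih]

/-- The atom `a` is a leaf of a formula. -/
def IsLeaf (a : A) : Formula A → Prop
  | .ff => False
  | .tt => False
  | .atom b => b = a
  | .disj l r => IsLeaf a l ∨ IsLeaf a r
  | .conj l r => IsLeaf a l ∨ IsLeaf a r

/-- An empty result signals that a is not a leaf. The case distinction in `add` relies on this to
find the side on which a occurs. -/
theorem length_add_or (a : A) (t : Formula A) (pad : List (Formula A)) :
    (IsLeaf a t ∧ (add a t pad).length = pad.length + 1) ∨ (¬ IsLeaf a t ∧ add a t pad = []) := by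
  induction t with
  | ff | tt => exact .inr ⟨id, rfl⟩
  | atom b =>
    cases h : aeq b a
    · exact .inr ⟨aeq_eq_false.1 h, by simp [add, h]⟩
    · exact .inl ⟨aeq_eq_true.1 h, by simp [add, h]⟩
  | disj l r hl hr | conj l r hl hr =>
    rcases hl with ⟨hl, hl'⟩ | ⟨hl, hl'⟩
    · obtain ⟨s, S, hS⟩ := List.exists_cons_of_length_pos (l := add a l pad) (by omega)
      exact .inl ⟨.inl hl, by simp [add, hS, listElim, length_addConvL, length_vec]⟩
    · rcases hr with ⟨hr, hr'⟩ | ⟨hr, hr'⟩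
      · exact .inl ⟨.inr hr, by simp [add, hl', listElim, length_addConvR, hr']⟩
      · exact .inr ⟨by simp [IsLeaf, hl, hr], by simp [add, hl', listElim, hr', addConvR]⟩

/-- A true disjunct pairs the same position j of U and of `rev`. As `rev` is a reversed initial
segment, j stands there for the index rev.length - 1 - j, and this index is what `hrev` bounds by n.
-/
theorem le_of_val_dot {U rev : List (Formula A)} {m n : ℕ}
    (hU : ∀ i, (U.getD i .ff).val = true → i ≤ m)
    (hrev : ∀ i, (rev.getD i .ff).val = true → rev.length ≤ i + n + 1)
    (h : (dot rev U).val = true) : rev.length ≤ m + n + 1 := by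
  suffices ∃ j, (U.getD j .ff).val = true ∧ (rev.getD j .ff).val = true by
    obtain ⟨j, h1, h2⟩ := this
    have := hU j h1
    have := hrev j h2
    omega
  clear hU hrev
  induction rev generalizing U with
  | nil => simp [dot, Formula.val] at h
  | cons w rev ih =>
    have h' : ((U.headD .ff).val = true ∧ w.val = true) ∨ (dot rev U.tail).val = true := by
      simpa [dot, Formula.val] using h
    rcases h' with h' | h'
    · refine ⟨0, ?_, by simpa using h'.2⟩
      cases U <;> exact h'.1
    · obtain ⟨j, h1, h2⟩ := ih h'
      refine ⟨j + 1, ?_, by simpa using h2⟩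
      cases U
      · simp [Formula.val] at h1
      · simpa using h1

/-- Index bounds m and n for true members add up under convolution, since a true disjunct combines
one index from each list. -/
theorem le_of_val_conv {U W acc : List (Formula A)} {m n : ℕ}
    (hU : ∀ i, (U.getD i .ff).val = true → i ≤ m)
    (hW : ∀ i, (W.getD i .ff).val = true → acc.length + i ≤ n)
    (hacc : ∀ i, (acc.getD i .ff).val = true → acc.length ≤ i + n + 1) {i : ℕ}
    (h : ((conv W U acc).getD i .ff).val = true) : acc.length + i ≤ m + n := by
  induction W generalizing acc i with
  | nil => simp [conv, Formula.val] at h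
  | cons w W ih =>
    have hacc' : ∀ i, ((w :: acc).getD i .ff).val = true → (w :: acc).length ≤ i + n + 1 := by
      intro i hi
      cases i with
      | zero =>
        have := hW 0 (by simpa using hi)
        simpa using this
      | succ i =>
        have := hacc i (by simpa using hi)
        rw [List.length_cons]
        omega
    cases i with
    | zero =>
      have := le_of_val_dot hU hacc' (by simpa [conv] using h)
      rw [List.length_cons] at this
      omega
    | succ i =>
      have := ih (acc := w :: acc) (i := i) (fun i hi => by
        have := hW (i + 1) (by simpa using hi)
        rw [List.length_cons]
        omega) hacc' (by simpa [conv] using h)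
      rw [List.length_cons] at this
      omega

/-- A threshold formula that is true when all leaves are true. -/
theorem le_size_of_val_vec {t : Formula A} {pad : List (Formula A)} (hpad : ∀ φ ∈ pad, φ = .ff)
    {i : ℕ} (h : ((vec t pad).getD i .ff).val = true) : i ≤ t.size := by
  have hpad' : ∀ i, (pad.getD i .ff).val = false := fun i => by
    rw [List.getD_eq_getElem?_getD]
    cases hi : pad[i]? with
    | none => rfl
    | some φ => rw [hpad φ (List.mem_of_getElem? hi)]; rfl
  induction t generalizing i with
  | ff | tt | atom b =>
    rcases i with _ | _ | i
    · exact Nat.zero_le _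
    · exact le_rfl
    · have := hpad' i
      simp [vec] at h this
      simp [h] at this
  | disj l r hl hr | conj l r hl hr =>
    have := le_of_val_conv (acc := []) (fun i hi => hl hi) (fun i hi => by simpa using hr hi)
      (fun i hi => by simp [Formula.val] at hi) h
    simpa [Formula.size] using this

variable [AtomSet A]

/-- The scripts of the first list lead from `a ∧ α[a := f]` to `β`, for the members `α`, `β` of
the other lists. -/
def Adds (a : A) : List (Scr A) → List (Formula A) → List (Formula A) → Prop
  | [], _, [] => True
  | s :: S, α :: V, β :: W => s.act (.conj (.atom a) (α.sub a)) = β ∧ Adds a S V W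
  | _, _, _ => False

theorem act_zero (t : Formula A) (pad : List (Formula A)) :
    (zero t).act .tt = (vec t pad).headD .ff := by
  induction t with
  | ff | tt | atom => rfl
  | disj l r hl hr | conj l r hl hr =>
    obtain ⟨u, u', U, hU⟩ := vec_eq_cons l pad
    obtain ⟨w, w', W, hW⟩ := vec_eq_cons r pad
    rw [hU] at hl
    rw [hW] at hr
    simp [zero, vec, hU, hW, conv, dot, hl, hr]

/-- After a has been distributed over the disjunction, each disjunct turns a ∧ Uᵢ[a := f] into Uᵢ₊₁,
and the occurrences of a in its other factor are restored by weakening. -/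
theorem act_addDotL {a : A} {S : List (Scr A)} {U V : List (Formula A)} (h : Adds a S U V)
    {rev : List (Formula A)} (hr : rev.length ≤ V.length) :
    (addDotL a rev S).act (.conj (.atom a) ((dot rev U).sub a)) = dot rev V := by
  induction rev generalizing S U V with
  | nil => rfl
  | cons w rev ih =>
    rcases S with _ | ⟨s, S⟩ <;> rcases U with _ | ⟨u, U⟩ <;> rcases V with _ | ⟨v, V⟩ <;>
      simp [Adds] at h hr
    simp [addDotL, dot, Formula.sub, h.1, ih h.2 hr]

/-- Raising the index of U by one in the disjuncts Uᵢ ∧ Wₖ₋ᵢ of threshold k gives all the disjuncts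
of threshold k + 1 except the one with U₀, which is supplied by weakening. -/
theorem adds_addConvL {a : A} {S : List (Scr A)} {u₀ : Formula A} {V : List (Formula A)}
    (h : Adds a S (u₀ :: V) V) {W acc : List (Formula A)} (hl : acc.length + W.length ≤ V.length + 1) :
    Adds a (addConvL a S u₀ W acc) (dot acc (u₀ :: V) :: conv W (u₀ :: V) acc)
      (conv W (u₀ :: V) acc) := by
  induction W generalizing acc with
  | nil => trivial
  | cons w W ih =>
    rw [List.length_cons] at hl
    refine ⟨?_, ih (by simp; omega)⟩
    simp [act_addDotL h (show acc.length ≤ V.length by omega), dot]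

/-- The mirror image of `act_addDotL`, with the index of the other factor raised. The missing
disjunct is now the one with index 0 on that side. It stands last, since `rev` is reversed. -/
theorem act_addDotR {a : A} (w₀ : Formula A) {S : List (Scr A)} {rev rev' : List (Formula A)}
    (h : Adds a S rev rev') (hl : S.length = rev.length) (U : List (Formula A)) :
    (addDotR a w₀ S U).act (.conj (.atom a) ((dot rev U).sub a)) = dot (rev' ++ [w₀]) U := by
  induction S generalizing rev rev' U with
  | nil =>
    rcases rev with _ | _ <;> rcases rev' with _ | _ <;> simp [Adds] at h hl
    simp [addDotR, dot, Formula.sub]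
  | cons s S ih =>
    rcases rev with _ | _ <;> rcases rev' with _ | _ <;> simp [Adds] at h hl
    simp [addDotR, dot, Formula.sub, h.1, ih h.2 hl]

theorem adds_addConvR {a : A} (U : List (Formula A)) (w₀ : Formula A) {S acc : List (Scr A)}
    {W W' rev rev' : List (Formula A)} (h : Adds a S W W') (h' : Adds a acc rev rev')
    (hl : acc.length = rev.length) :
    Adds a (addConvR a U w₀ S acc) (conv W U rev) (conv W' U (rev' ++ [w₀])) := by
  induction S generalizing acc W W' rev rev' with
  | nil =>
    rcases W' with _ | _ <;> simp [Adds] at h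
    trivial
  | cons s S ih =>
    rcases W with _ | ⟨w, W⟩ <;> rcases W' with _ | ⟨w', W'⟩ <;> simp [Adds] at h
    have h'' : Adds a (s :: acc) (w :: rev) (w' :: rev') := ⟨h.1, h'⟩
    exact ⟨act_addDotR w₀ h'' (by simpa using hl) U, ih h.2 h'' (by simpa using hl)⟩

/-- A single occurrence of a is enough. At a leaf a ∧ t gives a, and from there on a ∧ f gives f,
for which the padding has to consist of f. At a node only one side that contains a is raised; the
occurrences of a on the other side come back from f by weakening. -/
theorem adds_add {a : A} {t : Formula A} {pad : List (Formula A)} (hpad : ∀ φ ∈ pad, φ = .ff)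
    (h : IsLeaf a t) : Adds a (add a t pad) (vec t pad) (vec t pad).tail := by
  induction t with
  | ff | tt => exact h.elim
  | atom b =>
    obtain rfl : b = a := h
    simp only [add, aeq_self, cond_true, vec, List.tail_cons]
    refine ⟨rfl, ?_⟩
    -- The first of these scripts starts from the leaf, which only the substitution turns into f;
    -- the later ones start from the padding.
    suffices ∀ φ : Formula A, φ.sub b = .ff →
        Adds b (pad.map (fun _ => .dropL b)) (φ :: pad) pad by
      exact this _ (by simp [Formula.sub])
    induction pad with
    | nil => intros; trivial
    | cons ψ pad ih =>
      intro φ hφ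
      obtain rfl := hpad ψ (by simp)
      exact ⟨by simp [hφ], ih (fun φ hφ => hpad φ (by simp [hφ])) _ rfl⟩
  | disj l r hl hr | conj l r hl hr =>
    obtain ⟨u, u', U, hU⟩ := vec_eq_cons l pad
    obtain ⟨w, w', W, hW⟩ := vec_eq_cons r pad
    have lU := length_vec l pad
    have lW := length_vec r pad
    cases hS : add a l pad with
    | nil =>
      have hl' : ¬ IsLeaf a l := by
        rcases length_add_or a l pad with h' | h'
        · simp [hS] at h'
        · exact h'.1
      have := adds_addConvR (vec l pad) w (hr (h.resolve_left hl')) (show Adds a [] [] [] from trivial)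
        rfl
      simpa [add, hS, listElim, vec, hW, conv] using this
    | cons s S =>
      have hl' : IsLeaf a l := by
        rcases length_add_or a l pad with h' | h'
        · exact h'.1
        · simp [hS] at h'
      have key := hl hl'
      rw [hU] at key lU
      rw [hW] at lW
      have := adds_addConvL (W := w' :: W) (acc := [w]) key (by simp at *; omega)
      simpa [add, hS, listElim, vec, hW, hU, conv] using this

end Threshold

end DeepInference

/-! ### The tree of the cut atoms and the polarity of atoms. -/

namespace DeepInference

open Threshold

variable {A : Type u}

/-- Insertion of a leaf into a balanced tree. -/
def Formula.insertLeaf (a : A) : Formula A → Formula A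
  | .ff => .disj (.atom a) .ff
  | .tt => .disj (.atom a) .tt
  | .atom b => .disj (.atom a) (.atom b)
  | .disj l r => .disj (insertLeaf a r) l
  | .conj l r => .disj (.atom a) (.conj l r)

/-- A balanced tree with the cut atoms of a derivation as leaves. -/
def cutTree : List (Step A) → Formula A
  | [] => .ff
  | s :: l => s.inst.elim (fun _ => cutTree l) (fun _ => cutTree l) (fun _ => cutTree l)
      (fun a => (cutTree l).insertLeaf a) (fun _ => cutTree l) (fun _ => cutTree l)
      (fun _ _ _ => cutTree l) (fun _ _ _ _ => cutTree l) (fun _ => cutTree l)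
      (fun _ => cutTree l)

theorem Formula.size_insertLeaf (a : A) (t : Formula A) :
    (t.insertLeaf a).size = t.size + 1 := by
  induction t <;> simp_all [insertLeaf, size] <;> omega

theorem Formula.isLeaf_insertLeaf (a b : A) (t : Formula A) :
    IsLeaf b (t.insertLeaf a) ↔ a = b ∨ IsLeaf b t := by
  induction t <;> simp_all [insertLeaf, IsLeaf]
  tauto

theorem size_cutTree_le (l : List (Step A)) : (cutTree l).size ≤ l.length + 1 := by
  induction l with
  | nil => exact le_rfl
  | cons s l ih =>
    rw [cutTree]
    cases s.inst <;> simp only [Inst.elim, Formula.size_insertLeaf, List.length_cons] <;> omega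

theorem isLeaf_cutTree {l : List (Step A)} {s : Step A} (hs : s ∈ l) {a : A}
    (h : s.inst = .aiUp a) : IsLeaf a (cutTree l) := by
  induction l with
  | nil => simp at hs
  | cons s' l ih =>
    rcases List.mem_cons.1 hs with rfl | hs
    · simp [cutTree, h, Inst.elim, Formula.isLeaf_insertLeaf]
    · rw [cutTree]
      cases s'.inst <;> simp only [Inst.elim, Formula.isLeaf_insertLeaf, ih hs, or_true]

/-- The padding for the lists of threshold formulae. -/
def padding (l : List (Step A)) : List (Formula A) := .ff :: l.map (fun _ => .ff)

/-- The threshold formulae for the cut atoms of a derivation. -/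
def thresholds (l : List (Step A)) : List (Formula A) := vec (cutTree l) (padding l)

/-- The derivations between the threshold formulae for the cut atoms of a derivation. -/
noncomputable def additions (l : List (Step A)) (a : A) : List (Scr A) :=
  add a (cutTree l) (padding l)

/-- The member of a list whose position is the length of another list. -/
def nth {X : Type v} {Y : Type w} : List X → List Y → Y → Y
  | [], l, d => l.headD d
  | _ :: k, l, d => nth k l.tail d

/-- Programs have no numbers, so a position is represented by a list of that length; for proofs it
is converted back into a number. -/
theorem nth_eq {X : Type v} {Y : Type w} (k : List X) (l : List Y) (d : Y) :
    nth k l d = l.getD k.length d := by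
  induction k generalizing l with
  | nil => cases l <;> rfl
  | cons x k ih => cases l <;> simp [nth, ih]

/-- The suffixes of a list, from short to long. -/
def suffixes {X : Type v} : List X → List (List X)
  | [] => [[]]
  | x :: l => suffixes l ++ [x :: l]

variable [AtomSet A]

/-- The first leaf of `t` that is `a` or its dual, if there is one. -/
noncomputable def Formula.firstOf (a : A) : Formula A → Formula A
  | .ff => .ff
  | .tt => .ff
  | .atom b => bif aeq b a then .atom b else bif aeq b (AtomSet.dual a) then .atom b else .ff
  | .disj l r => (firstOf a l).elim (firstOf a r) .ff (fun b => .atom b) (fun _ _ => .ff)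
      (fun _ _ => .ff)
  | .conj l r => (firstOf a l).elim (firstOf a r) .ff (fun b => .atom b) (fun _ _ => .ff)
      (fun _ _ => .ff)

/-- An atom is negative if its dual is a leaf of `t` and does not come after the atom. -/
noncomputable def Formula.isNeg (t : Formula A) (a : A) : Bool :=
  (t.firstOf a).elim false false (fun b => aeq b (AtomSet.dual a)) (fun _ _ => false)
    (fun _ _ => false)

theorem Formula.firstOf_eq (t : Formula A) (a : A) :
    (t.firstOf a = .ff ∧ ¬ IsLeaf a t) ∨
      (∃ b, t.firstOf a = .atom b ∧ IsLeaf b t ∧ (b = a ∨ b = AtomSet.dual a)) := by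
  induction t with
  | ff | tt => exact .inl ⟨rfl, id⟩
  | atom b =>
    cases h : aeq b a
    · cases h' : aeq b (AtomSet.dual a)
      · exact .inl ⟨by simp [firstOf, h, h'], aeq_eq_false.1 h⟩
      · exact .inr ⟨b, by simp [firstOf, h, h'], rfl, .inr (aeq_eq_true.1 h')⟩
    · exact .inr ⟨b, by simp [firstOf, h], rfl, .inl (aeq_eq_true.1 h)⟩
  | disj l r hl hr | conj l r hl hr =>
    rcases hl with ⟨hl, hl'⟩ | ⟨b, hl, hl', h⟩
    · rcases hr with ⟨hr, hr'⟩ | ⟨b, hr, hr', h⟩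
      · exact .inl ⟨by simp [firstOf, hl, hr, Formula.elim], by simp [IsLeaf, hl', hr']⟩
      · exact .inr ⟨b, by simp [firstOf, hl, hr, Formula.elim], .inr hr', h⟩
    · exact .inr ⟨b, by simp [firstOf, hl, Formula.elim], .inl hl', h⟩

/-- The search depends only on the pair of an atom and its dual. This makes the polarity consistent
even if both of them are cut atoms. -/
theorem Formula.firstOf_dual (t : Formula A) (a : A) :
    t.firstOf (AtomSet.dual a) = t.firstOf a := by
  induction t with
  | atom b =>
    cases h : aeq b a <;> cases h' : aeq b (AtomSet.dual a) <;>
      simp [firstOf, h, h', AtomSet.dual_dual]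
  | _ => simp_all [firstOf]

theorem Formula.isNeg_iff {t : Formula A} {a : A} :
    t.isNeg a = true ↔ t.firstOf a = .atom (AtomSet.dual a) := by
  unfold isNeg
  cases t.firstOf a <;> simp [Formula.elim, aeq_eq_true]

theorem Formula.isLeaf_of_isNeg {t : Formula A} {a : A} (h : t.isNeg a = true) :
    IsLeaf (AtomSet.dual a) t := by
  rw [isNeg_iff] at h
  rcases t.firstOf_eq a with ⟨h', -⟩ | ⟨b, h', hb, -⟩ <;> rw [h] at h'
  · simp at h'
  · simpa [Formula.atom.inj h'] using hb

theorem Formula.isNeg_dual_of_isNeg {t : Formula A} {a : A} (h : t.isNeg a = true) :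
    t.isNeg (AtomSet.dual a) = false := by
  rw [isNeg_iff] at h
  by_contra h'
  rw [Bool.not_eq_false, isNeg_iff, firstOf_dual, h, AtomSet.dual_dual] at h'
  exact AtomSet.dual_ne a (Formula.atom.inj h')

/-- Whichever of a and ā is found first becomes the positive one, so in every cut exactly one atom
is strengthened. Pairs that do not occur in the tree have no negative atom and are left alone. -/
theorem Formula.isNeg_dual_of_isLeaf {t : Formula A} {a : A} (h : IsLeaf a t)
    (h' : t.isNeg a = false) : t.isNeg (AtomSet.dual a) = true := by
  rw [isNeg_iff, firstOf_dual, AtomSet.dual_dual]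
  rcases t.firstOf_eq a with ⟨-, h''⟩ | ⟨b, h'', -, rfl | rfl⟩
  · exact (h'' h).elim
  · exact h''
  · rw [← isNeg_iff, h'] at h''
    simp at h''

/-! ### Strengthening of a proof by a threshold formula. -/

section

variable (T T' t : Formula A)

/-- A negative atom is strengthened by the threshold formula `T`. -/
noncomputable def Formula.strengthenAtom (a : A) : Formula A :=
  bif t.isNeg a then .conj (.atom a) (T.sub (AtomSet.dual a)) else .atom a

/-- Strengthening of all the negative atoms of a formula. -/
noncomputable def Formula.strengthen : Formula A → Formula A → Formula A → Formula A
  | .ff, _, _ => .ff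
  | .tt, _, _ => .tt
  | .atom a, T, t => T.strengthenAtom t a
  | .disj α β, T, t => .disj (α.strengthen T t) (β.strengthen T t)
  | .conj α β, T, t => .conj (α.strengthen T t) (β.strengthen T t)

namespace Scr

/-- Removal of the strengthenings. -/
noncomputable def weaken : Formula A → Scr A
  | .ff => .nop
  | .tt => .nop
  | .atom a => bif t.isNeg a then .conj .nop (coweak (T.sub (AtomSet.dual a))) ⟫ cUnit else .nop
  | .disj α β => .disj (weaken α) (weaken β)
  | .conj α β => .conj (weaken α) (weaken β)

@[simp] theorem act_weaken (φ : Formula A) : (weaken T t φ).act (φ.strengthen T t) = φ := by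
  induction φ with
  | atom a =>
    cases h : t.isNeg a <;> simp [weaken, Formula.strengthen, Formula.strengthenAtom, h]
  | _ => simp_all [weaken, Formula.strengthen]

/-- From `T` to `(ā ∧ T[a := f]) ∨ a`. -/
noncomputable def identity (a : A) : Scr A :=
  cUnit' ⟫ .conj (ext T a) (.rule (.aiDown a) ⟫ dComm) ⟫ sw ⟫ .disj (cComm ⟫ sw) .nop ⟫
    dAssoc ⟫ .disj .nop (ac a)

-- Extraction of a from T is set beside a fresh identity, which gives (T[a := f] ∨ a) ∧ (ā ∨ a). Two
-- switches join ā with T[a := f] and leave two copies of a, which are contracted.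
@[simp] theorem act_identity (a : A) : (identity T a).act T =
    .disj (.conj (.atom (AtomSet.dual a)) (T.sub a)) (.atom a) := by
  simp [identity]

/-- A derivation from `T ∧ α` to `β ∨ T'` that is given by one from `α` to `β`. -/
def ignoring (s : Scr A) : Scr A :=
  .conj (coweak T) .nop ⟫ cUnitL ⟫ s ⟫ dUnit' ⟫ .disj .nop (weak T')

@[simp] theorem act_ignoring (s : Scr A) (α : Formula A) :
    (ignoring T T' s).act (.conj T α) = .disj (s.act α) T' := by
  simp [ignoring]

/-- A strengthened rule instance, with the premiss in conjunction with `T` and the conclusion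
in disjunction with `T'`. -/
noncomputable def inst (S : A → Scr A) (i : Inst A) : Scr A :=
  i.elim
    (fun a => bif t.isNeg a then cUnit ⟫ identity T (AtomSet.dual a) ⟫ dUnit' ⟫ .disj .nop (weak T')
      else bif t.isNeg (AtomSet.dual a) then
        cUnit ⟫ identity T a ⟫ dComm ⟫ dUnit' ⟫ .disj .nop (weak T')
      else ignoring T T' (.rule (.aiDown a)))
    (fun a => ignoring T T' (weak (T.strengthenAtom t a)))
    (fun a => ignoring T T' (contr (T.strengthenAtom t a)))
    (fun a => .conj (coweak T) .nop ⟫ cUnitL ⟫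
      bif t.isNeg a then cComm ⟫ .conj .nop (dropL a) ⟫ S (AtomSet.dual a) ⟫ dUnitL
      else .conj .nop (dropL (AtomSet.dual a)) ⟫ S a ⟫ dUnitL)
    (fun a => ignoring T T' (coweak (T.strengthenAtom t a)))
    (fun a => ignoring T T' (cocontr (T.strengthenAtom t a)))
    (fun _ _ _ => ignoring T T' (.rule i))
    (fun _ _ _ _ => ignoring T T' (.rule i))
    (fun _ => ignoring T T' (.rule i))
    (fun _ => ignoring T T' (.rule i))

/-- Only identity and cut touch the thresholds: an identity on a pair with a negative atom uses up
T, and every cut produces T'. Switch, medial and the equations are schematic and so remain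
instances; the other structural rules become derived rules for the strengthened atom. That cut atoms
are leaves ensures that one of the two atoms of a cut carries a threshold. -/
theorem act_inst {S : A → Scr A}
    (hS : ∀ a, IsLeaf a t → (S a).act (.conj (.atom a) (T.sub a)) = T') (i : Inst A)
    (hi : ∀ a, i = .aiUp a → IsLeaf a t) :
    (inst T T' t S i).act (.conj T (i.premiss.strengthen T t)) =
      .disj (i.conclusion.strengthen T t) T' := by
  cases i with
  | aiDown a =>
    cases h : t.isNeg a
    · cases h' : t.isNeg (AtomSet.dual a) <;>
        simp [inst, Inst.elim, Inst.premiss, Inst.conclusion, Formula.strengthen,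
          Formula.strengthenAtom, h, h', AtomSet.dual_dual]
    · simp [inst, Inst.elim, Inst.premiss, Inst.conclusion, Formula.strengthen,
          Formula.strengthenAtom, h, Formula.isNeg_dual_of_isNeg h, AtomSet.dual_dual]
  | aiUp a =>
    cases h : t.isNeg a
    · simp [inst, Inst.elim, Inst.premiss, Inst.conclusion, Formula.strengthen,
        Formula.strengthenAtom, h, Formula.isNeg_dual_of_isLeaf (hi a rfl) h, AtomSet.dual_dual,
        hS a (hi a rfl)]
    -- Here a itself is negative. After the exchange of the two sides, ā is the leaf that is added
    -- to the threshold.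
    · simp [inst, Inst.elim, Inst.premiss, Inst.conclusion, Formula.strengthen,
        Formula.strengthenAtom, h, Formula.isNeg_dual_of_isNeg h, AtomSet.dual_dual,
        hS _ (Formula.isLeaf_of_isNeg h)]
  | eqLR e =>
    rw [inst, Inst.elim, act_ignoring]
    cases e <;> rfl
  | eqRL e =>
    rw [inst, Inst.elim, act_ignoring]
    cases e <;> rfl
  | switch | medial =>
    rw [inst, Inst.elim, act_ignoring]
    rfl
  | _ => simp [inst, Inst.elim, Inst.premiss, Inst.conclusion, Formula.strengthen]

end Scr

end

/-! ### The slices. -/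

namespace Scr

/-- A script from `T ∧ α` to `β ∨ T'`, inside of a context. -/
def within : Ctx A → Scr A → Scr A
  | .hole, s => s
  | .disjL ξ _, s => sw ⟫ .disj (within ξ s) .nop ⟫ dAssoc ⟫ .disj .nop dComm ⟫ dAssoc'
  | .disjR _ ξ, s => .conj .nop dComm ⟫ sw ⟫ .disj (within ξ s) .nop ⟫ dComm ⟫ dAssoc'
  | .conjL ξ _, s => cAssoc' ⟫ .conj (within ξ s) .nop ⟫ cComm ⟫ sw ⟫ .disj cComm .nop
  | .conjR _ ξ, s => .conj .nop cComm ⟫ cAssoc' ⟫ .conj (within ξ s) .nop ⟫ cComm ⟫ sw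

/-- On the way in, T passes a disjunction by switch and a conjunction by associativity. On the way
out, T' passes a disjunction by associativity and a conjunction by switch. The script depends on the
path to the hole only, so the formulae beside it may be strengthened as well. -/
theorem act_within {T T' t α β : Formula A} {s : Scr A}
    (hs : s.act (.conj T (α.strengthen T t)) = .disj (β.strengthen T t) T') (ξ : Ctx A) :
    (within ξ s).act (.conj T ((ξ.fill α).strengthen T t)) =
      .disj ((ξ.fill β).strengthen T t) T' := by
  induction ξ <;> simp_all [within, Ctx.fill, Formula.strengthen]

/-- A script that is applied with `T` being kept and `T'` being collected. -/
def collect (T T' : Formula A) (s : Scr A) : Scr A :=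
  .disj (.conj (cocontr T) .nop ⟫ cAssoc ⟫ .conj .nop s ⟫ sw) .nop ⟫ dAssoc ⟫
    .disj .nop (contr T')

/-- This keeps the invariant (T ∧ α) ∨ T' of a slice. The step receives its own copy of T by
cocontraction, and the T' that it returns is contracted with the previous one. -/
theorem act_collect {T T' α β : Formula A} {s : Scr A} (hs : s.act (.conj T α) = .disj β T') :
    (collect T T' s).act (.disj (.conj T α) T') = .disj (.conj T β) T' := by
  simp [collect, hs]

/-- The composition of a list of scripts. -/
def seqs : List (Scr A) → Scr A
  | [] => .nop
  | s :: l => s ⟫ seqs l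

/-- The strengthened steps of a derivation. -/
noncomputable def derivation (T T' t : Formula A) (S : A → Scr A) (l : List (Step A)) : Scr A :=
  seqs (l.map fun s => collect T T' (within s.ctx (inst T T' t S s.inst)))

theorem act_derivation {T T' t : Formula A} {S : A → Scr A}
    (hS : ∀ a, IsLeaf a t → (S a).act (.conj (.atom a) (T.sub a)) = T') {l : List (Step A)}
    (hl : ∀ s ∈ l, ∀ a, s.inst = .aiUp a → IsLeaf a t) {α β : Formula A} (h : IsChain α l β) :
    (derivation T T' t S l).act (.disj (.conj T (α.strengthen T t)) T') =
      .disj (.conj T (β.strengthen T t)) T' := by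
  induction l generalizing α with
  | nil =>
    obtain rfl : α = β := h
    rfl
  | cons s l ih =>
    obtain ⟨rfl, h⟩ := h
    have := ih (fun s hs => hl s (by simp [hs])) h
    rw [derivation, List.map_cons, seqs, act_seq, Step.premiss, act_collect (act_within
      (act_inst T T' t hS s.inst (hl s (by simp))) s.ctx)]
    exact this

/-- The derivation from `α ∨ T` to `α ∨ T'` that is given by a proof of `α`. -/
noncomputable def slice (T T' t : Formula A) (S : A → Scr A) (l : List (Step A)) (α : Formula A) :
    Scr A :=
  .disj .nop (cUnit' ⟫ dUnit' ⟫ .disj .nop (weak T') ⟫ derivation T T' t S l ⟫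
    .disj (.conj (coweak T) .nop ⟫ cUnitL ⟫ weaken T t α) .nop) ⟫ dAssoc' ⟫ .disj (contr α) .nop

/-- The disjunct T becomes (T ∧ t) ∨ T' by weakening, and the strengthened steps turn t into the
strengthened α. Dropping T and the strengthenings leaves α, which is contracted with the α that is
present already. -/
theorem act_slice {T T' t : Formula A} {S : A → Scr A}
    (hS : ∀ a, IsLeaf a t → (S a).act (.conj (.atom a) (T.sub a)) = T') {l : List (Step A)}
    (hl : ∀ s ∈ l, ∀ a, s.inst = .aiUp a → IsLeaf a t) {α : Formula A} (h : IsChain .tt l α) :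
    (slice T T' t S l α).act (.disj α T) = .disj α T' := by
  have := act_derivation hS hl h
  rw [Formula.strengthen] at this
  simp [slice, this]

end Scr

theorem Threshold.act_getD {a : A} {S : List (Scr A)} {V W : List (Formula A)} (h : Adds a S V W)
    {k : ℕ} (hk : k < S.length) :
    (S.getD k .nop).act (.conj (.atom a) ((V.getD k .ff).sub a)) = W.getD k .ff := by
  induction k generalizing S V W with
  | zero =>
    rcases S with _ | _ <;> rcases V with _ | _ <;> rcases W with _ | _ <;> simp [Adds] at h hk
    simpa using h.1
  | succ k ih =>
    rcases S with _ | _ <;> rcases V with _ | _ <;> rcases W with _ | _ <;> simp [Adds] at h hk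
    simpa using ih h.2 hk

/-! ### Composition of the slices. -/

namespace Scr

/-- The slices for the threshold formulae, composed. -/
noncomputable def cutFree (l : List (Step A)) (α : Formula A) : Scr A :=
  dUnit' ⟫ dComm ⟫ .disj (weak α) (zero (cutTree l)) ⟫
    seqs ((suffixes (padding l)).map fun k => slice (nth k (thresholds l) .ff)
      (nth k (thresholds l).tail .ff) (cutTree l) (fun a => nth k (additions l a) .nop) l α) ⟫
    .disj .nop (refute (nth (padding l) (thresholds l).tail .ff)) ⟫ dUnit

theorem act_seqs_append (m m' : List (Scr A)) (φ : Formula A) :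
    (seqs (m ++ m')).act φ = (seqs m').act ((seqs m).act φ) := by
  induction m generalizing φ with
  | nil => rfl
  | cons s m ih => exact ih _

/-- From t, weakening introduces α beside the provable threshold 0. The slices raise the threshold
until it is refutable, and then only α remains. -/
theorem act_cutFree {l : List (Step A)} {α : Formula A} (h : IsChain .tt l α) :
    (cutFree l α).act .tt = α := by
  have hpad : ∀ φ ∈ padding l, φ = .ff := by
    intro φ hφ
    simp only [padding, List.mem_cons, List.mem_map] at hφ
    rcases hφ with h | ⟨_, _, h⟩
    · exact h
    · exact h.symm
  have tail_getD : ∀ (V : List (Formula A)) k, V.tail.getD k .ff = V.getD (k + 1) .ff := by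
    intro V k
    cases V <;> simp
  -- The suffix of length j names the slice from threshold j to j + 1, so all suffixes of `pad`, the
  -- empty one included, lead from 0 to pad.length + 1.
  have key : ∀ pad : List (Formula A), pad.length ≤ (padding l).length →
      (seqs ((suffixes pad).map fun k => slice (nth k (thresholds l) .ff)
        (nth k (thresholds l).tail .ff) (cutTree l)
        (fun a => nth k (additions l a) .nop) l α)).act
        (.disj α ((thresholds l).getD 0 .ff)) =
      .disj α ((thresholds l).getD (pad.length + 1) .ff) := by
    have one : ∀ k : List (Formula A), k.length ≤ (padding l).length →
        (slice (nth k (thresholds l) .ff) (nth k (thresholds l).tail .ff) (cutTree l)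
          (fun a => nth k (additions l a) .nop) l α).act
          (.disj α ((thresholds l).getD k.length .ff)) =
        .disj α ((thresholds l).getD (k.length + 1) .ff) := by
      intro k hk
      rw [nth_eq, nth_eq, tail_getD]
      refine act_slice (fun a ha => ?_) (fun s hs a => isLeaf_cutTree hs) h
      rw [nth_eq, ← tail_getD]
      refine act_getD (adds_add hpad ha) ?_
      rcases length_add_or a (cutTree l) (padding l) with h' | h'
      · rw [h'.2]
        omega
      · exact (h'.1 ha).elim
    intro pad
    induction pad with
    | nil =>
      intro hk
      exact one [] hk
    | cons x pad ih =>
      intro hk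
      rw [List.length_cons] at hk
      rw [suffixes, List.map_append, act_seqs_append, ih (by omega)]
      exact one (x :: pad) hk
  have h0 : (zero (cutTree l)).act .tt = (thresholds l).getD 0 .ff := by
    rw [act_zero _ (padding l), thresholds]
    cases vec (cutTree l) (padding l) <;> rfl
  -- The tree has at most l.length + 1 leaves, one for each cut and the initial f. This is the
  -- length of the padding, so the last index exceeds the number of leaves.
  have hN : ((thresholds l).getD ((padding l).length + 1) .ff).val = false := by
    by_contra hv
    rw [Bool.not_eq_false] at hv
    have h1 := le_size_of_val_vec hpad hv
    have h2 := size_cutTree_le l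
    simp only [padding, List.length_cons, List.length_map] at h1
    omega
  rw [cutFree, act_seq, act_dUnit', act_seq, act_dComm, act_seq, act_disj, act_weak, h0, act_seq,
    key _ le_rfl, nth_eq, tail_getD, act_seq, act_disj, act_refute _ hN, act_nop, act_dUnit]

end Scr

end DeepInference

/-! ### Sizes and computability of the basic scripts. -/

namespace DeepInference
open Enc

section

variable {A : Type u}

@[simp] theorem esize_scr_dComm : esize A (Scr.dComm : Scr A) = 37 := rfl
@[simp] theorem esize_scr_cComm : esize A (Scr.cComm : Scr A) = 39 := rfl
@[simp] theorem esize_scr_dAssoc : esize A (Scr.dAssoc : Scr A) = 45 := rfl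
@[simp] theorem esize_scr_dAssoc_inv : esize A (Scr.dAssoc' : Scr A) = 47 := rfl
@[simp] theorem esize_scr_cAssoc : esize A (Scr.cAssoc : Scr A) = 47 := rfl
@[simp] theorem esize_scr_cAssoc_inv : esize A (Scr.cAssoc' : Scr A) = 49 := rfl
@[simp] theorem esize_scr_dUnit : esize A (Scr.dUnit : Scr A) = 41 := rfl
@[simp] theorem esize_scr_dUnit_inv : esize A (Scr.dUnit' : Scr A) = 43 := rfl
@[simp] theorem esize_scr_cUnit : esize A (Scr.cUnit : Scr A) = 43 := rfl
@[simp] theorem esize_scr_cUnit_inv : esize A (Scr.cUnit' : Scr A) = 45 := rfl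
@[simp] theorem esize_scr_tt : esize A (Scr.tt : Scr A) = 41 := rfl
@[simp] theorem esize_scr_tt_inv : esize A (Scr.tt' : Scr A) = 43 := rfl
@[simp] theorem esize_scr_ff_inv : esize A (Scr.ff' : Scr A) = 45 := rfl
@[simp] theorem esize_scr_sw : esize A (Scr.sw : Scr A) = 33 := rfl
@[simp] theorem esize_scr_med : esize A (Scr.med : Scr A) = 39 := rfl
@[simp] theorem esize_scr_ac (a : A) : esize A (Scr.ac a) = 15 := rfl
@[simp] theorem esize_scr_ac_inv (a : A) : esize A (Scr.ac' a) = 21 := rfl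
@[simp] theorem esize_scr_aw_inv (a : A) : esize A (Scr.aw' a) = 19 := rfl
@[simp] theorem esize_aiDown (a : A) : esize A (Inst.aiDown a) = 5 := rfl
@[simp] theorem esize_awDown (a : A) : esize A (Inst.awDown a) = 7 := rfl
@[simp] theorem esize_scr_dUnitL : esize A (Scr.dUnitL : Scr A) = 89 := by simp [Scr.dUnitL]
@[simp] theorem esize_scr_cUnitL : esize A (Scr.cUnitL : Scr A) = 91 := by simp [Scr.cUnitL]
@[simp] theorem esize_scr_dSwap : esize A (Scr.dSwap : Scr A) = 285 := by simp [Scr.dSwap]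
@[simp] theorem esize_scr_cSwap : esize A (Scr.cSwap : Scr A) = 299 := by simp [Scr.cSwap]
@[simp] theorem esize_scr_ffTt : esize A (Scr.ffTt : Scr A) = 317 := by simp [Scr.ffTt]
@[simp] theorem esize_scr_dropL (a : A) : esize A (Scr.dropL a) = 135 := by simp [Scr.dropL]
@[simp] theorem esize_scr_dist (a : A) : esize A (Scr.dist a) = 285 := by simp [Scr.dist]

end

section

variable {X : Type u → Type v} {Y : Type u → Type w} [∀ A, Enc A (X A)] [∀ A, Enc A (Y A)]

instance QPT.scr_dComm : QPT (fun (A : Type u) _ (_ : X A) => (Scr.dComm : Scr A)) := by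
  unfold Scr.dComm
  infer_instance
instance QPT.scr_cComm : QPT (fun (A : Type u) _ (_ : X A) => (Scr.cComm : Scr A)) := by
  unfold Scr.cComm
  infer_instance
instance QPT.scr_dAssoc : QPT (fun (A : Type u) _ (_ : X A) => (Scr.dAssoc : Scr A)) := by
  unfold Scr.dAssoc
  infer_instance
instance QPT.scr_dAssoc_inv : QPT (fun (A : Type u) _ (_ : X A) => (Scr.dAssoc' : Scr A)) := by
  unfold Scr.dAssoc'
  infer_instance
instance QPT.scr_cAssoc : QPT (fun (A : Type u) _ (_ : X A) => (Scr.cAssoc : Scr A)) := by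
  unfold Scr.cAssoc
  infer_instance
instance QPT.scr_cAssoc_inv : QPT (fun (A : Type u) _ (_ : X A) => (Scr.cAssoc' : Scr A)) := by
  unfold Scr.cAssoc'
  infer_instance
instance QPT.scr_dUnit : QPT (fun (A : Type u) _ (_ : X A) => (Scr.dUnit : Scr A)) := by
  unfold Scr.dUnit
  infer_instance
instance QPT.scr_dUnit_inv : QPT (fun (A : Type u) _ (_ : X A) => (Scr.dUnit' : Scr A)) := by
  unfold Scr.dUnit'
  infer_instance
instance QPT.scr_cUnit : QPT (fun (A : Type u) _ (_ : X A) => (Scr.cUnit : Scr A)) := by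
  unfold Scr.cUnit
  infer_instance
instance QPT.scr_cUnit_inv : QPT (fun (A : Type u) _ (_ : X A) => (Scr.cUnit' : Scr A)) := by
  unfold Scr.cUnit'
  infer_instance
instance QPT.scr_tt : QPT (fun (A : Type u) _ (_ : X A) => (Scr.tt : Scr A)) := by
  unfold Scr.tt
  infer_instance
instance QPT.scr_tt_inv : QPT (fun (A : Type u) _ (_ : X A) => (Scr.tt' : Scr A)) := by
  unfold Scr.tt'
  infer_instance
instance QPT.scr_ff_inv : QPT (fun (A : Type u) _ (_ : X A) => (Scr.ff' : Scr A)) := by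
  unfold Scr.ff'
  infer_instance
instance QPT.scr_sw : QPT (fun (A : Type u) _ (_ : X A) => (Scr.sw : Scr A)) := by
  unfold Scr.sw
  infer_instance
instance QPT.scr_med : QPT (fun (A : Type u) _ (_ : X A) => (Scr.med : Scr A)) := by
  unfold Scr.med
  infer_instance
instance QPT.scr_ac {a : ∀ (A : Type u) [AtomSet A], X A → A} [ha : QPT a] :
    QPT (fun A _ x => Scr.ac (a A x)) := by
  unfold Scr.ac
  infer_instance
instance QPT.scr_ac_inv {a : ∀ (A : Type u) [AtomSet A], X A → A} [ha : QPT a] :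
    QPT (fun A _ x => Scr.ac' (a A x)) := by
  unfold Scr.ac'
  infer_instance
instance QPT.scr_aw_inv {a : ∀ (A : Type u) [AtomSet A], X A → A} [ha : QPT a] :
    QPT (fun A _ x => Scr.aw' (a A x)) := by
  unfold Scr.aw'
  infer_instance
instance QPT.scr_dUnitL : QPT (fun (A : Type u) _ (_ : X A) => (Scr.dUnitL : Scr A)) := by
  unfold Scr.dUnitL
  infer_instance
instance QPT.scr_cUnitL : QPT (fun (A : Type u) _ (_ : X A) => (Scr.cUnitL : Scr A)) := by
  unfold Scr.cUnitL
  infer_instance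
instance QPT.scr_dSwap : QPT (fun (A : Type u) _ (_ : X A) => (Scr.dSwap : Scr A)) := by
  unfold Scr.dSwap
  infer_instance
instance QPT.scr_cSwap : QPT (fun (A : Type u) _ (_ : X A) => (Scr.cSwap : Scr A)) := by
  unfold Scr.cSwap
  infer_instance
instance QPT.scr_ffTt : QPT (fun (A : Type u) _ (_ : X A) => (Scr.ffTt : Scr A)) := by
  unfold Scr.ffTt
  infer_instance
instance QPT.scr_dropL {a : ∀ (A : Type u) [AtomSet A], X A → A} [ha : QPT a] :
    QPT (fun A _ x => Scr.dropL (a A x)) := by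
  unfold Scr.dropL
  infer_instance
instance QPT.scr_dist {a : ∀ (A : Type u) [AtomSet A], X A → A} [ha : QPT a] :
    QPT (fun A _ x => Scr.dist (a A x)) := by
  unfold Scr.dist
  infer_instance

end

end DeepInference

set_option synthInstance.maxHeartbeats 400000
set_option synthInstance.maxSize 10000

/-! ### Sizes and computability of the recursively defined scripts and substitutions. -/

namespace DeepInference
open Enc

section

variable {A : Type u}

/-- The script spends a bounded amount on each node of the formula, so any large constant will do;
the constants 1000 below have the same origin. -/
theorem Scr.esize_weak_le (φ : Formula A) : esize A (weak φ) ≤ 1000 * esize A φ := by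
  induction φ <;> simp [weak] <;> omega

theorem Scr.esize_coweak_le (φ : Formula A) : esize A (coweak φ) ≤ 1000 * esize A φ := by
  induction φ <;> simp [coweak] <;> omega

theorem Scr.esize_contr_le (φ : Formula A) : esize A (contr φ) ≤ 1000 * esize A φ := by
  induction φ <;> simp [contr] <;> omega

theorem Scr.esize_cocontr_le (φ : Formula A) : esize A (cocontr φ) ≤ 1000 * esize A φ := by
  induction φ <;> simp [cocontr] <;> omega

theorem Scr.esize_refute_le (φ : Formula A) : esize A (refute φ) ≤ 1000 * esize A φ := by
  induction φ with
  | conj α β =>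
    have h1 := esize_coweak_le α
    have h2 := esize_coweak_le β
    cases h : α.val <;> simp [refute, h] <;> omega
  | _ => simp [refute] <;> omega

/-- The encoding of an atom has one node, that of f has three. -/
theorem Formula.esize_sub_le (φ : Formula A) (a : A) : esize A (φ.sub a) ≤ 3 * esize A φ := by
  induction φ with
  | atom b => cases h : aeq b a <;> simp [Formula.sub, h]
  | _ => simp [Formula.sub] <;> omega

theorem Scr.esize_ext_le (φ : Formula A) (a : A) : esize A (ext φ a) ≤ 1000 * esize A φ := by
  induction φ with
  | atom b => cases h : aeq b a <;> simp [ext, h]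
  | _ => simp [ext] <;> omega

theorem Scr.esize_unsub_le (φ : Formula A) (a : A) : esize A (unsub φ a) ≤ 1000 * esize A φ := by
  induction φ with
  | atom b => cases h : aeq b a <;> simp [unsub, h]
  | _ => simp [unsub] <;> omega

theorem Threshold.esize_zero_le (φ : Formula A) : esize A (zero φ) ≤ 1000 * esize A φ := by
  induction φ <;> simp [zero] <;> omega

theorem Formula.esize_insertLeaf_le (a : A) (φ : Formula A) :
    esize A (φ.insertLeaf a) ≤ esize A φ + 10 := by
  induction φ <;> simp [insertLeaf] <;> omega

theorem Formula.esize_firstOf_le [AtomSet A] (a : A) (φ : Formula A) :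
    esize A (φ.firstOf a) ≤ 5 := by
  rcases φ.firstOf_eq a with h | ⟨b, h, -⟩
  · simp [h.1]
  · simp [h]

theorem Scr.esize_within_le (ξ : Ctx A) (s : Scr A) :
    esize A (within ξ s) ≤ 1000 * esize A ξ + esize A s := by
  induction ξ <;> simp [within] <;> omega

theorem Scr.esize_weaken_le [AtomSet A] (T t φ : Formula A) :
    esize A (weaken T t φ) ≤ (3000 * esize A T + 100) * esize A φ := by
  have h : ∀ a, esize A (weaken T t (.atom a)) ≤ 3000 * esize A T + 100 := by
    intro a
    have h1 := T.esize_sub_le (AtomSet.dual a)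
    have h2 := esize_coweak_le (T.sub (AtomSet.dual a))
    cases h : t.isNeg a <;> simp [weaken, h]
    omega
  -- Naming the factor makes the inductive steps linear.
  obtain ⟨m, hm⟩ : ∃ m, 3000 * esize A T + 100 = m := ⟨_, rfl⟩
  rw [hm] at h ⊢
  induction φ with
  | atom a => simpa using h a
  | disj α β hα hβ | conj α β hα hβ => simp [weaken, mul_add]; omega
  | _ => simp [weaken]; omega

end

section

variable {X : Type u → Type v} {Y : Type u → Type w} {Z : Type u → Type v'}
  [∀ A, Enc A (X A)] [∀ A, Enc A (Y A)] [∀ A, Enc A (Z A)]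
  {φ : ∀ (A : Type u) [AtomSet A], X A → Formula A} {a : ∀ (A : Type u) [AtomSet A], X A → A}

instance QPT.weak [hφ : QPT φ] : QPT (fun A _ x => Scr.weak (φ A x)) :=
  QPT.formulaRec (f := fun A _ φ (_ : Unit) => Scr.weak φ) (fun A _ _ => .nop)
    (fun A _ _ => .ffTt) (fun A _ a _ => .rule (.awDown a))
    (fun A _ _ _ _ s t => .dUnit' ⟫ .disj s t) (fun A _ _ _ _ s t => .ff' ⟫ .conj s t)
    (fun _ _ _ => rfl) (fun _ _ _ => rfl) (fun _ _ _ _ => rfl) (fun _ _ _ _ _ => rfl)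
    (fun _ _ _ _ _ => rfl) (q := fun n => 1000 * n) ((isQP_const _).mul isQP_id)
    (fun A _ φ _ => (Scr.esize_weak_le φ).trans (by simp)) (y := fun _ _ _ => ())

instance QPT.coweak [hφ : QPT φ] : QPT (fun A _ x => Scr.coweak (φ A x)) :=
  QPT.formulaRec (f := fun A _ φ (_ : Unit) => Scr.coweak φ) (fun A _ _ => .ffTt)
    (fun A _ _ => .nop) (fun A _ a _ => .aw' a)
    (fun A _ _ _ _ s t => .disj s t ⟫ .tt) (fun A _ _ _ _ s t => .conj s t ⟫ .cUnit)
    (fun _ _ _ => rfl) (fun _ _ _ => rfl) (fun _ _ _ _ => rfl) (fun _ _ _ _ _ => rfl)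
    (fun _ _ _ _ _ => rfl) (q := fun n => 1000 * n) ((isQP_const _).mul isQP_id)
    (fun A _ φ _ => (Scr.esize_coweak_le φ).trans (by simp)) (y := fun _ _ _ => ())

instance QPT.contr [hφ : QPT φ] : QPT (fun A _ x => Scr.contr (φ A x)) :=
  QPT.formulaRec (f := fun A _ φ (_ : Unit) => Scr.contr φ) (fun A _ _ => .dUnit)
    (fun A _ _ => .tt) (fun A _ a _ => .ac a)
    (fun A _ _ _ _ s t => .dSwap ⟫ .disj s t) (fun A _ _ _ _ s t => .med ⟫ .conj s t)
    (fun _ _ _ => rfl) (fun _ _ _ => rfl) (fun _ _ _ _ => rfl) (fun _ _ _ _ _ => rfl)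
    (fun _ _ _ _ _ => rfl) (q := fun n => 1000 * n) ((isQP_const _).mul isQP_id)
    (fun A _ φ _ => (Scr.esize_contr_le φ).trans (by simp)) (y := fun _ _ _ => ())

instance QPT.cocontr [hφ : QPT φ] : QPT (fun A _ x => Scr.cocontr (φ A x)) :=
  QPT.formulaRec (f := fun A _ φ (_ : Unit) => Scr.cocontr φ) (fun A _ _ => .ff')
    (fun A _ _ => .cUnit') (fun A _ a _ => .ac' a)
    (fun A _ _ _ _ s t => .disj s t ⟫ .med) (fun A _ _ _ _ s t => .conj s t ⟫ .cSwap)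
    (fun _ _ _ => rfl) (fun _ _ _ => rfl) (fun _ _ _ _ => rfl) (fun _ _ _ _ _ => rfl)
    (fun _ _ _ _ _ => rfl) (q := fun n => 1000 * n) ((isQP_const _).mul isQP_id)
    (fun A _ φ _ => (Scr.esize_cocontr_le φ).trans (by simp)) (y := fun _ _ _ => ())

instance QPT.zero [hφ : QPT φ] : QPT (fun A _ x => Threshold.zero (φ A x)) :=
  QPT.formulaRec (f := fun A _ φ (_ : Unit) => Threshold.zero φ) (fun A _ _ => .nop)
    (fun A _ _ => .nop) (fun A _ a _ => .nop)
    (fun A _ _ _ _ s t => .cUnit' ⟫ .conj s t ⟫ .dUnit')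
    (fun A _ _ _ _ s t => .cUnit' ⟫ .conj s t ⟫ .dUnit')
    (fun _ _ _ => rfl) (fun _ _ _ => rfl) (fun _ _ _ _ => rfl) (fun _ _ _ _ _ => rfl)
    (fun _ _ _ _ _ => rfl) (q := fun n => 1000 * n) ((isQP_const _).mul isQP_id)
    (fun A _ φ _ => (Threshold.esize_zero_le φ).trans (by simp)) (y := fun _ _ _ => ())

instance QPT.sub [hφ : QPT φ] [ha : QPT a] : QPT (fun A _ x => (φ A x).sub (a A x)) :=
  QPT.formulaRec (f := fun A _ φ (a : A) => φ.sub a) (fun A _ _ => .ff) (fun A _ _ => .tt)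
    (fun A _ b a => bif DeepInference.aeq b a then .ff else .atom b)
    (fun A _ _ _ _ s t => .disj s t) (fun A _ _ _ _ s t => .conj s t)
    (fun _ _ _ => rfl) (fun _ _ _ => rfl) (fun _ _ _ _ => rfl) (fun _ _ _ _ _ => rfl)
    (fun _ _ _ _ _ => rfl) (q := fun n => 3 * n) ((isQP_const _).mul isQP_id)
    (fun A _ φ a => (Formula.esize_sub_le φ a).trans (by simp))

instance QPT.ext [hφ : QPT φ] [ha : QPT a] : QPT (fun A _ x => Scr.ext (φ A x) (a A x)) :=
  QPT.formulaRec (f := fun A _ φ (a : A) => Scr.ext φ a)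
    (fun A _ a => .dUnit' ⟫ .disj .nop (.rule (.awDown a)))
    (fun A _ a => .dUnit' ⟫ .disj .nop (.rule (.awDown a)))
    (fun A _ b a => bif DeepInference.aeq b a then .dUnitL else .dUnit' ⟫ .disj .nop (.rule (.awDown a)))
    (fun A _ _ _ a s t => .disj s t ⟫ .dSwap ⟫ .disj .nop (.ac a))
    (fun A _ _ _ a s t => .conj s t ⟫ .sw ⟫
      .disj (.cComm ⟫ .sw ⟫ .disj .cComm .nop) .nop ⟫ .dAssoc ⟫ .disj .nop (.ac a))
    (fun _ _ _ => rfl) (fun _ _ _ => rfl) (fun _ _ _ _ => rfl) (fun _ _ _ _ _ => rfl)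
    (fun _ _ _ _ _ => rfl) (q := fun n => 1000 * n) ((isQP_const _).mul isQP_id)
    (fun A _ φ a => (Scr.esize_ext_le φ a).trans (by simp))

instance QPT.unsub [hφ : QPT φ] [ha : QPT a] : QPT (fun A _ x => Scr.unsub (φ A x) (a A x)) :=
  QPT.formulaRec (f := fun A _ φ (a : A) => Scr.unsub φ a) (fun A _ _ => .nop) (fun A _ _ => .nop)
    (fun A _ b a => bif DeepInference.aeq b a then .rule (.awDown a) else .nop)
    (fun A _ _ _ _ s t => .disj s t) (fun A _ _ _ _ s t => .conj s t)
    (fun _ _ _ => rfl) (fun _ _ _ => rfl) (fun _ _ _ _ => rfl) (fun _ _ _ _ _ => rfl)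
    (fun _ _ _ _ _ => rfl) (q := fun n => 1000 * n) ((isQP_const _).mul isQP_id)
    (fun A _ φ a => (Scr.esize_unsub_le φ a).trans (by simp))

instance QPT.val [hφ : QPT φ] : QPT (fun A _ x => (φ A x).val) :=
  QPT.formulaRec (f := fun A _ φ (_ : Unit) => φ.val) (fun A _ _ => false) (fun A _ _ => true)
    (fun A _ _ _ => true) (fun A _ _ _ _ s t => bif s then true else t)
    (fun A _ _ _ _ s t => bif s then t else false)
    (fun _ _ _ => rfl) (fun _ _ _ => rfl) (fun _ _ _ _ => rfl) (fun _ _ _ _ _ => rfl)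
    (fun _ _ _ _ _ => rfl) (q := fun n => 3 * n) ((isQP_const _).mul isQP_id)
    (fun A _ φ _ => (esize_bool_le _).trans (by have := one_le_esize (A := A) φ; omega)) (y := fun _ _ _ => ())

instance QPT.refute [hφ : QPT φ] : QPT (fun A _ x => Scr.refute (φ A x)) :=
  QPT.formulaRec (f := fun A _ φ (_ : Unit) => Scr.refute φ) (fun A _ _ => .nop)
    (fun A _ _ => .nop) (fun A _ _ _ => .nop) (fun A _ _ _ _ s t => .disj s t ⟫ .dUnit)
    (fun A _ α β _ s t => bif α.val then .conj (.coweak α) t ⟫ .cUnitL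
      else .conj s (.coweak β) ⟫ .cUnit)
    (fun _ _ _ => rfl) (fun _ _ _ => rfl) (fun _ _ _ _ => rfl) (fun _ _ _ _ _ => rfl)
    (fun _ _ _ _ _ => rfl) (q := fun n => 1000 * n) ((isQP_const _).mul isQP_id)
    (fun A _ φ _ => (Scr.esize_refute_le φ).trans (by simp)) (y := fun _ _ _ => ())

instance QPT.firstOf [hφ : QPT φ] [ha : QPT a] :
    QPT (fun A _ x => (φ A x).firstOf (a A x)) :=
  QPT.formulaRec (f := fun A _ φ (a : A) => φ.firstOf a) (fun A _ _ => .ff) (fun A _ _ => .ff)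
    (fun A _ b a => bif DeepInference.aeq b a then .atom b else bif DeepInference.aeq b (AtomSet.dual a) then .atom b else .ff)
    (fun A _ _ _ _ s t => s.elim t .ff (fun b => .atom b) (fun _ _ => .ff) (fun _ _ => .ff))
    (fun A _ _ _ _ s t => s.elim t .ff (fun b => .atom b) (fun _ _ => .ff) (fun _ _ => .ff))
    (fun _ _ _ => rfl) (fun _ _ _ => rfl) (fun _ _ _ _ => rfl) (fun _ _ _ _ _ => rfl)
    (fun _ _ _ _ _ => rfl) (q := fun n => 5 * n) ((isQP_const _).mul isQP_id)
    (fun A _ φ a => (Formula.esize_firstOf_le a φ).trans (by have := one_le_esize (A := A) φ; omega))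

instance QPT.isNeg [hφ : QPT φ] [ha : QPT a] : QPT (fun A _ x => (φ A x).isNeg (a A x)) := by
  have : QPT (fun A _ (p : Formula A × A) => p.1.isNeg p.2) := by
    unfold Formula.isNeg
    infer_instance
  exact this.compose (f := fun A _ x => (φ A x, a A x)) inferInstance

instance QPT.strengthenAtom {T : ∀ (A : Type u) [AtomSet A], X A → Formula A} [hT : QPT T]
    [hφ : QPT φ] [ha : QPT a] : QPT (fun A _ x => (T A x).strengthenAtom (φ A x) (a A x)) := by
  unfold Formula.strengthenAtom
  infer_instance

instance QPT.weaken {T t : ∀ (A : Type u) [AtomSet A], X A → Formula A} [hT : QPT T] [ht : QPT t]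
    [hφ : QPT φ] : QPT (fun A _ x => Scr.weaken (T A x) (t A x) (φ A x)) :=
  QPT.formulaRec (f := fun A _ φ (p : Formula A × Formula A) => Scr.weaken p.1 p.2 φ)
    (fun A _ _ => .nop) (fun A _ _ => .nop)
    (fun A _ a p => bif p.2.isNeg a then
      .conj .nop (.coweak (p.1.sub (AtomSet.dual a))) ⟫ .cUnit else .nop)
    (fun A _ _ _ _ s t => .disj s t) (fun A _ _ _ _ s t => .conj s t)
    (fun _ _ _ => rfl) (fun _ _ _ => rfl) (fun _ _ _ _ => rfl) (fun _ _ _ _ _ => rfl)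
    (fun _ _ _ _ _ => rfl) (q := fun n => (3000 * n + 100) * n)
    ((((isQP_const _).mul isQP_id).add (isQP_const _)).mul isQP_id)
    (fun A _ φ ⟨T, t⟩ => (Scr.esize_weaken_le T t φ).trans
      (Nat.mul_le_mul (by rw [esize_pair]; omega) (by omega))) (y := fun A _ x => (T A x, t A x))

instance QPT.insertLeaf [hφ : QPT φ] [ha : QPT a] :
    QPT (fun A _ x => (φ A x).insertLeaf (a A x)) :=
  QPT.formulaRec (f := fun A _ φ (a : A) => φ.insertLeaf a) (fun A _ a => .disj (.atom a) .ff)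
    (fun A _ a => .disj (.atom a) .tt) (fun A _ b a => .disj (.atom a) (.atom b))
    (fun A _ α _ _ s t => .disj t α) (fun A _ α β a s t => .disj (.atom a) (.conj α β))
    (fun _ _ _ => rfl) (fun _ _ _ => rfl) (fun _ _ _ _ => rfl) (fun _ _ _ _ _ => rfl)
    (fun _ _ _ _ _ => rfl) (q := fun n => n + 10) (isQP_id.add (isQP_const _))
    (fun A _ φ a => (Formula.esize_insertLeaf_le a φ).trans (by simp))

instance QPT.within {ξ : ∀ (A : Type u) [AtomSet A], X A → Ctx A}
    {s : ∀ (A : Type u) [AtomSet A], X A → Scr A} [hξ : QPT ξ] [hs : QPT s] :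
    QPT (fun A _ x => Scr.within (ξ A x) (s A x)) :=
  QPT.ctxRec (f := fun A _ ξ s => Scr.within ξ s) (fun A _ s => s)
    (fun A _ _ _ z => .sw ⟫ .disj z .nop ⟫ .dAssoc ⟫ .disj .nop .dComm ⟫ .dAssoc')
    (fun A _ _ _ z => .conj .nop .dComm ⟫ .sw ⟫ .disj z .nop ⟫ .dComm ⟫ .dAssoc')
    (fun A _ _ _ z => .cAssoc' ⟫ .conj z .nop ⟫ .cComm ⟫ .sw ⟫ .disj .cComm .nop)
    (fun A _ _ _ z => .conj .nop .cComm ⟫ .cAssoc' ⟫ .conj z .nop ⟫ .cComm ⟫ .sw)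
    (fun _ _ _ => rfl) (fun _ _ _ _ _ => rfl) (fun _ _ _ _ _ => rfl) (fun _ _ _ _ _ => rfl)
    (fun _ _ _ _ _ => rfl) (q := fun n => 1000 * n) ((isQP_const _).mul isQP_id)
    (fun A _ ξ s => (Scr.esize_within_le ξ s).trans (by omega))

end

end DeepInference


/-! ### Computability of list recursions and of a single convolution. -/

namespace DeepInference
open Enc

section

variable {X : Type u → Type v} {Y : Type u → Type w} {Z : Type u → Type v'}
  [∀ A, Enc A (X A)] [∀ A, Enc A (Y A)] [∀ A, Enc A (Z A)]

instance QPT.list_tail {f : ∀ (A : Type u) [AtomSet A], X A → List (Y A)} [hf : QPT f] :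
    QPT (fun A _ x => (f A x).tail) := by
  have : QPT (fun A _ x => DeepInference.listElim (f A x) [] (fun _ l => l)) := inferInstance
  exact this.of_eq fun A _ x => by cases f A x <;> rfl

instance QPT.list_headD {f : ∀ (A : Type u) [AtomSet A], X A → List (Y A)}
    {d : ∀ (A : Type u) [AtomSet A], X A → Y A} [hf : QPT f] [hd : QPT d] :
    QPT (fun A _ x => (f A x).headD (d A x)) := by
  have : QPT (fun A _ x => DeepInference.listElim (f A x) (d A x) (fun y _ => y)) := inferInstance
  exact this.of_eq fun A _ x => by cases f A x <;> rfl

theorem esize_tail_le {A : Type u} {T : Type v} [Enc A T] (l : List T) :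
    esize A l.tail ≤ esize A l := by
  cases l <;> simp; omega

theorem esize_headD_add_le {A : Type u} {T : Type v} [Enc A T] (l : List T) (d : T) :
    esize A (l.headD d) + esize A l.tail ≤ esize A l + esize A d := by
  cases l with
  | nil => simp
  | cons x l =>
    have := one_le_esize (A := A) d
    simp; omega

theorem esize_nth_le {A : Type u} {S : Type v} {T : Type w} [Enc A T] (k : List S) (l : List T)
    (d : T) : esize A (nth k l d) ≤ esize A l + esize A d := by
  induction k generalizing l with
  | nil =>
    have := esize_headD_add_le (A := A) l d
    simp only [nth]; omega
  | cons x k ih =>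
    have := ih l.tail
    have := esize_tail_le (A := A) l
    simp only [nth]; omega

instance QPT.nth {k : ∀ (A : Type u) [AtomSet A], X A → List (Z A)}
    {f : ∀ (A : Type u) [AtomSet A], X A → List (Y A)}
    {d : ∀ (A : Type u) [AtomSet A], X A → Y A} [hk : QPT k] [hf : QPT f] [hd : QPT d] :
    QPT (fun A _ x => nth (k A x) (f A x) (d A x)) :=
  QPT.listRec (f := fun A _ k (p : List (Y A) × Y A) => DeepInference.nth k p.1 p.2)
    (fun A _ p => p.1.headD p.2) (fun A _ _ _ p => (p.1.tail, p.2)) (fun A _ _ _ _ z => z)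
    (fun _ _ _ => rfl) (fun _ _ _ _ _ => rfl) (fun A _ _ p => esize A p) (fun _ _ _ _ => le_rfl)
    (fun A _ k ⟨l, d⟩ => by have := esize_nth_le (A := A) k l d; simp only [esize_pair]; omega)
    (fun A _ x l ⟨m, d⟩ => by have := esize_tail_le (A := A) m; simp only [esize_pair]; omega)
    isQP_id (fun A _ _ _ => by omega) (y := fun A _ x => (f A x, d A x))

theorem esize_suffixes_le {A : Type u} {T : Type v} [Enc A T] (l : List T) :
    esize A (suffixes l) ≤ 3 * esize A l * esize A l := by
  induction l with
  | nil => exact le_rfl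
  | cons x l ih =>
    have h1 := esize_append (A := A) (suffixes l) [x :: l]
    have h2 := one_le_esize (A := A) x
    simp only [suffixes, esize_cons, esize_nil] at h1 ⊢
    nlinarith

instance QPT.suffixes {f : ∀ (A : Type u) [AtomSet A], X A → List (Y A)} [hf : QPT f] :
    QPT (fun A _ x => suffixes (f A x)) :=
  QPT.listRec (f := fun A _ (l : List (Y A)) (_ : Unit) => DeepInference.suffixes l)
    (fun A _ _ => [[]]) (fun A _ _ _ y => y) (fun A _ x l _ z => z ++ [x :: l])
    (fun _ _ _ => rfl) (fun _ _ _ _ _ => rfl) (fun A _ l _ => 3 * esize A l * esize A l)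
    (fun A _ l _ => by
      have := one_le_esize (A := A) l
      rw [esize_unit]
      nlinarith)
    (fun A _ l _ => esize_suffixes_le l)
    (fun A _ x l _ => by
      simp only [esize_cons]
      gcongr <;> omega)
    (q := fun n => 3 * n * n) (((isQP_const 3).mul isQP_id).mul isQP_id)
    (fun A _ l _ => by gcongr <;> omega) (y := fun A _ _ => ())

theorem Scr.esize_seqs_le {A : Type u} (l : List (Scr A)) : esize A (seqs l) ≤ 9 * esize A l := by
  induction l <;> simp [seqs]; omega

instance QPT.seqs {f : ∀ (A : Type u) [AtomSet A], X A → List (Scr A)} [hf : QPT f] :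
    QPT (fun A _ x => Scr.seqs (f A x)) :=
  QPT.listRec (f := fun A _ (l : List (Scr A)) (_ : Unit) => Scr.seqs l)
    (fun A _ _ => .nop) (fun A _ _ _ y => y) (fun A _ x l _ z => x ⟫ z)
    (fun _ _ _ => rfl) (fun _ _ _ _ _ => rfl) (fun A _ l _ => 9 * esize A l)
    (fun A _ l _ => by
      have := one_le_esize (A := A) l
      rw [esize_unit]
      omega)
    (fun A _ l _ => Scr.esize_seqs_le l)
    (fun A _ x l _ => by simp only [esize_cons]; omega)
    (q := fun n => 9 * n) ((isQP_const _).mul isQP_id)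
    (fun A _ l _ => by omega) (y := fun A _ _ => ())

theorem esize_cutTree_le {A : Type u} (l : List (Step A)) :
    esize A (cutTree l) ≤ 11 * esize A l := by
  induction l with
  | nil => simp [cutTree]
  | cons s l ih =>
    rw [cutTree, esize_cons]
    cases s.inst with
    | aiUp a =>
      have := (cutTree l).esize_insertLeaf_le a
      simp only [Inst.elim]; omega
    | _ => simp only [Inst.elim]; omega

instance QPT.cutTree {f : ∀ (A : Type u) [AtomSet A], X A → List (Step A)} [hf : QPT f] :
    QPT (fun A _ x => cutTree (f A x)) :=
  QPT.listRec (f := fun A _ (l : List (Step A)) (_ : Unit) => DeepInference.cutTree l)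
    (fun A _ _ => .ff) (fun A _ _ _ y => y)
    (fun A _ s l _ z => s.inst.elim (fun _ => z) (fun _ => z) (fun _ => z)
      (fun a => z.insertLeaf a) (fun _ => z) (fun _ => z)
      (fun _ _ _ => z) (fun _ _ _ _ => z) (fun _ => z) (fun _ => z))
    (fun _ _ _ => rfl) (fun _ _ _ _ _ => rfl) (fun A _ l _ => 11 * esize A l)
    (fun A _ l _ => by
      have := one_le_esize (A := A) l
      rw [esize_unit]
      omega)
    (fun A _ l _ => esize_cutTree_le l)
    (fun A _ x l _ => by simp only [esize_cons]; omega)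
    (q := fun n => 11 * n) ((isQP_const _).mul isQP_id)
    (fun A _ l _ => by omega) (y := fun A _ _ => ())

instance QPT.padding {f : ∀ (A : Type u) [AtomSet A], X A → List (Step A)} [hf : QPT f] :
    QPT (fun A _ x => padding (f A x)) := by
  have : QPT (fun A _ x => (f A x).map (fun _ => (Formula.ff : Formula A))) :=
    QPT.list_map (g := fun A _ (_ : Step A) (_ : Unit) => (Formula.ff : Formula A))
      (y := fun _ _ _ => ())
  unfold DeepInference.padding
  infer_instance

end

theorem mul_affine_le {l m n n' : ℕ} (c : ℕ) (h : l ≤ m) (h' : n ≤ n') :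
    l * (c * n + 1) + 1 ≤ m * (c * n' + 1) + 1 := by
  gcongr

namespace Threshold

section

variable {A : Type u}

/-- This estimate and those that follow for convolutions bound a whole list by the total size of the
arguments. They only serve to compute a single convolution: iterated over logarithmically many
levels, a quadratic bound would become exponential. -/
theorem esize_dot_le (rev U : List (Formula A)) :
    esize A (dot rev U) ≤ 25 * esize A rev + esize A U := by
  induction rev generalizing U with
  | nil => simp [dot]; omega
  | cons w rev ih =>
    have h1 := ih U.tail
    have h2 := esize_headD_add_le (A := A) U .ff
    simp only [dot, esize_disj, esize_conj, esize_cons, esize_ff] at h2 ⊢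
    omega

theorem esize_conv_le {W U acc : List (Formula A)} {n : ℕ}
    (h : esize A W + esize A acc + esize A U ≤ n) :
    esize A (conv W U acc) ≤ W.length * (25 * n + 1) + 1 := by
  induction W generalizing acc with
  | nil => simp [conv]
  | cons w W ih =>
    have h1 := ih (acc := w :: acc) (by simp only [esize_cons] at *; omega)
    have h2 := esize_dot_le (w :: acc) U
    have h3 := one_le_esize (A := A) W
    simp only [conv, esize_cons, List.length_cons, add_mul] at *
    omega

theorem esize_addDotL_le [AtomSet A] (a : A) (rev : List (Formula A)) (S : List (Scr A)) :
    esize A (addDotL a rev S) ≤ 1000 * esize A rev + esize A S := by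
  induction rev generalizing S with
  | nil => simp [addDotL]; omega
  | cons w rev ih =>
    have h1 := ih S.tail
    have h2 := esize_headD_add_le (A := A) S .nop
    have h3 := Scr.esize_unsub_le w a
    simp [addDotL] at h2 ⊢
    omega

theorem esize_addConvL_le [AtomSet A] (a : A) {S : List (Scr A)} {u₀ : Formula A}
    {W acc : List (Formula A)} {n : ℕ}
    (h : esize A W + esize A acc + esize A S + esize A u₀ + 20 ≤ n) :
    esize A (addConvL a S u₀ W acc) ≤ W.length * (1000 * n + 1) + 1 := by
  induction W generalizing acc with
  | nil => simp [addConvL]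
  | cons w W ih =>
    have h1 := ih (acc := w :: acc) (by simp only [esize_cons] at *; omega)
    have h2 := esize_addDotL_le a acc S
    have h3 := Scr.esize_weak_le (.conj u₀ w)
    simp [addConvL, add_mul] at *
    omega

theorem esize_addDotR_le [AtomSet A] (a : A) (w₀ : Formula A) (S : List (Scr A))
    (U : List (Formula A)) : esize A (addDotR a w₀ S U) ≤
      5000 * esize A S + 1000 * esize A U + 1000 * esize A w₀ + 14000 := by
  induction S generalizing U with
  | nil =>
    have h2 := esize_headD_add_le (A := A) U .ff
    have h3 := Scr.esize_weak_le (.conj (U.headD .ff) w₀)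
    simp [addDotR] at *
    omega
  | cons s S ih =>
    have h1 := ih U.tail
    have h2 := esize_headD_add_le (A := A) U .ff
    have h3 := Scr.esize_unsub_le (U.headD .ff) a
    simp [addDotR] at *
    omega

theorem esize_addConvR_le [AtomSet A] (a : A) {U : List (Formula A)} {w₀ : Formula A}
    {S acc : List (Scr A)} {n : ℕ}
    (h : esize A S + esize A acc + esize A U + esize A w₀ + 20 ≤ n) :
    esize A (addConvR a U w₀ S acc) ≤ S.length * (5000 * n + 1) + 1 := by
  induction S generalizing acc with
  | nil => simp [addConvR]
  | cons s S ih =>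
    have h1 := ih (acc := s :: acc) (by simp only [esize_cons] at *; omega)
    have h2 := esize_addDotR_le a w₀ (s :: acc) U
    simp [addConvR, add_mul] at *
    omega

end

end Threshold

section

variable {X : Type u → Type v} [∀ A, Enc A (X A)]
  {U W rev acc : ∀ (A : Type u) [AtomSet A], X A → List (Formula A)}
  {S T : ∀ (A : Type u) [AtomSet A], X A → List (Scr A)}
  {φ : ∀ (A : Type u) [AtomSet A], X A → Formula A} {a : ∀ (A : Type u) [AtomSet A], X A → A}

open Threshold

instance QPT.dot [hrev : QPT rev] [hU : QPT U] : QPT (fun A _ x => dot (rev A x) (U A x)) :=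
  QPT.listRec (f := fun A _ rev (U : List (Formula A)) => Threshold.dot rev U)
    (fun A _ _ => .ff) (fun A _ _ _ U => U.tail)
    (fun A _ w _ U z => .disj (.conj (U.headD .ff) w) z)
    (fun _ _ _ => rfl) (fun _ _ _ _ _ => rfl) (fun A _ rev U => 25 * esize A rev + esize A U)
    (fun _ _ _ _ => by omega) (fun A _ rev U => esize_dot_le rev U)
    (fun A _ w l U => by have := esize_tail_le (A := A) U; simp only [esize_cons]; omega)
    (q := fun n => 25 * n) ((isQP_const _).mul isQP_id) (fun A _ _ _ => by omega)

instance QPT.conv [hW : QPT W] [hU : QPT U] [hacc : QPT acc] :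
    QPT (fun A _ x => conv (W A x) (U A x) (acc A x)) :=
  QPT.listRec (f := fun A _ W (p : List (Formula A) × List (Formula A)) =>
      Threshold.conv W p.1 p.2)
    (fun A _ _ => []) (fun A _ w _ p => (p.1, w :: p.2))
    (fun A _ w _ p z => Threshold.dot (w :: p.2) p.1 :: z)
    (fun _ _ _ => rfl) (fun _ _ _ _ _ => rfl)
    (fun A _ W p => (esize A W + esize A p) * (25 * (esize A W + esize A p) + 1) + 1)
    (fun A _ W p => by
      generalize esize A p = n
      nlinarith [Nat.zero_le (esize A W)])
    (fun A _ W ⟨U, acc⟩ => (esize_conv_le le_rfl).trans (by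
      have h1 := length_le_esize (A := A) W
      exact mul_affine_le _ (by omega) (by simp only [esize_pair]; omega)))
    (fun A _ w l ⟨U, acc⟩ => by
      simp only [esize_cons, esize_pair]
      exact mul_affine_le _ (by omega) (by omega))
    (q := fun n => n * (25 * n + 1) + 1)
    ((isQP_id.mul (((isQP_const _).mul isQP_id).add (isQP_const _))).add (isQP_const _))
    (fun A _ _ _ => le_rfl) (y := fun A _ x => (U A x, acc A x))

instance QPT.addDotL [ha : QPT a] [hrev : QPT rev] [hS : QPT S] :
    QPT (fun A _ x => addDotL (a A x) (rev A x) (S A x)) :=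
  QPT.listRec (f := fun A _ rev (p : A × List (Scr A)) => Threshold.addDotL p.1 rev p.2)
    (fun A _ p => .dropL p.1) (fun A _ _ _ p => (p.1, p.2.tail))
    (fun A _ w _ p z => .dist p.1 ⟫ .disj (.cAssoc' ⟫ .conj (p.2.headD .nop) (.unsub w p.1)) z)
    (fun _ _ _ => rfl) (fun _ _ _ _ _ => rfl) (fun A _ rev p => 1000 * esize A rev + esize A p)
    (fun _ _ _ _ => by omega)
    (fun A _ rev ⟨a, S⟩ => (esize_addDotL_le a rev S).trans (by rw [esize_pair]; omega))
    (fun A _ w l ⟨a, S⟩ => by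
      have := esize_tail_le (A := A) S; simp only [esize_cons, esize_pair]; omega)
    (q := fun n => 1000 * n) ((isQP_const _).mul isQP_id) (fun A _ _ _ => by omega)
    (y := fun A _ x => (a A x, S A x))

instance QPT.addConvL [ha : QPT a] [hS : QPT S] [hφ : QPT φ] [hW : QPT W] [hacc : QPT acc] :
    QPT (fun A _ x => addConvL (a A x) (S A x) (φ A x) (W A x) (acc A x)) :=
  QPT.listRec (f := fun A _ W (p : A × List (Scr A) × Formula A × List (Formula A)) =>
      Threshold.addConvL p.1 p.2.1 p.2.2.1 W p.2.2.2)
    (fun A _ _ => []) (fun A _ w _ p => (p.1, p.2.1, p.2.2.1, w :: p.2.2.2))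
    (fun A _ w _ p z => (Threshold.addDotL p.1 p.2.2.2 p.2.1 ⟫ .dUnitL ⟫
      .disj (.weak (.conj p.2.2.1 w)) .nop) :: z)
    (fun _ _ _ => rfl) (fun _ _ _ _ _ => rfl)
    (fun A _ W p => (esize A W + esize A p + 20) * (1000 * (esize A W + esize A p + 20) + 1) + 1)
    (fun A _ W p => by
      generalize esize A p = n
      nlinarith [Nat.zero_le (esize A W)])
    (fun A _ W ⟨a, S, φ, acc⟩ => (esize_addConvL_le a le_rfl).trans (by
      have h1 := length_le_esize (A := A) W
      exact mul_affine_le _ (by omega) (by simp only [esize_pair]; omega)))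
    (fun A _ w l ⟨a, S, φ, acc⟩ => by
      simp only [esize_cons, esize_pair]
      exact mul_affine_le _ (by omega) (by omega))
    (q := fun n => (n + 20) * (1000 * (n + 20) + 1) + 1)
    (((isQP_id.add (isQP_const _)).mul (((isQP_const _).mul (isQP_id.add (isQP_const _))).add
      (isQP_const _))).add (isQP_const _))
    (fun A _ _ _ => le_rfl) (y := fun A _ x => (a A x, S A x, φ A x, acc A x))

instance QPT.addDotR [ha : QPT a] [hφ : QPT φ] [hS : QPT S] [hU : QPT U] :
    QPT (fun A _ x => addDotR (a A x) (φ A x) (S A x) (U A x)) :=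
  QPT.listRec (f := fun A _ S (p : A × Formula A × List (Formula A)) =>
      Threshold.addDotR p.1 p.2.1 S p.2.2)
    (fun A _ p => .dropL p.1 ⟫ .dUnit' ⟫ .disj (.weak (.conj (p.2.2.headD .ff) p.2.1)) .nop)
    (fun A _ _ _ p => (p.1, p.2.1, p.2.2.tail))
    (fun A _ s _ p z => .dist p.1 ⟫ .disj (.cAssoc' ⟫ .conj .cComm .nop ⟫ .cAssoc ⟫
      .conj (.unsub (p.2.2.headD .ff) p.1) s) z)
    (fun _ _ _ => rfl) (fun _ _ _ _ _ => rfl)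
    (fun A _ S p => 5000 * esize A S + 1000 * esize A p + 14000)
    (fun _ _ _ _ => by omega)
    (fun A _ S ⟨a, φ, U⟩ => (esize_addDotR_le a φ S U).trans (by simp only [esize_pair]; omega))
    (fun A _ w l ⟨a, φ, U⟩ => by
      have := esize_tail_le (A := A) U; simp only [esize_cons, esize_pair]; omega)
    (q := fun n => 5000 * n + 14000) (((isQP_const _).mul isQP_id).add (isQP_const _))
    (fun A _ _ _ => by omega) (y := fun A _ x => (a A x, φ A x, U A x))

instance QPT.addConvR [ha : QPT a] [hU : QPT U] [hφ : QPT φ] [hS : QPT S] [hT : QPT T] :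
    QPT (fun A _ x => addConvR (a A x) (U A x) (φ A x) (S A x) (T A x)) :=
  QPT.listRec (f := fun A _ S (p : A × List (Formula A) × Formula A × List (Scr A)) =>
      Threshold.addConvR p.1 p.2.1 p.2.2.1 S p.2.2.2)
    (fun A _ _ => []) (fun A _ s _ p => (p.1, p.2.1, p.2.2.1, s :: p.2.2.2))
    (fun A _ s _ p z => Threshold.addDotR p.1 p.2.2.1 (s :: p.2.2.2) p.2.1 :: z)
    (fun _ _ _ => rfl) (fun _ _ _ _ _ => rfl)
    (fun A _ W p => (esize A W + esize A p + 20) * (5000 * (esize A W + esize A p + 20) + 1) + 1)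
    (fun A _ W p => by
      generalize esize A p = n
      nlinarith [Nat.zero_le (esize A W)])
    (fun A _ S ⟨a, U, φ, acc⟩ => (esize_addConvR_le a le_rfl).trans (by
      have h1 := length_le_esize (A := A) S
      exact mul_affine_le _ (by omega) (by simp only [esize_pair]; omega)))
    (fun A _ w l ⟨a, U, φ, acc⟩ => by
      simp only [esize_cons, esize_pair]
      exact mul_affine_le _ (by omega) (by omega))
    (q := fun n => (n + 20) * (5000 * (n + 20) + 1) + 1)
    (((isQP_id.add (isQP_const _)).mul (((isQP_const _).mul (isQP_id.add (isQP_const _))).add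
      (isQP_const _))).add (isQP_const _))
    (fun A _ _ _ => le_rfl) (y := fun A _ x => (a A x, U A x, φ A x, T A x))

end

end DeepInference


/-! ### Balanced trees and the quasipolynomial size of the threshold formulae. -/

namespace DeepInference
open Enc

/-- The length of the longest branch of a formula. -/
def Formula.depth {A : Type u} : Formula A → ℕ
  | .ff => 0
  | .tt => 0
  | .atom _ => 0
  | .disj α β => max α.depth β.depth + 1
  | .conj α β => max α.depth β.depth + 1

/-- Balanced trees. -/
def Formula.Balanced {A : Type u} : Formula A → Prop
  | .ff => True
  | .tt => True
  | .atom _ => True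
  | .disj l r => l.Balanced ∧ r.Balanced ∧ r.size ≤ l.size ∧ l.size ≤ r.size + 1
  | .conj _ _ => False

/-- The new leaf goes into r, which is never the larger half, and the result becomes the left half.
So the left half still exceeds the right one by at most one. -/
theorem Formula.Balanced.insertLeaf {A : Type u} {t : Formula A} (ht : t.Balanced) (a : A) :
    (t.insertLeaf a).Balanced := by
  induction t with
  | ff | tt | atom b => exact ⟨trivial, trivial, le_rfl, Nat.le_succ _⟩
  | disj l r hl hr =>
    obtain ⟨h1, h2, h3, h4⟩ := ht
    refine ⟨hr h2, h1, ?_, ?_⟩ <;> rw [size_insertLeaf] <;> omega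
  | conj => exact ht.elim

theorem balanced_cutTree {A : Type u} (l : List (Step A)) : (cutTree l).Balanced := by
  induction l with
  | nil => trivial
  | cons s l ih =>
    rw [cutTree]
    cases s.inst <;> first | exact ih | exact ih.insertLeaf _

/-- Two halves that differ by at most one and have at most 2 ^ (j + 1) leaves together have at most
2 ^ j leaves each. -/
theorem Formula.Balanced.depth_le {A : Type u} {t : Formula A} (ht : t.Balanced) {j : ℕ}
    (h : t.size ≤ 2 ^ j) : t.depth ≤ j := by
  induction t generalizing j with
  | ff | tt | atom b => exact Nat.zero_le _
  | disj l r hl hr =>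
    obtain ⟨h1, h2, h3, h4⟩ := ht
    have h5 := r.one_le_size
    rw [size] at h
    cases j with
    | zero => simp at h; omega
    | succ j =>
      rw [pow_succ] at h
      have h6 := hl h1 (j := j) (by omega)
      have h7 := hr h2 (j := j) (by omega)
      rw [depth]
      omega
  | conj => exact ht.elim

theorem depth_cutTree_le {A : Type u} (l : List (Step A)) :
    (cutTree l).depth ≤ Nat.log 2 (esize A l) + 1 := by
  refine (balanced_cutTree l).depth_le ((size_cutTree_le l).trans ?_)
  exact (length_le_esize (A := A) l).trans (Nat.lt_pow_succ_log_self (by omega) _).le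

theorem esize_padding_le {A : Type u} (l : List (Step A)) :
    esize A (padding l) ≤ 5 * esize A l := by
  have : esize A (l.map (fun _ => (Formula.ff : Formula A))) ≤ 4 * l.length + 1 := by
    have h : ∀ x ∈ l.map (fun _ => (Formula.ff : Formula A)), esize A x ≤ 3 := by simp
    have := esize_le_of_forall h
    rw [List.length_map] at this
    omega
  have h := length_le_esize (A := A) l
  simp only [padding, esize_cons, esize_ff]
  omega

namespace Threshold

section

variable {A : Type u} {e : ℕ}

theorem headD_le {T : Type v} [Enc A T] {l : List T} {d : T} (h : ∀ x ∈ l, esize A x ≤ e)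
    (hd : esize A d ≤ e) : esize A (l.headD d) ≤ e := by
  cases l with
  | nil => exact hd
  | cons x l => exact h x (by simp)

/-- In contrast to `esize_dot_le`, the bound is linear in the maximal size e of a member, with the
length of the list as factor. That length is the same at all levels of the tree, and this is why the
growth is only quasipolynomial. -/
theorem esize_dot_le_of_forall {rev U : List (Formula A)} (he : 3 ≤ e)
    (hr : ∀ x ∈ rev, esize A x ≤ e) (hU : ∀ x ∈ U, esize A x ≤ e) :
    esize A (dot rev U) ≤ rev.length * (2 * e + 20) + 3 := by
  induction rev generalizing U with
  | nil => simp [dot]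
  | cons w rev ih =>
    have h1 := ih (fun x hx => hr x (by simp [hx])) (fun x hx => hU x (List.mem_of_mem_tail hx))
    have h2 := headD_le (d := .ff) hU (by simpa using he)
    have h3 := hr w (by simp)
    simp only [dot, esize_disj, esize_conj, List.length_cons, add_mul]
    omega

theorem esize_conv_le_of_forall {W U acc : List (Formula A)} (he : 3 ≤ e)
    (hW : ∀ x ∈ W, esize A x ≤ e) (hacc : ∀ x ∈ acc, esize A x ≤ e)
    (hU : ∀ x ∈ U, esize A x ≤ e) :
    ∀ x ∈ conv W U acc, esize A x ≤ (W.length + acc.length) * (2 * e + 20) + 3 := by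
  induction W generalizing acc with
  | nil => simp [conv]
  | cons w W ih =>
    have hacc' : ∀ x ∈ w :: acc, esize A x ≤ e := by
      simpa using ⟨hW w (by simp), hacc⟩
    intro x hx
    rcases List.mem_cons.1 hx with rfl | hx
    · refine (esize_dot_le_of_forall he hacc' hU).trans ?_
      simp only [List.length_cons]
      gcongr ?_ * _ + _
      omega
    · refine (ih (fun x hx => hW x (by simp [hx])) hacc' x hx).trans ?_
      simp only [List.length_cons]
      gcongr ?_ * _ + _
      omega

variable (a : A)

theorem esize_addDotL_le_of_forall {rev : List (Formula A)} {S : List (Scr A)} (he : 3 ≤ e)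
    (hr : ∀ x ∈ rev, esize A x ≤ e) (hS : ∀ x ∈ S, esize A x ≤ e) :
    esize A (addDotL a rev S) ≤ rev.length * (1001 * e + 600) + 200 := by
  induction rev generalizing S with
  | nil => simp [addDotL]
  | cons w rev ih =>
    have h1 := ih (fun x hx => hr x (by simp [hx])) (fun x hx => hS x (List.mem_of_mem_tail hx))
    have h2 := headD_le (d := .nop) hS (by simpa using he)
    have h3 := hr w (by simp)
    have h4 := Scr.esize_unsub_le w a
    simp only [addDotL, esize_scr_disj, esize_scr_conj, esize_seq, esize_scr_dist,
      esize_scr_cAssoc_inv, List.length_cons, add_mul]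
    omega

theorem esize_addConvL_le_of_forall {S : List (Scr A)} {u₀ : Formula A} {W acc : List (Formula A)}
    (he : 3 ≤ e) (hW : ∀ x ∈ W, esize A x ≤ e) (hacc : ∀ x ∈ acc, esize A x ≤ e)
    (hS : ∀ x ∈ S, esize A x ≤ e) (hu : esize A u₀ ≤ e) :
    ∀ x ∈ addConvL a S u₀ W acc,
      esize A x ≤ (W.length + acc.length) * (1001 * e + 600) + 2000 * e + 14000 := by
  induction W generalizing acc with
  | nil => simp [addConvL]
  | cons w W ih =>
    have hw := hW w (by simp)
    have hacc' : ∀ x ∈ w :: acc, esize A x ≤ e := by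
      simpa using ⟨hw, hacc⟩
    intro x hx
    rcases List.mem_cons.1 hx with rfl | hx
    · have h1 := esize_addDotL_le_of_forall a he hacc hS
      have h2 := Scr.esize_weak_le (.conj u₀ w)
      have h3 : acc.length * (1001 * e + 600) ≤
          ((w :: W).length + acc.length) * (1001 * e + 600) := Nat.mul_le_mul_right _ (by omega)
      simp only [esize_seq, esize_scr_disj, esize_scr_dUnitL, esize_nop, esize_conj] at h2 ⊢
      omega
    · refine (ih (fun x hx => hW x (by simp [hx])) hacc' x hx).trans ?_
      simp only [List.length_cons]
      gcongr ?_ * _ + _ + _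
      omega

theorem esize_addDotR_le_of_forall {w₀ : Formula A} {S : List (Scr A)} {U : List (Formula A)}
    (he : 3 ≤ e) (hS : ∀ x ∈ S, esize A x ≤ e) (hU : ∀ x ∈ U, esize A x ≤ e)
    (hw : esize A w₀ ≤ e) :
    esize A (addDotR a w₀ S U) ≤ S.length * (1001 * e + 600) + 2000 * e + 14000 := by
  induction S generalizing U with
  | nil =>
    have h1 := headD_le (d := .ff) hU (by simpa using he)
    have h2 := Scr.esize_weak_le (.conj (U.headD .ff) w₀)
    simp only [addDotR, esize_seq, esize_scr_disj, esize_scr_dropL, esize_scr_dUnit_inv, esize_nop,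
      esize_conj] at h2 ⊢
    omega
  | cons s S ih =>
    have h1 := ih (fun x hx => hS x (by simp [hx])) (fun x hx => hU x (List.mem_of_mem_tail hx))
    have h2 := headD_le (d := .ff) hU (by simpa using he)
    have h3 := hS s (by simp)
    have h4 := Scr.esize_unsub_le (U.headD .ff) a
    simp only [addDotR, esize_scr_disj, esize_scr_conj, esize_seq, esize_scr_dist,
      esize_scr_cAssoc_inv, esize_scr_cAssoc, esize_scr_cComm, esize_nop, List.length_cons, add_mul]
    omega

theorem esize_addConvR_le_of_forall {U : List (Formula A)} {w₀ : Formula A} {S acc : List (Scr A)}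
    (he : 3 ≤ e) (hS : ∀ x ∈ S, esize A x ≤ e) (hacc : ∀ x ∈ acc, esize A x ≤ e)
    (hU : ∀ x ∈ U, esize A x ≤ e) (hw : esize A w₀ ≤ e) :
    ∀ x ∈ addConvR a U w₀ S acc,
      esize A x ≤ (S.length + acc.length) * (1001 * e + 600) + 2000 * e + 14000 := by
  induction S generalizing acc with
  | nil => simp [addConvR]
  | cons s S ih =>
    have hacc' : ∀ x ∈ s :: acc, esize A x ≤ e := by
      simpa using ⟨hS s (by simp), hacc⟩
    intro x hx
    rcases List.mem_cons.1 hx with rfl | hx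
    · refine (esize_addDotR_le_of_forall a he hacc' hU hw).trans ?_
      simp only [List.length_cons]
      gcongr ?_ * _ + _ + _
      omega
    · refine (ih (fun x hx => hS x (by simp [hx])) hacc' x hx).trans ?_
      simp only [List.length_cons]
      gcongr ?_ * _ + _ + _
      omega

/-- A bound for the sizes of the threshold formulae and of the derivations between them. -/
def bound (n d : ℕ) : ℕ := (100000 * n) ^ (d + 1)

theorem bound_mono {m n c d : ℕ} (hm : 1 ≤ m) (h : m ≤ n) (h' : c ≤ d) : bound m c ≤ bound n d :=
  (Nat.pow_le_pow_left (by omega) _).trans (Nat.pow_le_pow_right (by omega) (by omega))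

theorem le_bound {n d : ℕ} (hn : 1 ≤ n) : 100000 * n ≤ bound n d := by
  rw [bound]
  simpa using Nat.pow_le_pow_right (n := 100000 * n) (by omega) (show 1 ≤ d + 1 by omega)

theorem bound_succ (n d : ℕ) : bound n (d + 1) = 100000 * n * bound n d := by
  rw [bound, pow_succ, mul_comm, bound]

/-- One level of the tree is paid for by one factor 100000 * n. The numerals are those of the
estimates for `addConvL` and `addConvR`, which also cover `conv`. -/
theorem affine_le_bound_succ {m n d : ℕ} (hn : 1 ≤ n) (hm : m ≤ 2 * n) :
    m * (1001 * bound n d + 600) + 2000 * bound n d + 14000 ≤ bound n (d + 1) := by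
  have h := le_bound (d := d) hn
  rw [bound_succ]
  generalize bound n d = e at h ⊢
  calc _ ≤ 2 * n * (1001 * e + 600) + 2000 * e + 14000 := by gcongr
    _ ≤ 100000 * n * e := by nlinarith

/-- The exponent is governed by the depth of the tree and not by its size. The base depends only on
the padding, which determines the length of all the lists. -/
theorem esize_vec_le (t : Formula A) (pad : List (Formula A)) {n d : ℕ} (hn : esize A pad ≤ n)
    (hd : t.depth ≤ d) : ∀ x ∈ vec t pad, esize A x ≤ bound n d := by
  have hl := length_le_esize (A := A) pad
  have hb := le_bound (d := d) (show 1 ≤ n by omega)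
  induction t generalizing d with
  | ff | tt | atom b =>
    have hp : ∀ x ∈ pad, esize A x ≤ bound n d := fun x hx => by
      have := esize_mem_le (A := A) hx
      omega
    simp only [vec, List.forall_mem_cons, esize_ff, esize_tt, esize_formula_atom]
    exact ⟨by omega, by omega, hp⟩
  | disj l r hl' hr' | conj l r hl' hr' =>
    rw [Formula.depth] at hd
    obtain ⟨d, rfl⟩ : ∃ c, d = c + 1 := ⟨d - 1, by omega⟩
    have hb' := le_bound (d := d) (show 1 ≤ n by omega)
    intro x hx
    refine (esize_conv_le_of_forall (e := bound n d) (by omega) (hr' (by omega) hb')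
      (by simp) (hl' (by omega) hb') x hx).trans ?_
    refine le_trans ?_ (affine_le_bound_succ (d := d) (show 1 ≤ n by omega)
      (m := pad.length + 2) (by omega))
    rw [length_vec, List.length_nil, add_zero, add_assoc]
    refine Nat.add_le_add (Nat.mul_le_mul_left _ (by omega)) (by omega)

theorem esize_add_le (t : Formula A) (pad : List (Formula A)) {n d : ℕ} (hn : esize A pad ≤ n)
    (hd : t.depth ≤ d) : ∀ x ∈ add a t pad, esize A x ≤ bound n d := by
  have hl := length_le_esize (A := A) pad
  have hb := le_bound (d := d) (show 1 ≤ n by omega)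
  induction t generalizing d with
  | ff | tt => simp [add]
  | atom b =>
    cases h : aeq b a
    · simp [add, h]
    · intro x hx
      simp only [add, h, cond_true, List.mem_cons, List.mem_map] at hx
      rcases hx with rfl | ⟨_, _, rfl⟩ <;> simp <;> omega
  | disj l r hl' hr' | conj l r hl' hr' =>
    rw [Formula.depth] at hd
    obtain ⟨d, rfl⟩ : ∃ c, d = c + 1 := ⟨d - 1, by omega⟩
    have hb' := le_bound (d := d) (show 1 ≤ n by omega)
    have hU := esize_vec_le l pad hn (d := d) (by omega)
    have hW := esize_vec_le r pad hn (d := d) (by omega)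
    have hff : esize A (Formula.ff : Formula A) ≤ bound n d := by simp; omega
    intro x hx
    have := length_add_or a r pad
    cases h : add a l pad with
    | nil =>
      simp only [add, h, listElim] at hx
      refine (esize_addConvR_le_of_forall a (e := bound n d) (by omega) (hr' (by omega) hb')
        (by simp) hU (headD_le hW hff) x hx).trans (affine_le_bound_succ (by omega) ?_)
      rcases this with h | h <;> rw [h.2] <;> simp; omega
    | cons s S =>
      simp only [add, h, listElim] at hx
      rw [← h] at hx
      refine (esize_addConvL_le_of_forall a (e := bound n d) (by omega)
        (fun x hx => hW x (List.mem_of_mem_tail hx)) (by simpa using headD_le hW hff)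
        (hl' (by omega) hb') (headD_le hU hff) x hx).trans
        (affine_le_bound_succ (by omega) ?_)
      simp [length_vec]; omega

/-- The factor 3 leaves room for a pair of two such lists. -/
theorem list_le_bound_succ {T : Type v} [Enc A T] {l : List T} {n d : ℕ} (hn : 1 ≤ n)
    (hl : l.length ≤ 2 * n) (h : ∀ x ∈ l, esize A x ≤ bound n d) :
    3 * esize A l ≤ bound n (d + 1) := by
  have h1 := esize_le_of_forall h
  have h2 := le_bound (d := d) hn
  rw [bound_succ]
  generalize bound n d = e at *
  calc _ ≤ 3 * (2 * n * (e + 1) + 1) := by gcongr; exact h1.trans (by gcongr)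
    _ ≤ _ := by nlinarith

end

end Threshold

open Threshold

theorem isQP_bound {r : ℕ → ℕ} (hr : IsQP r) :
    IsQP (fun n => bound (r n) (Nat.log 2 n + 2)) := by
  have h : IsQP (fun n => (100000 * (r n + 1)) ^ 2) :=
    ((isQP_const _).mul (hr.add (isQP_const 1))).pow 2
  -- The exponent log n + 3 is at most 2 * (log n + 2), so squaring the base suffices. The summand 1
  -- keeps the base positive.
  refine h.pow_log.mono fun n => ?_
  rw [bound, ← pow_mul]
  exact (Nat.pow_le_pow_left (by omega) _).trans (Nat.pow_le_pow_right (by omega) (by omega))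

section

variable {X : Type u → Type v} [∀ A, Enc A (X A)]
  {l : ∀ (A : Type u) [AtomSet A], X A → List (Step A)}
  {a : ∀ (A : Type u) [AtomSet A], X A → A}

theorem QPT.thresholds' : QPT (fun (A : Type u) _ (l : List (Step A)) => thresholds l) := by
  unfold thresholds
  refine QPT.formulaRec_of_bound (f := fun A _ t pad => vec t pad)
    (fun A _ pad => .tt :: .ff :: pad) (fun A _ pad => .tt :: .tt :: pad)
    (fun A _ a pad => .tt :: .atom a :: pad)
    (fun A _ _ _ _ U W => Threshold.conv W U []) (fun A _ _ _ _ U W => Threshold.conv W U [])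
    (fun _ _ _ => rfl) (fun _ _ _ => rfl) (fun _ _ _ _ => rfl) (fun _ _ _ _ _ => rfl)
    -- The values of the recursion are entire lists; depth + 1 instead of depth pays for their
    -- length.
    (fun _ _ _ _ _ => rfl) (fun A _ t pad => bound (esize A pad) (t.depth + 1))
    (fun A _ t pad => (le_bound (one_le_esize _)).trans' (by omega))
    (fun A _ t pad => ?_) (fun A _ α β pad => ?_) (fun A _ α β pad => ?_)
    (fun A _ l => DeepInference.cutTree l) (fun A _ l => DeepInference.padding l)
    (isQP_bound ((isQP_const 5).mul isQP_id)) (fun A _ l => ?_)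
  · have h1 := length_le_esize (A := A) pad
    have := list_le_bound_succ (A := A) (one_le_esize pad) (by rw [length_vec]; omega)
      (esize_vec_le t pad le_rfl le_rfl)
    omega
  · exact ⟨bound_mono (one_le_esize _) le_rfl (by rw [Formula.depth]; omega),
      bound_mono (one_le_esize _) le_rfl (by rw [Formula.depth]; omega)⟩
  · exact ⟨bound_mono (one_le_esize _) le_rfl (by rw [Formula.depth]; omega),
      bound_mono (one_le_esize _) le_rfl (by rw [Formula.depth]; omega)⟩
  · exact bound_mono (one_le_esize _) (esize_padding_le l) (by have := depth_cutTree_le l; omega)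

instance QPT.thresholds [hl : QPT l] : QPT (fun A _ x => thresholds (l A x)) :=
  QPT.thresholds'.compose hl

/-- The recursion for `add` refers to the threshold formulae of the subtrees, so both are computed
together and the second component is returned. -/
theorem QPT.additions' :
    QPT (fun (A : Type u) _ (p : List (Step A) × A) => additions p.1 p.2) := by
  have : QPT (fun (A : Type u) _ (p : List (Step A) × A) =>
      (vec (DeepInference.cutTree p.1) (DeepInference.padding p.1),
        DeepInference.additions p.1 p.2)) := by
    unfold DeepInference.additions
    refine QPT.formulaRec_of_bound
      (f := fun A _ t (y : A × List (Formula A)) => (vec t y.2, add y.1 t y.2))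
      (fun A _ y => (.tt :: .ff :: y.2, [])) (fun A _ y => (.tt :: .tt :: y.2, []))
      (fun A _ b y => (.tt :: .atom b :: y.2,
        bif DeepInference.aeq b y.1 then .cUnit :: y.2.map (fun _ => .dropL y.1) else []))
      (fun A _ _ _ y l r => (Threshold.conv r.1 l.1 [], DeepInference.listElim l.2
        (Threshold.addConvR y.1 l.1 (r.1.headD .ff) r.2 [])
        (fun _ _ => Threshold.addConvL y.1 l.2 (l.1.headD .ff) r.1.tail [r.1.headD .ff])))
      (fun A _ _ _ y l r => (Threshold.conv r.1 l.1 [], DeepInference.listElim l.2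
        (Threshold.addConvR y.1 l.1 (r.1.headD .ff) r.2 [])
        (fun _ _ => Threshold.addConvL y.1 l.2 (l.1.headD .ff) r.1.tail [r.1.headD .ff])))
      (h2 := ?_)
      (fun _ _ _ => rfl) (fun _ _ _ => rfl) (fun _ _ _ _ => rfl) (fun _ _ _ _ _ => rfl)
      (fun _ _ _ _ _ => rfl) (fun A _ t y => bound (esize A y) (t.depth + 1))
      (fun A _ t y => (le_bound (one_le_esize _)).trans' (by omega))
      (fun A _ t y => ?_) (fun A _ α β y => ?_) (fun A _ α β y => ?_)
      (fun A _ (p : List (Step A) × A) => DeepInference.cutTree p.1)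
      (fun A _ p => (p.2, DeepInference.padding p.1))
      (isQP_bound (((isQP_const 5).mul isQP_id).add (isQP_const 2))) (fun A _ p => ?_)
    · have : QPT (fun (A : Type u) _ (p : A × A × List (Formula A)) =>
          p.2.2.map (fun _ => Scr.dropL p.2.1)) :=
        QPT.list_map (g := fun A _ (_ : Formula A) (a : A) => Scr.dropL a)
          (f := fun A _ (p : A × A × List (Formula A)) => p.2.2)
          (y := fun A _ (p : A × A × List (Formula A)) => p.2.1)
      infer_instance
    · have h1 := length_le_esize (A := A) y.2
      have hy : esize A y.2 ≤ esize A y := by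
        obtain ⟨a, pad⟩ := y
        simp only [esize_pair]
        omega
      have h2 := list_le_bound_succ (A := A) (one_le_esize y) (by rw [length_vec]; omega)
        (esize_vec_le t y.2 hy le_rfl)
      have h3 := list_le_bound_succ (A := A) (l := add y.1 t y.2) (one_le_esize y)
        (by rcases length_add_or y.1 t y.2 with h | h <;> rw [h.2] <;> simp; omega)
        (esize_add_le y.1 t y.2 hy le_rfl)
      have h4 := le_bound (d := t.depth + 1) (one_le_esize (A := A) y)
      have h5 := one_le_esize (A := A) y
      rw [esize_pair]
      omega
    · exact ⟨bound_mono (one_le_esize _) le_rfl (by rw [Formula.depth]; omega),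
        bound_mono (one_le_esize _) le_rfl (by rw [Formula.depth]; omega)⟩
    · exact ⟨bound_mono (one_le_esize _) le_rfl (by rw [Formula.depth]; omega),
        bound_mono (one_le_esize _) le_rfl (by rw [Formula.depth]; omega)⟩
    · obtain ⟨l, a⟩ := p
      dsimp only
      have h1 := esize_padding_le l
      have h2 := depth_cutTree_le l
      have h3 : Nat.log 2 (esize A l) ≤ Nat.log 2 (esize A (l, a)) :=
        Nat.log_mono_right (by rw [esize_pair]; omega)
      exact bound_mono (one_le_esize _) (by simp only [esize_pair, esize_atom]; omega) (by omega)
  exact QPT.snd (hf := this)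

instance QPT.additions [hl : QPT l] [ha : QPT a] :
    QPT (fun A _ x => additions (l A x) (a A x)) :=
  QPT.additions'.compose (f := fun A _ x => (l A x, a A x)) inferInstance

end

end DeepInference


/-! ### Computability of the slices and of the cut-free script. -/

namespace DeepInference
open Enc

section

variable {X : Type u → Type v} [∀ A, Enc A (X A)]
  {T T' : ∀ (A : Type u) [AtomSet A], X A → Formula A}
  {a : ∀ (A : Type u) [AtomSet A], X A → A}
  {s : ∀ (A : Type u) [AtomSet A], X A → Scr A}

instance QPT.identity [hT : QPT T] [ha : QPT a] :
    QPT (fun A _ x => Scr.identity (T A x) (a A x)) := by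
  have : QPT (fun A _ (p : Formula A × A) => Scr.identity p.1 p.2) := by
    unfold Scr.identity
    infer_instance
  exact this.compose (f := fun A _ x => (T A x, a A x)) inferInstance

instance QPT.ignoring [hT : QPT T] [hT' : QPT T'] [hs : QPT s] :
    QPT (fun A _ x => Scr.ignoring (T A x) (T' A x) (s A x)) := by
  have : QPT (fun A _ (p : Formula A × Formula A × Scr A) => Scr.ignoring p.1 p.2.1 p.2.2) := by
    unfold Scr.ignoring
    infer_instance
  exact this.compose (f := fun A _ x => (T A x, T' A x, s A x)) inferInstance

instance QPT.collect [hT : QPT T] [hT' : QPT T'] [hs : QPT s] :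
    QPT (fun A _ x => Scr.collect (T A x) (T' A x) (s A x)) := by
  have : QPT (fun A _ (p : Formula A × Formula A × Scr A) => Scr.collect p.1 p.2.1 p.2.2) := by
    unfold Scr.collect
    infer_instance
  exact this.compose (f := fun A _ x => (T A x, T' A x, s A x)) inferInstance

/-- The data of a slice: the two threshold formulae, the position and the derivation. -/
abbrev SliceData (A : Type u) : Type u := Formula A × Formula A × List (Formula A) × List (Step A)

-- The argument S of `Scr.inst` is a function and not data that a program could receive. It is
-- therefore replaced by the computation of S a from the position and the derivation, for the atom a
-- at hand.
set_option maxHeartbeats 2000000 in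
theorem QPT.inst' : QPT (fun (A : Type u) _ (p : Inst A × SliceData A) =>
    Scr.inst p.2.1 p.2.2.1 (DeepInference.cutTree p.2.2.2.2)
      (fun a => DeepInference.nth p.2.2.2.1 (DeepInference.additions p.2.2.2.2 a) .nop) p.1) := by
  unfold Scr.inst
  infer_instance

theorem QPT.slice' : QPT (fun (A : Type u) _ (p : SliceData A × Formula A) =>
    Scr.slice p.1.1 p.1.2.1 (DeepInference.cutTree p.1.2.2.2)
      (fun a => DeepInference.nth p.1.2.2.1 (DeepInference.additions p.1.2.2.2 a) .nop)
      p.1.2.2.2 p.2) := by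
  have : QPT (fun (A : Type u) _ (q : Step A × SliceData A) => Scr.inst q.2.1 q.2.2.1
      (DeepInference.cutTree q.2.2.2.2)
      (fun a => DeepInference.nth q.2.2.2.1 (DeepInference.additions q.2.2.2.2 a) .nop)
      q.1.inst) :=
    QPT.inst'.compose (f := fun A _ (q : Step A × SliceData A) => (q.1.inst, q.2)) inferInstance
  have := QPT.list_map (X := fun A => SliceData A × Formula A)
    (g := fun A _ (s : Step A) (p : SliceData A) => Scr.collect p.1 p.2.1 (Scr.within s.ctx
      (Scr.inst p.1 p.2.1 (DeepInference.cutTree p.2.2.2)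
        (fun a => DeepInference.nth p.2.2.1 (DeepInference.additions p.2.2.2 a) .nop) s.inst)))
    (f := fun A _ p => p.1.2.2.2) (y := fun A _ p => p.1)
  unfold Scr.slice Scr.derivation
  infer_instance

theorem QPT.cutFree' : QPT (fun (A : Type u) _ (p : List (Step A) × Formula A) =>
    Scr.cutFree p.1 p.2) := by
  have h : QPT (fun (A : Type u) _ (q : List (Formula A) × List (Step A) × Formula A) =>
      Scr.slice (DeepInference.nth q.1 (DeepInference.thresholds q.2.1) .ff)
        (DeepInference.nth q.1 (DeepInference.thresholds q.2.1).tail .ff)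
        (DeepInference.cutTree q.2.1)
        (fun a => DeepInference.nth q.1 (DeepInference.additions q.2.1 a) .nop) q.2.1 q.2.2) :=
    QPT.slice'.compose (f := fun A _ (q : List (Formula A) × List (Step A) × Formula A) =>
      (((DeepInference.nth q.1 (DeepInference.thresholds q.2.1) .ff,
        DeepInference.nth q.1 (DeepInference.thresholds q.2.1).tail .ff, q.1, q.2.1), q.2.2) :
        SliceData A × Formula A)) inferInstance
  have := QPT.list_map (X := fun A => List (Step A) × Formula A) (hg := h)
    (g := fun A _ (k : List (Formula A)) (p : List (Step A) × Formula A) =>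
      Scr.slice (DeepInference.nth k (DeepInference.thresholds p.1) .ff)
        (DeepInference.nth k (DeepInference.thresholds p.1).tail .ff) (DeepInference.cutTree p.1)
        (fun a => DeepInference.nth k (DeepInference.additions p.1 a) .nop) p.1 p.2)
    (f := fun A _ p => DeepInference.suffixes (DeepInference.padding p.1)) (y := fun A _ p => p)
  unfold Scr.cutFree
  infer_instance

instance QPT.cutFree {l : ∀ (A : Type u) [AtomSet A], X A → List (Step A)} [hl : QPT l]
    [hT : QPT T] : QPT (fun A _ x => Scr.cutFree (l A x) (T A x)) :=
  QPT.cutFree'.compose (f := fun A _ x => (l A x, T A x)) inferInstance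

end

end DeepInference


/-! ### The algorithm, its correctness and its running time. -/

namespace DeepInference
open Enc

/-- The conclusion of the last of the steps, or the formula `φ` if there are no steps. -/
def lastConclusion {A : Type u} [AtomSet A] : List (Step A) → Formula A → Formula A
  | [], φ => φ
  | s :: l, φ => listElim l s.conclusion (fun _ _ => lastConclusion l φ)

/-- The input of the algorithm is the derivation alone; the formula that it proves is read off from
its last step. -/
theorem IsChain.lastConclusion_eq {A : Type u} [AtomSet A] {l : List (Step A)} {α β : Formula A}
    (h : IsChain α l β) : lastConclusion l α = β := by
  suffices ∀ (l : List (Step A)) (s : Step A) (α : Formula A), IsChain s.conclusion l β →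
      lastConclusion (s :: l) α = β by
    cases l with
    | nil => exact h
    | cons s l => exact this l s α h.2
  intro l
  induction l with
  | nil => exact fun s α h => h
  | cons t l ih => exact fun s α h => ih t α h.2

theorem QPT.step_conclusion' : QPT (fun (A : Type u) _ (s : Step A) => s.conclusion) := by
  unfold Step.conclusion
  infer_instance

instance QPT.lastConclusion {X : Type u → Type v} [∀ A, Enc A (X A)]
    {l : ∀ (A : Type u) [AtomSet A], X A → List (Step A)}
    {φ : ∀ (A : Type u) [AtomSet A], X A → Formula A} [hl : QPT l] [hφ : QPT φ] :
    QPT (fun A _ x => lastConclusion (l A x) (φ A x)) := by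
  obtain ⟨r, hr, hm, hr'⟩ := QPT.step_conclusion'.{u}.exists_size_le
  have i1 : QPT (fun A _ (p : Step A × List (Step A) × Formula A × Formula A) =>
      p.1.conclusion) :=
    QPT.step_conclusion'.compose
      (f := fun A _ (p : Step A × List (Step A) × Formula A × Formula A) => p.1) inferInstance
  refine QPT.listRec (f := fun A _ (l : List (Step A)) (φ : Formula A) =>
    DeepInference.lastConclusion l φ) (fun A _ φ => φ) (fun A _ _ _ y => y)
    (fun A _ s l _ z => DeepInference.listElim l s.conclusion (fun _ _ => z))
    (fun _ _ _ => rfl) (fun _ _ _ _ _ => rfl) (fun A _ l y => esize A y + r (esize A l))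
    (fun _ _ _ _ => by omega) (fun A _ l y => ?_) (fun A _ x l y => ?_)
    (q := fun n => n + r n) (isQP_id.add hr) (fun A _ l y => ?_)
  · induction l with
    | nil => exact Nat.le_add_right _ _
    | cons s l ih =>
      cases l with
      | nil => exact (hr' A s).trans ((hm (by simp)).trans (Nat.le_add_left _ _))
      | cons t l =>
        have := hm (show esize A (t :: l) ≤ esize A (s :: t :: l) by simp; omega)
        exact ih.trans (by omega)
  · have := hm (show esize A l ≤ esize A (x :: l) by simp; omega)
    omega
  · have := hm (show esize A l ≤ esize A l + esize A y by omega)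
    omega

/-- The cut-free proof that is constructed from a proof. -/
noncomputable def Derivation.eliminateCuts {A : Type u} [AtomSet A] (D : Derivation A) :
    Derivation A :=
  ⟨.tt, ((Scr.cutFree D.steps (lastConclusion D.steps D.premiss)).run .tt).1⟩

theorem QPT.eliminateCuts : QPT (fun (A : Type u) _ (D : Derivation A) => D.eliminateCuts) := by
  have : QPT (fun (A : Type u) _ (D : Derivation A) =>
      (Scr.cutFree D.steps (DeepInference.lastConclusion D.steps D.premiss)).run .tt) :=
    QPT.run
  unfold Derivation.eliminateCuts
  infer_instance

theorem mem_SKS (r : Rule) : r ∈ SKS := by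
  cases r <;> simp [SKS]

/-- Validity and absence of cuts hold for every script; the conclusion alone depends on the input
being a proof. -/
theorem Derivation.IsProof.eliminateCuts {A : Type u} [AtomSet A] {D : Derivation A}
    {α : Formula A} (h : D.IsProof SKS α) : D.eliminateCuts.IsProof (SKS \ {.aiUp}) α := by
  obtain ⟨h0, h, -⟩ := h
  have hα : lastConclusion D.steps D.premiss = α := IsChain.lastConclusion_eq (h0 ▸ h)
  rw [Derivation.eliminateCuts, hα]
  refine ⟨rfl, ?_, fun s hs => ⟨mem_SKS _, Scr.rule_ne _ _ s hs⟩⟩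
  have := Scr.isChain (Scr.cutFree D.steps α) .tt
  rwa [Scr.act_cutFree h] at this

/-- An intermediate formula is the conclusion of one step and the premiss of the next. It is charged
80 for either role, and one more pays for the cell of the list. -/
theorem IsChain.esize_le {A : Type u} [AtomSet A] {l : List (Step A)} {α β : Formula A}
    (h : IsChain α l β) :
    esize A l ≤ 80 * α.size + 161 * (l.map fun s => s.conclusion.size).sum + 1 := by
  induction l generalizing α with
  | nil => simp
  | cons s l ih =>
    obtain ⟨rfl, h⟩ := h
    have h1 := ih h
    have h2 := s.esize_le
    have h3 := s.conclusion.one_le_size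
    simp only [List.map_cons, List.sum_cons, esize_cons]
    omega

theorem Derivation.encode_size_le {A : Type u} [AtomSet A] {D : Derivation A} {β : Formula A}
    (h : IsChain D.premiss D.steps β) : D.encode.size ≤ 161 * D.size := by
  have h1 := h.esize_le
  have h2 := D.premiss.esize_le
  have h3 := D.premiss.one_le_size
  have h4 : D.encode.size = esize A D.premiss + esize A D.steps + 1 := rfl
  rw [h4, Derivation.size]
  omega

/-- The main function of a program for a computable relation. -/
theorem Comp.exists_program {S : SRel.{u}} (hS : Comp S) : ∃ (P : Program) (T : ℕ → ℕ), IsQP T ∧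
    Monotone T ∧ ∀ (A : Type u) [AtomSet A] (x y : SExp A), S A x.size x y →
      P.OutputsInTime x y (T x.size) := by
  obtain ⟨k, hk⟩ := hS
  -- Number 0 is reserved for a main function that calls the computed one, so the fragment is
  -- compiled for address 1.
  obtain ⟨Q, i, hQ⟩ := hk 1
  refine ⟨[.call i (.var 0)] ++ Q, fun n => n + 1 + (n + 1 + qb k n + 1) + 1,
    ((isQP_id.add (isQP_const 1)).add (((isQP_id.add (isQP_const 1)).add (isQP_qb k)).add
      (isQP_const 1))).add (isQP_const 1), fun m n h => ?_, fun A _ x y h => ?_⟩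
  · have := qb_mono (le_refl k) h
    dsimp only
    omega
  · have h1 := hQ [.call i (.var 0)] [] rfl A _ x y h
    rw [List.append_nil] at h1
    have h2 : Fn ([.call i (.var 0)] ++ Q) 0 x y (x.size + 1 + qb k x.size + 1) :=
      ⟨_, rfl, Ev.call h1 (Ev.var rfl)⟩
    obtain ⟨c, hc, h3⟩ := Ev.call h2 (Ev.var (env := [x]) (i := 0) rfl)
    exact ⟨c, h3, hc⟩

end DeepInference

theorem mainTheorem2 :
    ∃ (P : DeepInference.Program) (T : ℕ → ℕ), DeepInference.IsQuasipolynomial T ∧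
      ∀ (A : Type u) [DeepInference.AtomSet A] (α : DeepInference.Formula A)
        (D : DeepInference.Derivation A), D.IsProof DeepInference.SKS α →
        ∃ D' : DeepInference.Derivation A,
          D'.IsProof (DeepInference.SKS \ {DeepInference.Rule.aiUp}) α ∧
          P.OutputsInTime D.encode D'.encode (T D.size) := by
  obtain ⟨P, T, hT, hm, h⟩ := DeepInference.QPT.eliminateCuts.{u}.comp.exists_program
  -- The program is timed by the size of the encoding, which is at most 161 times the size of the
  -- derivation.
  refine ⟨P, fun n => T (161 * n), DeepInference.isQuasipolynomial_of_isQP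
    (hT.comp ((DeepInference.isQP_const 161).mul DeepInference.isQP_id)), fun A _ α D hD =>
    ⟨D.eliminateCuts, hD.eliminateCuts, ?_⟩⟩
  obtain ⟨c, hc, hc'⟩ := h A D.encode D.eliminateCuts.encode ⟨le_rfl, D, rfl, rfl⟩
  refine ⟨c, hc, hc'.trans (hm (DeepInference.Derivation.encode_size_le (β := α) ?_))⟩
  rw [hD.1]
  exact hD.2.1
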